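/- Let $k$ be a field, $n\ge 5$, $q\in k$ a primitive $n$-th root of unity, and $\mathcal C=(a_{ij})_{t\times t}$ a positive definite symmetric Cartan matrix, i.e. an integer matrix with $a_{ii}=2$ and $a_{ij}=a_{ji}\le 0$ for $i\ne j$ that is positive definite. Let $c^i\in(\mathbb Z/n)^t$ be its $i$-th column modulo $n$. **The algebra $\Pi^{\mathcal C}$.** Let $\mathcal Q$ be the quiver with vertex set $(\mathbb Z/n)^t$ and with an arrow $a(x,i):x-c^i\to x$ for each vertex $x$ and each $1\le i\le t$, and let $\overline{\mathcal Q}$ be its double, with additional arrows $a(x,i)^*:x\to x-c^i$. In the path algebra $k\overline{\mathcal Q}$ the product $pp'$ of two paths is "first $p'$, then $p$" if $p$ starts where $p'$ ends, and $0$ otherwise; $e_x$ is the trivial path at $x$. $\Pi^{\mathcal C}$ is the quotient of $k\overline{\mathcal Q}$ by the relations $$a(x,i)a(x,i)^*-a(x+c^i,i)^*a(x+c^i,i)=\frac{q^{x_i}-q^{-x_i}}{q-q^{-1}}\,e_x,$$ $$a(x,j)^*a(x,i)=a(x-c^j,i)\,a(x-c^i,j)^*\qquad(i\ne j).$$ It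 is a Hopf algebra with $$\Delta(e_x)=\sum_{u+v=x}e_u\otimes e_v,\qquad \Delta(a(x,i))=\sum_{u+v=x}\bigl(q^{u_i}e_u\otimes a(v,i)+a(u,i)\otimes e_v\bigr),$$ $$\Delta(a(x,i)^*)=\sum_{u+v=x}\bigl(e_u\otimes a(v,i)^*+q^{-v_i}a(u,i)^*\otimes e_v\bigr),$$ $$\varepsilon(e_x)=\delta_{x,0},\quad \varepsilon(a(x,i))=\varepsilon(a(x,i)^*)=0,$$ $$S(e_x)=e_{-x},\quad S(a(x,i))=-q^{x_i-2}a(-x+c^i,i),\quad S(a(x,i)^*)=-q^{-x_i+2}a(-x+c^i,i)^*.$$ **The Hopf algebras $\mathfrak u_q^{\pm}$.** $\mathfrak u_q^+$ is the Hopf algebra with generators $K_i,E_i$ $(1\le i\le t)$ and relations $K_i^n=1$, $K_iK_j=K_jK_i$, $K_iE_jK_i^{-1}=q^{a_{ij}}E_j$, with $\Delta(K_i)=K_i\otimes K_i$, $\Delta(E_i)=E_i\otimes 1+K_i\otimes E_i$, $\varepsilon(K_i)=1$, $\varepsilon(E_i)=0$, $S(K_i)=K_i^{-1}$, $S(E_i)=-K_i^{-1}E_i$.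 $\mathfrak u_q^-$ is the Hopf algebra with generators $K_i,F_i$ and relations $K_i^n=1$, $K_iK_j=K_jK_i$, $K_iF_jK_i^{-1}=q^{-a_{ij}}F_j$, with $\Delta(K_i)=K_i\otimes K_i$, $\Delta(F_i)=F_i\otimes K_i^{-1}+1\otimes F_i$, $\varepsilon(K_i)=1$, $\varepsilon(F_i)=0$, $S(K_i)=K_i^{-1}$, $S(F_i)=-F_iK_i$. **The Drinfeld double.** Let $\varphi:\mathfrak u_q^+\times\mathfrak u_q^-\to k$ be the skew Hopf pairing, i.e. the bilinear form with $\varphi(1,b)=\varepsilon(b)$, $\varphi(a,1)=\varepsilon(a)$, $\varphi(aa',b)=\sum\varphi(a',b_{1})\varphi(a,b_{2})$, $\varphi(a,bb')=\sum\varphi(a_{1},b)\varphi(a_{2},b')$, that is determined by $$\varphi(K_i,K_j)=q^{-a_{ij}},\quad \varphi(E_i,F_j)=-\frac{\delta_{ij}}{q-q^{-1}},\quad \varphi(E_i,K_j)=\varphi(K_i,F_j)=0.$$ The Drinfeld double $\mathcal D(\mathfrak u_q)$ of this pairing is the Hopf algebra with underlying coalgebra $\mathfrak u_q^+\otimes\mathfrak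 u_q^-$, unit $1\otimes1$, multiplication $$(a\otimes b)(a'\otimes b')=\sum\varphi(a'_{1},S(b_{1}))\;aa'_{2}\otimes b_{2}b'\;\varphi(a'_{3},b_{3})$$ and antipode $S(a\otimes b)=(1\otimes S(b))(S(a)\otimes1)$. **Claim.** Let $I$ be the two-sided ideal of $\mathcal D(\mathfrak u_q)$ generated by the elements $K_i\otimes1-1\otimes K_i$, $1\le i\le t$. Then $I$ is a Hopf ideal of $\mathcal D(\mathfrak u_q)$, and $\Pi^{\mathcal C}\cong\mathcal D(\mathfrak u_q)/I$ as Hopf algebras over $k$. -/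

import Mathlib

noncomputable section

namespace QuiverDouble

open scoped TensorProduct
open Coalgebra

section Generators

variable {k H : Type*} [Field k] [Ring H] [Bialgebra k H]

/-- The subalgebra on which a candidate `S` (an algebra map to the opposite algebra) satisfies
both antipode axioms. -/
def antipodeSubalgebra (S : H →ₐ[k] Hᵐᵒᵖ) : Subalgebra k H where
  carrier := {x |
    LinearMap.mul' k H (((MulOpposite.opLinearEquiv k).symm.toLinearMap ∘ₗ
      S.toLinearMap).rTensor H (comul x)) = algebraMap k H (counit x) ∧
    LinearMap.mul' k H (((MulOpposite.opLinearEquiv k).symm.toLinearMap ∘ₗ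
      S.toLinearMap).lTensor H (comul x)) = algebraMap k H (counit x)}
  algebraMap_mem' r := by
    constructor <;>
    simp [Algebra.TensorProduct.one_def, Algebra.algebraMap_eq_smul_one]
  add_mem' := by
    rintro x y ⟨h1, h2⟩ ⟨h3, h4⟩
    constructor
    · simp only [map_add, h1, h3]
    · simp only [map_add, h2, h4]
  mul_mem' := by
    rintro x y ⟨h1, h2⟩ ⟨h3, h4⟩
    constructor
    · have key : ∀ z w : H ⊗[k] H, LinearMap.mul' k H
          (((MulOpposite.opLinearEquiv k).symm.toLinearMap ∘ₗ S.toLinearMap).rTensor H z) =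
            algebraMap k H (counit x) →
          LinearMap.mul' k H (((MulOpposite.opLinearEquiv k).symm.toLinearMap ∘ₗ
            S.toLinearMap).rTensor H (z * w)) = algebraMap k H (counit x) *
          LinearMap.mul' k H (((MulOpposite.opLinearEquiv k).symm.toLinearMap ∘ₗ
            S.toLinearMap).rTensor H w) := by
        intro z w hz
        induction w with
        | zero => simp
        | add a b ha hb => simp only [mul_add, map_add, ha, hb]
        | tmul a b =>
          have : ∀ z : H ⊗[k] H, LinearMap.mul' k H
            (((MulOpposite.opLinearEquiv k).symm.toLinearMap ∘ₗ
              S.toLinearMap).rTensor H (z * a ⊗ₜ b)) =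
            (S a).unop * LinearMap.mul' k H
              (((MulOpposite.opLinearEquiv k).symm.toLinearMap ∘ₗ
                S.toLinearMap).rTensor H z) * b := by
            intro z
            induction z with
            | zero => simp
            | add a b ha hb => simp only [mul_add, add_mul, map_add, ha, hb]
            | tmul c d => simp [mul_assoc]
          rw [this, hz, ← Algebra.commutes]
          simp [mul_assoc]
      simp only [Bialgebra.comul_mul, Bialgebra.counit_mul, map_mul] at *
      rw [key _ _ h1, h3]
    · have key : ∀ z w : H ⊗[k] H, LinearMap.mul' k H
          (((MulOpposite.opLinearEquiv k).symm.toLinearMap ∘ₗ S.toLinearMap).lTensor H w) =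
            algebraMap k H (counit y) →
          LinearMap.mul' k H (((MulOpposite.opLinearEquiv k).symm.toLinearMap ∘ₗ
            S.toLinearMap).lTensor H (z * w)) =
          LinearMap.mul' k H (((MulOpposite.opLinearEquiv k).symm.toLinearMap ∘ₗ
            S.toLinearMap).lTensor H z) * algebraMap k H (counit y) := by
        intro z w hw
        induction z with
        | zero => simp
        | add a b ha hb => simp only [add_mul, map_add, ha, hb]
        | tmul a b =>
          have : ∀ w : H ⊗[k] H, LinearMap.mul' k H
            (((MulOpposite.opLinearEquiv k).symm.toLinearMap ∘ₗ
              S.toLinearMap).lTensor H (a ⊗ₜ b * w)) =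
            a * LinearMap.mul' k H
              (((MulOpposite.opLinearEquiv k).symm.toLinearMap ∘ₗ
                S.toLinearMap).lTensor H w) * (S b).unop := by
            intro w
            induction w with
            | zero => simp
            | add a b ha hb => simp only [mul_add, add_mul, map_add, ha, hb]
            | tmul c d => simp [mul_assoc]
          rw [this, hw, mul_assoc, Algebra.commutes]
          simp [mul_assoc]
      simp only [Bialgebra.comul_mul, Bialgebra.counit_mul, map_mul] at *
      rw [key _ _ h4, h2]

/-- A bialgebra with an algebra map `S : H → Hᵒᵖ` that satisfies the antipode axioms on algebra
generators is a Hopf algebra with antipode `S`. -/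
@[reducible]
def hopfOfGenerators (S : H →ₐ[k] Hᵐᵒᵖ) (G : Set H) (hG : Algebra.adjoin k G = ⊤)
    (h : G ⊆ antipodeSubalgebra S) : HopfAlgebra k H where
  antipode := (MulOpposite.opLinearEquiv k).symm.toLinearMap ∘ₗ S.toLinearMap
  mul_antipode_rTensor_comul := by
    ext x
    have hx : x ∈ antipodeSubalgebra S := Algebra.adjoin_le h (hG ▸ Algebra.mem_top)
    exact hx.1
  mul_antipode_lTensor_comul := by
    ext x
    have hx : x ∈ antipodeSubalgebra S := Algebra.adjoin_le h (hG ▸ Algebra.mem_top)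
    exact hx.2

end Generators

section Coefficients

variable {k C : Type*} [Field k] [AddCommGroup C] [Module k C] [Coalgebra k C]

/-- A square array of elements of a coalgebra that comultiplies and counits like the matrix
coefficients of a comodule. -/
structure IsComatrix {m : ℕ} (U : Fin m → Fin m → C) : Prop where
  comul_eq : ∀ i j, comul (R := k) (U i j) = ∑ l, U i l ⊗ₜ[k] U l j
  counit_eq : ∀ i j, counit (R := k) (U i j) = if i = j then 1 else 0

theorem exists_comatrix (c : C) : ∃ (m : ℕ) (U : Fin m → Fin m → C) (w : Fin m → Fin m → k),
    IsComatrix (k := k) U ∧ c = ∑ i, ∑ j, w i j • U i j := by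
  classical
  -- `V = {c₁ f(c₂)}` is a finite-dimensional subcomodule that contains `c`
  let R : (C →ₗ[k] k) →ₗ[k] C :=
    { toFun := fun f => TensorProduct.rid k C (f.lTensor C (comul c))
      map_add' := by intro f g; simp [LinearMap.lTensor_add]
      map_smul' := by intro r f; simp [LinearMap.lTensor_smul] }
  let V : Submodule k C := LinearMap.range R
  have hRdef : ∀ f, R f = TensorProduct.rid k C (f.lTensor C (comul c)) := fun f => rfl
  have hfin : FiniteDimensional k V := by
    have hle : V ≤ Submodule.span k ((ℛ k c).index.image (ℛ k c).left : Finset C) := by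
      rintro _ ⟨f, rfl⟩
      rw [hRdef, ← (ℛ k c).eq]
      simp only [map_sum, LinearMap.lTensor_tmul, TensorProduct.rid_tmul]
      refine Submodule.sum_mem _ fun i hi => Submodule.smul_mem _ _ (Submodule.subset_span ?_)
      exact Finset.mem_coe.2 (Finset.mem_image_of_mem _ hi)
    exact Submodule.finiteDimensional_of_le hle
  let v := Module.finBasis k V
  let e := Module.Basis.ofVectorSpace k C
  have hc : c ∈ V := ⟨counit, by rw [hRdef]; simp⟩
  have hΔc : comul (R := k) c = (TensorProduct.equivFinsuppOfBasisRight e (comul (R := k) c)).sum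
      fun i m => m ⊗ₜ e i := by
    rw [← TensorProduct.equivFinsuppOfBasisRight_symm_apply, LinearEquiv.symm_apply_apply]
  have hΔV : ∀ x ∈ V, ∃ z : V ⊗[k] C, V.subtype.rTensor C z = comul (R := k) x := by
    rintro _ ⟨f, rfl⟩
    have h1 : comul (R := k) (R f) = ((TensorProduct.rid k C).toLinearMap ∘ₗ
        f.lTensor C ∘ₗ comul).lTensor C (comul (R := k) c) := by
      have h2 : ∀ y : C ⊗[k] C, comul (R := k) (TensorProduct.rid k C (f.lTensor C y)) =
          ((TensorProduct.rid k C).toLinearMap ∘ₗ f.lTensor C).lTensor C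
            (TensorProduct.assoc k C C C (comul.rTensor C y)) := by
        intro y
        induction y with
        | zero => simp
        | add a b ha hb => simp only [map_add, ha, hb]
        | tmul a b =>
          simp only [LinearMap.lTensor_tmul, TensorProduct.rid_tmul, map_smul,
            LinearMap.rTensor_tmul]
          induction comul (R := k) a with
          | zero => simp
          | add p q hp hq => simp only [smul_add, TensorProduct.add_tmul, map_add, hp, hq]
          | tmul p q => simp
      rw [hRdef, h2, coassoc_apply, ← LinearMap.comp_apply, ← LinearMap.lTensor_comp]
      rfl
    rw [h1]
    nth_rw 1 [hΔc]
    refine ⟨(TensorProduct.equivFinsuppOfBasisRight e (comul (R := k) c)).sum fun i _ =>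
      (⟨R (e.coord i), e.coord i, rfl⟩ : V) ⊗ₜ
        ((TensorProduct.rid k C).toLinearMap ∘ₗ f.lTensor C ∘ₗ comul) (e i), ?_⟩
    simp only [Finsupp.sum, map_sum, LinearMap.rTensor_tmul, LinearMap.lTensor_tmul]
    refine Finset.sum_congr rfl fun i _ => ?_
    rw [TensorProduct.equivFinsuppOfBasisRight_apply]
    rfl
  choose! z hz using hΔV
  let U : Fin (Module.finrank k V) → Fin (Module.finrank k V) → C := fun i j =>
    TensorProduct.equivFinsuppOfBasisLeft v (z (v j)) i
  have hv : ∀ j, comul (R := k) (v j : C) = ∑ i, (v i : C) ⊗ₜ[k] U i j := by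
    intro j
    rw [← hz (v j) (v j).2]
    conv_lhs => rw [← (TensorProduct.equivFinsuppOfBasisLeft v).symm_apply_apply (z (v j))]
    rw [TensorProduct.equivFinsuppOfBasisLeft_symm_apply, Finsupp.sum_fintype _ _ (by simp)]
    simp [U]
  have hg : ∀ l, ∃ g : C →ₗ[k] k, ∀ i, g (v i) = if i = l then 1 else 0 := by
    intro l
    obtain ⟨g, hg⟩ := LinearMap.exists_extend (v.coord l)
    refine ⟨g, fun i => ?_⟩
    have := LinearMap.congr_fun hg (v i)
    simp only [LinearMap.comp_apply, Submodule.subtype_apply] at this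
    rw [this, Module.Basis.coord_apply, Module.Basis.repr_self, Finsupp.single_apply]
  choose g hg using hg
  have hU1 : ∀ i j, comul (R := k) (U i j) = ∑ l, U i l ⊗ₜ[k] U l j := by
    intro i j
    have h := coassoc_apply (R := k) (v j : C)
    simp only [hv, map_sum, LinearMap.rTensor_tmul, LinearMap.lTensor_tmul,
      TensorProduct.sum_tmul, TensorProduct.assoc_tmul] at h
    have h' := congrArg (fun y => TensorProduct.lid k (C ⊗[k] C) ((g i).rTensor (C ⊗[k] C) y)) h
    simp only [map_sum, LinearMap.rTensor_tmul, TensorProduct.lid_tmul, hg, ite_smul, one_smul,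
      zero_smul, Finset.sum_ite_eq', Finset.mem_univ, if_true] at h'
    exact h'.symm
  have hU2 : ∀ i j, counit (R := k) (U i j) = if i = j then 1 else 0 := by
    intro i j
    have h := lTensor_counit_comul (R := k) (v j : C)
    simp only [hv, map_sum, LinearMap.lTensor_tmul] at h
    have h' := congrArg (fun y => TensorProduct.lid k k ((g i).rTensor k y)) h
    simp only [map_sum, LinearMap.rTensor_tmul, TensorProduct.lid_tmul, hg, ite_smul, one_smul,
      zero_smul, Finset.sum_ite_eq', Finset.mem_univ, if_true] at h'
    rw [h']
    simp [eq_comm]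
  refine ⟨_, U, fun i j => v.repr ⟨c, hc⟩ j * counit (R := k) (v i : C), ⟨hU1, hU2⟩, ?_⟩
  have h3 : ∀ j, (v j : C) = ∑ i, counit (R := k) (v i : C) • U i j := by
    intro j
    have h := rTensor_counit_comul (R := k) (v j : C)
    simp only [hv, map_sum, LinearMap.rTensor_tmul] at h
    have h' := congrArg (TensorProduct.lid k C) h
    simp only [map_sum, TensorProduct.lid_tmul, one_smul] at h'
    exact h'.symm
  have h4 := congrArg Subtype.val (v.sum_repr ⟨c, hc⟩)
  simp only [Submodule.coe_sum, Submodule.coe_smul] at h4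
  refine h4.symm.trans ?_
  rw [Finset.sum_comm]
  refine Finset.sum_congr rfl fun j _ => ?_
  conv_lhs => rw [h3 j]
  simp [Finset.smul_sum, mul_smul]

/-- Linear maps out of a coalgebra agree if they agree on all matrix coefficients. -/
theorem linearMap_ext_comatrix {M : Type*} [AddCommGroup M] [Module k M] {f g : C →ₗ[k] M}
    (h : ∀ (m : ℕ) (U : Fin m → Fin m → C), IsComatrix (k := k) U → ∀ i j, f (U i j) = g (U i j)) :
    f = g := by
  ext c
  obtain ⟨m, U, w, hU, rfl⟩ := exists_comatrix (k := k) c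
  simp [h m U hU]

end Coefficients

/-- A skew Hopf pairing `φ : A × B → k` of Hopf algebras: `φ(1, b) = ε(b)`, `φ(a, 1) = ε(a)`,
`φ(aa', b) = φ(a' ⊗ a, Δ b)` and `φ(a, bb') = φ(Δ a, b ⊗ b')`. -/
structure SkewHopfPairing (k A B : Type*) [Field k] [Ring A] [Ring B] [HopfAlgebra k A]
    [HopfAlgebra k B] where
  toLin : A →ₗ[k] B →ₗ[k] k
  one_left : ∀ b, toLin 1 b = counit (R := k) b
  one_right : ∀ a, toLin a 1 = counit (R := k) a
  mul_left : ∀ a a' b, toLin (a * a') b =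
    LinearMap.mul' k k (TensorProduct.map (toLin a') (toLin a) (comul (R := k) b))
  mul_right : ∀ a b b', toLin a (b * b') =
    LinearMap.mul' k k (TensorProduct.map (toLin.flip b) (toLin.flip b') (comul (R := k) a))

theorem sum_rotate_three {M : Type*} [AddCommMonoid M] {m m' n : ℕ}
    (f : Fin m → Fin m' → Fin n → M) :
    ∑ l, ∑ r, ∑ p, f l r p = ∑ p, ∑ l, ∑ r, f l r p := by
  rw [eq_comm, Finset.sum_comm]
  exact Finset.sum_congr rfl fun l _ => Finset.sum_comm

theorem sum_rotate_four {M : Type*} [AddCommMonoid M] {m : ℕ}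
    (f : Fin m → Fin m → Fin m → Fin m → M) :
    ∑ l, ∑ r, ∑ n, ∑ p, f l r n p = ∑ p, ∑ n, ∑ l, ∑ r, f l r n p := by
  rw [sum_rotate_three fun l r n => ∑ p, f l r n p]
  conv_rhs => rw [Finset.sum_comm]
  refine Finset.sum_congr rfl fun n _ => ?_
  exact sum_rotate_three fun l r p => f l r n p

section Double

variable {k A B : Type*} [Field k] [Ring A] [Ring B] [HopfAlgebra k A] [HopfAlgebra k B]

theorem IsComatrix.comul_antipode {m : ℕ} {U : Fin m → Fin m → B} (hU : IsComatrix (k := k) U)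
    (i j : Fin m) : comul (R := k) (HopfAlgebra.antipode k (U i j)) =
      ∑ l, HopfAlgebra.antipode k (U l j) ⊗ₜ[k] HopfAlgebra.antipode k (U i l) := by
  have hS1 : ∀ i j, ∑ l, HopfAlgebra.antipode k (U i l) * U l j = if i = j then 1 else 0 := by
    intro i j
    have := HopfAlgebra.mul_antipode_rTensor_comul_apply (R := k) (U i j)
    rw [hU.comul_eq, hU.counit_eq] at this
    simp only [map_sum, LinearMap.rTensor_tmul, LinearMap.mul'_apply] at this
    rw [this]; split_ifs <;> simp
  have hS2 : ∀ i j, ∑ l, U i l * HopfAlgebra.antipode k (U l j) = if i = j then 1 else 0 := by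
    intro i j
    have := HopfAlgebra.mul_antipode_lTensor_comul_apply (R := k) (U i j)
    rw [hU.comul_eq, hU.counit_eq] at this
    simp only [map_sum, LinearMap.lTensor_tmul, LinearMap.mul'_apply] at this
    rw [this]; split_ifs <;> simp
  let X : Matrix (Fin m) (Fin m) (B ⊗[k] B) := Matrix.of fun i j =>
    comul (R := k) (HopfAlgebra.antipode k (U i j))
  let Y : Matrix (Fin m) (Fin m) (B ⊗[k] B) := Matrix.of fun i j => comul (R := k) (U i j)
  let Z : Matrix (Fin m) (Fin m) (B ⊗[k] B) := Matrix.of fun i j =>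
    ∑ l, HopfAlgebra.antipode k (U l j) ⊗ₜ[k] HopfAlgebra.antipode k (U i l)
  have h1 : X * Y = 1 := by
    ext i j
    simp only [X, Y, Matrix.mul_apply, Matrix.of_apply, ← Bialgebra.comul_mul, ← map_sum, hS1,
      Matrix.one_apply]
    split_ifs <;> simp
  have h2 : Y * Z = 1 := by
    ext i j
    simp only [Y, Z, Matrix.mul_apply, Matrix.of_apply, hU.comul_eq, Finset.mul_sum,
      Finset.sum_mul, Algebra.TensorProduct.tmul_mul_tmul]
    rw [Finset.sum_comm]
    have : ∀ r, ∑ x, ∑ p, (U i p * HopfAlgebra.antipode k (U r j)) ⊗ₜ[k]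
        (U p x * HopfAlgebra.antipode k (U x r)) =
        (U i r * HopfAlgebra.antipode k (U r j)) ⊗ₜ[k] (1 : B) := by
      intro r
      rw [Finset.sum_comm]
      simp only [← TensorProduct.tmul_sum, hS2]
      rw [Finset.sum_eq_single r]
      · simp
      · intro b _ hb; simp [hb]
      · simp
    rw [Finset.sum_congr rfl fun r _ => this r, ← TensorProduct.sum_tmul, hS2, Matrix.one_apply]
    split_ifs <;> simp [Algebra.TensorProduct.one_def]
  have h3 := left_inv_eq_right_inv h1 h2
  exact congrFun (congrFun h3 i) j

theorem IsComatrix.sum_antipode_mul {m : ℕ} {U : Fin m → Fin m → B}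
    (hU : IsComatrix (k := k) U) (i j : Fin m) :
    ∑ l, HopfAlgebra.antipode k (U i l) * U l j = if i = j then 1 else 0 := by
  have := HopfAlgebra.mul_antipode_rTensor_comul_apply (R := k) (U i j)
  rw [hU.comul_eq, hU.counit_eq] at this
  simp only [map_sum, LinearMap.rTensor_tmul, LinearMap.mul'_apply] at this
  rw [this]; split_ifs <;> simp

theorem IsComatrix.sum_mul_antipode {m : ℕ} {U : Fin m → Fin m → B}
    (hU : IsComatrix (k := k) U) (i j : Fin m) :
    ∑ l, U i l * HopfAlgebra.antipode k (U l j) = if i = j then 1 else 0 := by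
  have := HopfAlgebra.mul_antipode_lTensor_comul_apply (R := k) (U i j)
  rw [hU.comul_eq, hU.counit_eq] at this
  simp only [map_sum, LinearMap.lTensor_tmul, LinearMap.mul'_apply] at this
  rw [this]; split_ifs <;> simp

namespace SkewHopfPairing

variable (φ : SkewHopfPairing k A B)

theorem mul_left_comatrix {m : ℕ} {U : Fin m → Fin m → B} (hU : IsComatrix (k := k) U)
    (a a' : A) (i j : Fin m) :
    φ.toLin (a * a') (U i j) = ∑ l, φ.toLin a (U l j) * φ.toLin a' (U i l) := by
  rw [φ.mul_left, hU.comul_eq]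
  simp [mul_comm]

theorem mul_left_antipode {m : ℕ} {U : Fin m → Fin m → B} (hU : IsComatrix (k := k) U)
    (a a' : A) (i j : Fin m) :
    φ.toLin (a * a') (HopfAlgebra.antipode k (U i j)) =
      ∑ l, φ.toLin a (HopfAlgebra.antipode k (U i l)) *
        φ.toLin a' (HopfAlgebra.antipode k (U l j)) := by
  rw [φ.mul_left, hU.comul_antipode]
  simp [mul_comm]

theorem mul_right_comatrix {m : ℕ} {W : Fin m → Fin m → A} (hW : IsComatrix (k := k) W)
    (b b' : B) (i j : Fin m) :
    φ.toLin (W i j) (b * b') = ∑ l, φ.toLin (W i l) b * φ.toLin (W l j) b' := by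
  rw [φ.mul_right, hW.comul_eq]
  simp

/-- The map `b ↦ (a ↦ ∑ φ(a₁, S b) a₂)`. -/
def hitLeftLin : B →ₗ[k] Module.End k A where
  toFun b := (TensorProduct.lid k A).toLinearMap ∘ₗ
    (φ.toLin.flip (HopfAlgebra.antipode k b)).rTensor A ∘ₗ comul
  map_add' x y := by simp [LinearMap.rTensor_add, LinearMap.add_comp, LinearMap.comp_add]
  map_smul' r x := by simp [LinearMap.rTensor_smul, LinearMap.smul_comp, LinearMap.comp_smul]

/-- The map `b ↦ (a ↦ ∑ a₁ φ(a₂, b))`. -/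
def hitRightLin : B →ₗ[k] Module.End k A where
  toFun b := (TensorProduct.rid k A).toLinearMap ∘ₗ (φ.toLin.flip b).lTensor A ∘ₗ comul
  map_add' x y := by simp [LinearMap.lTensor_add, LinearMap.add_comp, LinearMap.comp_add]
  map_smul' r x := by simp [LinearMap.lTensor_smul, LinearMap.smul_comp, LinearMap.comp_smul]

theorem hitLeftLin_comatrix {m : ℕ} {W : Fin m → Fin m → A} (hW : IsComatrix (k := k) W)
    (b : B) (i j : Fin m) : φ.hitLeftLin b (W i j) =
      ∑ l, φ.toLin (W i l) (HopfAlgebra.antipode k b) • W l j := by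
  simp [hitLeftLin, hW.comul_eq]

theorem hitRightLin_comatrix {m : ℕ} {W : Fin m → Fin m → A} (hW : IsComatrix (k := k) W)
    (b : B) (i j : Fin m) : φ.hitRightLin b (W i j) = ∑ l, φ.toLin (W l j) b • W i l := by
  simp [hitRightLin, hW.comul_eq]

/-- `hitLeftLin` as an algebra homomorphism: a left action of `B` on `A`. -/
def hitLeft : B →ₐ[k] Module.End k A := AlgHom.ofLinearMap φ.hitLeftLin
  (linearMap_ext_comatrix (k := k) fun m W hW i j => by
    simp [hitLeftLin_comatrix _ hW, φ.one_right, hW.counit_eq])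
  (fun b b' => linearMap_ext_comatrix (k := k) fun m W hW i j => by
    simp only [hitLeftLin_comatrix _ hW, HopfAlgebra.antipode_mul_antidistrib,
      φ.mul_right_comatrix hW, Module.End.mul_apply, map_sum, map_smul, Finset.smul_sum,
      Finset.sum_smul, smul_smul]
    rw [Finset.sum_comm])

/-- `hitRightLin` as an algebra homomorphism: another left action of `B` on `A`. -/
def hitRight : B →ₐ[k] Module.End k A := AlgHom.ofLinearMap φ.hitRightLin
  (linearMap_ext_comatrix (k := k) fun m W hW i j => by
    simp [hitRightLin_comatrix _ hW, φ.one_right, hW.counit_eq])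
  (fun b b' => linearMap_ext_comatrix (k := k) fun m W hW i j => by
    simp only [hitRightLin_comatrix _ hW,
      φ.mul_right_comatrix hW, Module.End.mul_apply, map_sum, map_smul, Finset.smul_sum,
      Finset.sum_smul, smul_smul]
    rw [Finset.sum_comm]
    simp only [mul_comm])

theorem hitLeft_comatrix {m : ℕ} {W : Fin m → Fin m → A} (hW : IsComatrix (k := k) W)
    (b : B) (i j : Fin m) : φ.hitLeft b (W i j) =
      ∑ l, φ.toLin (W i l) (HopfAlgebra.antipode k b) • W l j :=
  φ.hitLeftLin_comatrix hW b i j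

theorem hitRight_comatrix {m : ℕ} {W : Fin m → Fin m → A} (hW : IsComatrix (k := k) W)
    (b : B) (i j : Fin m) : φ.hitRight b (W i j) = ∑ l, φ.toLin (W l j) b • W i l :=
  φ.hitRightLin_comatrix hW b i j

theorem hitLeft_comm_hitRight (b b' : B) : Commute (φ.hitLeft b) (φ.hitRight b') :=
  linearMap_ext_comatrix (k := k) fun m W hW i j => by
    simp only [Module.End.mul_apply, hitLeft_comatrix _ hW, hitRight_comatrix _ hW, map_sum,
      map_smul, Finset.smul_sum, smul_smul]
    rw [Finset.sum_comm]
    simp only [mul_comm]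

theorem comatrix_mul {m m' : ℕ} {W : Fin m → Fin m → A} (hW : IsComatrix (k := k) W)
    {W' : Fin m' → Fin m' → A} (hW' : IsComatrix (k := k) W') (i j : Fin m) (p q : Fin m') :
    comul (R := k) (W i j * W' p q) =
      ∑ l, ∑ r, (W i l * W' p r) ⊗ₜ[k] (W l j * W' r q) := by
  rw [Bialgebra.comul_mul, hW.comul_eq, hW'.comul_eq]
  simp [Finset.sum_mul_sum]

theorem hitLeft_mul {m : ℕ} {U : Fin m → Fin m → B} (hU : IsComatrix (k := k) U)
    (a a' : A) (i j : Fin m) :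
    φ.hitLeft (U i j) (a * a') = ∑ l, φ.hitLeft (U i l) a * φ.hitLeft (U l j) a' := by
  obtain ⟨n, W, w, hW, rfl⟩ := exists_comatrix (k := k) a
  obtain ⟨n', W', w', hW', rfl⟩ := exists_comatrix (k := k) a'
  have key : ∀ r s p q, φ.hitLeft (U i j) (W r s * W' p q) =
      ∑ l, φ.hitLeft (U i l) (W r s) * φ.hitLeft (U l j) (W' p q) := by
    intro r s p q
    have : φ.hitLeft (U i j) (W r s * W' p q) = ∑ t, ∑ u,
        φ.toLin (W r t * W' p u) (HopfAlgebra.antipode k (U i j)) • (W t s * W' u q) := by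
      change φ.hitLeftLin _ _ = _
      simp [hitLeftLin, comatrix_mul hW hW']
    rw [this]
    simp only [φ.mul_left_antipode hU, hitLeft_comatrix _ hW, hitLeft_comatrix _ hW',
      Finset.sum_mul_sum, Finset.sum_smul, smul_mul_smul_comm]
    rw [eq_comm, Finset.sum_comm]
    refine Finset.sum_congr rfl fun t _ => ?_
    rw [Finset.sum_comm]
  simp only [Finset.sum_mul_sum, map_sum, smul_mul_smul_comm, map_smul, key, Finset.smul_sum]
  simp only [Finset.sum_comm (s := (Finset.univ : Finset (Fin m)))]

theorem hitRight_mul {m : ℕ} {U : Fin m → Fin m → B} (hU : IsComatrix (k := k) U)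
    (a a' : A) (i j : Fin m) :
    φ.hitRight (U i j) (a * a') = ∑ l, φ.hitRight (U l j) a * φ.hitRight (U i l) a' := by
  obtain ⟨n, W, w, hW, rfl⟩ := exists_comatrix (k := k) a
  obtain ⟨n', W', w', hW', rfl⟩ := exists_comatrix (k := k) a'
  have key : ∀ r s p q, φ.hitRight (U i j) (W r s * W' p q) =
      ∑ l, φ.hitRight (U l j) (W r s) * φ.hitRight (U i l) (W' p q) := by
    intro r s p q
    have : φ.hitRight (U i j) (W r s * W' p q) = ∑ t, ∑ u,
        φ.toLin (W t s * W' u q) (U i j) • (W r t * W' p u) := by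
      change φ.hitRightLin _ _ = _
      simp [hitRightLin, comatrix_mul hW hW']
    rw [this]
    simp only [φ.mul_left_comatrix hU, hitRight_comatrix _ hW, hitRight_comatrix _ hW',
      Finset.sum_mul_sum, Finset.sum_smul, smul_mul_smul_comm]
    rw [eq_comm, Finset.sum_comm]
    refine Finset.sum_congr rfl fun t _ => ?_
    rw [Finset.sum_comm]
  simp only [Finset.sum_mul_sum, map_sum, smul_mul_smul_comm, map_smul, key, Finset.smul_sum]
  simp only [Finset.sum_comm (s := (Finset.univ : Finset (Fin m)))]

/-- Left multiplication by `a` in the first tensor factor. -/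
def leftFst : A →ₐ[k] Module.End k (A ⊗[k] B) :=
  (Module.End.rTensorAlgHom k A B).comp (Algebra.lmul k A)

/-- Left multiplication by `b` in the second tensor factor. -/
def leftSnd : B →ₐ[k] Module.End k (A ⊗[k] B) :=
  (Module.End.lTensorAlgHom k B A).comp (Algebra.lmul k B)

theorem leftFst_tmul (a a' : A) (b : B) :
    (leftFst a : Module.End k (A ⊗[k] B)) (a' ⊗ₜ b) = (a * a') ⊗ₜ b := rfl

theorem leftSnd_tmul (b : B) (a' : A) (b' : B) :
    (leftSnd b : Module.End k (A ⊗[k] B)) (a' ⊗ₜ b') = a' ⊗ₜ (b * b') := rfl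

theorem rTensorAlgHom_tmul (f : Module.End k A) (a : A) (b : B) :
    Module.End.rTensorAlgHom k A B f (a ⊗ₜ b) = f a ⊗ₜ b := rfl

/-- The operator `∑ hitLeft(b₁) ⊗ (b₂ ·)` on `A ⊗ B`. -/
def twistLeft : B →ₐ[k] Module.End k (A ⊗[k] B) :=
  (Algebra.TensorProduct.lift ((Module.End.rTensorAlgHom k A B).comp φ.hitLeft)
    leftSnd (fun x y => by
      refine TensorProduct.ext' fun a b => ?_
      simp [leftSnd_tmul, rTensorAlgHom_tmul,
        -Module.End.rTensorAlgHom_apply_apply])).comp (Bialgebra.comulAlgHom k B)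

theorem twistLeft_comatrix {m : ℕ} {U : Fin m → Fin m → B} (hU : IsComatrix (k := k) U)
    (i j : Fin m) (a : A) (b : B) : φ.twistLeft (U i j) (a ⊗ₜ b) = ∑ l,
      φ.hitLeft (U i l) a ⊗ₜ[k] (U l j * b) := by
  rw [twistLeft, AlgHom.comp_apply, Bialgebra.comulAlgHom_apply, hU.comul_eq, map_sum,
    LinearMap.sum_apply]
  rfl

/-- Left multiplication by `1 ⊗ b` in the Drinfeld double,
`a ⊗ b' ↦ ∑ φ(a₁, S b₁) a₂ ⊗ b₂ b' φ(a₃, b₃)`. -/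
def twist : B →ₐ[k] Module.End k (A ⊗[k] B) :=
  (Algebra.TensorProduct.lift φ.twistLeft ((Module.End.rTensorAlgHom k A B).comp φ.hitRight)
    (fun x y => by
      obtain ⟨m, U, w, hU, rfl⟩ := exists_comatrix (k := k) x
      simp only [map_sum, map_smul]
      refine Commute.sum_left _ _ _ fun i _ => Commute.sum_left _ _ _ fun j _ =>
        Commute.smul_left ?_ _
      refine TensorProduct.ext' fun a b => ?_
      have hc := fun b c => LinearMap.congr_fun (φ.hitLeft_comm_hitRight b c) a
      simp only [Module.End.mul_apply] at hc
      simp only [Module.End.mul_apply, AlgHom.comp_apply, rTensorAlgHom_tmul,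
        twistLeft_comatrix _ hU, hc, map_sum])).comp
    (Bialgebra.comulAlgHom k B)

theorem twist_comatrix {m : ℕ} {U : Fin m → Fin m → B} (hU : IsComatrix (k := k) U)
    (i j : Fin m) (a : A) (b : B) : φ.twist (U i j) (a ⊗ₜ b) = ∑ l, ∑ r,
      φ.hitLeft (U i l) (φ.hitRight (U r j) a) ⊗ₜ[k] (U l r * b) := by
  rw [twist, AlgHom.comp_apply, Bialgebra.comulAlgHom_apply, hU.comul_eq, map_sum,
    LinearMap.sum_apply, Finset.sum_comm]
  refine Finset.sum_congr rfl fun r _ => ?_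
  rw [Algebra.TensorProduct.lift_tmul, Module.End.mul_apply, AlgHom.comp_apply,
    rTensorAlgHom_tmul, twistLeft_comatrix _ hU]

/-- The multiplication of the Drinfeld double, as the map that sends `x` to the operator of left
multiplication by `x`: `a ⊗ b` acts as multiplication by `a` after `twist b`. -/
def doubleMul : A ⊗[k] B →ₗ[k] Module.End k (A ⊗[k] B) :=
  TensorProduct.lift ((LinearMap.mul k (Module.End k (A ⊗[k] B))).compl₁₂
    leftFst.toLinearMap φ.twist.toLinearMap)

theorem doubleMul_tmul (a : A) (b : B) : φ.doubleMul (a ⊗ₜ b) = leftFst a * φ.twist b := by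
  simp [doubleMul]

theorem twist_mul_leftFst (b : B) (a : A) :
    φ.twist b * leftFst a = φ.doubleMul (φ.twist b (a ⊗ₜ 1)) := by
  obtain ⟨m, U, w, hU, rfl⟩ := exists_comatrix (k := k) b
  simp only [map_sum, map_smul, Finset.sum_mul, smul_mul_assoc, LinearMap.sum_apply,
    LinearMap.smul_apply]
  refine Finset.sum_congr rfl fun i _ => Finset.sum_congr rfl fun j _ => ?_
  congr 1
  refine TensorProduct.ext' fun a' b' => ?_
  simp only [twist_comatrix _ hU, map_sum, doubleMul_tmul, LinearMap.sum_apply, mul_one,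
    Module.End.mul_apply]
  simp only [leftFst_tmul, twist_comatrix _ hU,
    hitRight_mul _ hU, hitLeft_mul _ hU, map_sum, TensorProduct.sum_tmul]
  exact sum_rotate_four _

/-- Right multiplication by `b` in the second tensor factor. -/
def rightSnd (b : B) : Module.End k (A ⊗[k] B) := (LinearMap.mulRight k b).lTensor A

theorem rightSnd_tmul (b : B) (a' : A) (b' : B) :
    (rightSnd b : Module.End k (A ⊗[k] B)) (a' ⊗ₜ b') = a' ⊗ₜ (b' * b) := rfl

theorem twist_rightSnd (b b' : B) (z : A ⊗[k] B) :
    φ.twist b (rightSnd b' z) = rightSnd b' (φ.twist b z) := by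
  obtain ⟨m, U, w, hU, rfl⟩ := exists_comatrix (k := k) b
  induction z with
  | zero => simp
  | add x y hx hy => simp only [map_add, hx, hy]
  | tmul x y => simp [twist_comatrix _ hU, rightSnd_tmul, LinearMap.sum_apply, mul_assoc]

theorem doubleMul_leftFst (a : A) (z : A ⊗[k] B) :
    φ.doubleMul (leftFst a z) = leftFst a * φ.doubleMul z := by
  induction z with
  | zero => simp
  | add x y hx hy => simp only [map_add, hx, hy, mul_add]
  | tmul x y => simp [doubleMul_tmul, leftFst_tmul, mul_assoc]

theorem doubleMul_rightSnd (b : B) (z : A ⊗[k] B) :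
    φ.doubleMul (rightSnd b z) = φ.doubleMul z * φ.twist b := by
  induction z with
  | zero => simp
  | add x y hx hy => simp only [map_add, hx, hy, add_mul]
  | tmul x y => simp [doubleMul_tmul, rightSnd_tmul, mul_assoc]

theorem doubleMul_doubleMul (x y : A ⊗[k] B) :
    φ.doubleMul (φ.doubleMul x y) = φ.doubleMul x * φ.doubleMul y := by
  induction x with
  | zero => simp
  | add x x' hx hx' => simp only [map_add, LinearMap.add_apply, hx, hx', add_mul]
  | tmul a b =>
    induction y with
    | zero => simp
    | add y y' hy hy' => simp only [map_add, hy, hy', mul_add]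
    | tmul a' b' =>
      have h : (a' ⊗ₜ b' : A ⊗[k] B) = rightSnd b' (a' ⊗ₜ 1) := by simp [rightSnd_tmul]
      rw [h, doubleMul_tmul, Module.End.mul_apply, twist_rightSnd, doubleMul_leftFst,
        doubleMul_rightSnd, ← twist_mul_leftFst, doubleMul_rightSnd, doubleMul_tmul, map_one]
      simp only [mul_assoc, mul_one]

theorem twist_one_right (b : B) : φ.twist b (1 ⊗ₜ 1) = 1 ⊗ₜ b := by
  obtain ⟨m, U, w, hU, rfl⟩ := exists_comatrix (k := k) b
  have h1 : ∀ b, φ.hitLeft b (1 : A) = counit (R := k) b • 1 := fun b => by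
    change φ.hitLeftLin b 1 = _
    simp [hitLeftLin, Algebra.TensorProduct.one_def, φ.one_left]
  have h2 : ∀ b, φ.hitRight b (1 : A) = counit (R := k) b • 1 := fun b => by
    change φ.hitRightLin b 1 = _
    simp [hitRightLin, Algebra.TensorProduct.one_def, φ.one_left]
  simp only [map_sum, map_smul, LinearMap.sum_apply, LinearMap.smul_apply, twist_comatrix _ hU,
    h1, h2, hU.counit_eq, TensorProduct.tmul_sum, TensorProduct.tmul_smul, mul_one]
  refine Finset.sum_congr rfl fun i _ => Finset.sum_congr rfl fun j _ => ?_
  congr 1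
  rw [Finset.sum_eq_single i, Finset.sum_eq_single j]
  · simp
  · intro r _ hr; simp [hr]
  · simp
  · intro r _ hr; simp [hr.symm]
  · simp

theorem doubleMul_one (x : A ⊗[k] B) : φ.doubleMul x (1 ⊗ₜ 1) = x := by
  induction x with
  | zero => simp
  | add x x' hx hx' => simp only [map_add, LinearMap.add_apply, hx, hx']
  | tmul a b =>
    rw [doubleMul_tmul, Module.End.mul_apply, twist_one_right, leftFst_tmul, mul_one]

end SkewHopfPairing

/-- The Drinfeld double of a skew Hopf pairing: the coalgebra `A ⊗ B` with the multiplication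
`(a ⊗ b)(a' ⊗ b') = ∑ φ(a'₁, S b₁) a a'₂ ⊗ b₂ b' φ(a'₃, b₃)`. -/
def DrinfeldDouble (_φ : SkewHopfPairing k A B) : Type _ :=
  A ⊗[k] B

namespace DrinfeldDouble

variable (φ : SkewHopfPairing k A B)

instance : AddCommGroup (DrinfeldDouble φ) := inferInstanceAs (AddCommGroup (A ⊗[k] B))

instance : Module k (DrinfeldDouble φ) := inferInstanceAs (Module k (A ⊗[k] B))

instance : Coalgebra k (DrinfeldDouble φ) := inferInstanceAs (Coalgebra k (A ⊗[k] B))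

/-- The element `a ⊗ b` of the Drinfeld double. -/
def tmul (a : A) (b : B) : DrinfeldDouble φ := a ⊗ₜ[k] b

/-- Multiplication of the Drinfeld double, linearly in both arguments. -/
def mulLin : DrinfeldDouble φ →ₗ[k] DrinfeldDouble φ →ₗ[k] DrinfeldDouble φ := φ.doubleMul

instance : Ring (DrinfeldDouble φ) where
  __ := (inferInstance : AddCommGroup (DrinfeldDouble φ))
  mul x y := mulLin φ x y
  one := tmul φ 1 1
  mul_assoc x y z := LinearMap.congr_fun (φ.doubleMul_doubleMul x y) z
  one_mul x := LinearMap.congr_fun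
    (show φ.doubleMul (1 ⊗ₜ 1) = 1 by rw [φ.doubleMul_tmul]; simp) x
  mul_one x := φ.doubleMul_one x
  left_distrib x y z := map_add (mulLin φ x) y z
  right_distrib x y z := by
    change mulLin φ (x + y) z = mulLin φ x z + mulLin φ y z
    simp
  zero_mul x := by
    change mulLin φ 0 x = 0
    simp
  mul_zero x := map_zero (mulLin φ x)

instance : Algebra k (DrinfeldDouble φ) := Algebra.ofModule
  (fun r x y => by
    change mulLin φ (r • x) y = r • mulLin φ x y
    simp)
  (fun r x y => map_smul (mulLin φ x) r y)

theorem one_def : (1 : DrinfeldDouble φ) = tmul φ 1 1 := rfl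

theorem tmul_mul (a : A) (b : B) (y : DrinfeldDouble φ) :
    tmul φ a b * y = SkewHopfPairing.leftFst a (φ.twist b y) := by
  change φ.doubleMul (a ⊗ₜ b) y = _
  rw [φ.doubleMul_tmul]
  rfl

/-- `a ↦ a ⊗ 1`, linearly. -/
def fstLin : A →ₗ[k] DrinfeldDouble φ where
  toFun a := tmul φ a 1
  map_add' a a' := TensorProduct.add_tmul a a' (1 : B)
  map_smul' r a := (TensorProduct.smul_tmul' r a (1 : B)).symm

/-- `b ↦ 1 ⊗ b`, linearly. -/
def sndLin : B →ₗ[k] DrinfeldDouble φ where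
  toFun b := tmul φ 1 b
  map_add' b b' := TensorProduct.tmul_add (1 : A) b b'
  map_smul' r b := TensorProduct.tmul_smul r (1 : A) b

/-- `a ↦ a ⊗ 1`. -/
def fst : A →ₐ[k] DrinfeldDouble φ := AlgHom.ofLinearMap (fstLin φ) rfl
  (fun a a' => by
    change _ = tmul φ a 1 * tmul φ a' 1
    rw [tmul_mul, map_one]
    rfl)

/-- `b ↦ 1 ⊗ b`. -/
def snd : B →ₐ[k] DrinfeldDouble φ := AlgHom.ofLinearMap (sndLin φ) rfl
  (fun b b' => by
    change _ = tmul φ 1 b * tmul φ 1 b'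
    rw [tmul_mul, map_one]
    change _ = φ.twist b (1 ⊗ₜ b')
    have h : (1 ⊗ₜ b' : A ⊗[k] B) = SkewHopfPairing.rightSnd b' (1 ⊗ₜ 1) := by
      simp [SkewHopfPairing.rightSnd_tmul]
    rw [h, φ.twist_rightSnd, φ.twist_one_right]
    rfl)

theorem fst_apply (a : A) : fst φ a = tmul φ a 1 := rfl

theorem snd_apply (b : B) : snd φ b = tmul φ 1 b := rfl

theorem fst_mul_snd (a : A) (b : B) : fst φ a * snd φ b = tmul φ a b := by
  rw [fst_apply, tmul_mul, map_one]
  change SkewHopfPairing.leftFst a (1 ⊗ₜ b) = _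
  rw [SkewHopfPairing.leftFst_tmul, mul_one]
  rfl

theorem fst_mul_tmul (a a' : A) (b : B) : fst φ a * tmul φ a' b = tmul φ (a * a') b := by
  rw [← fst_mul_snd, ← mul_assoc, ← map_mul, fst_mul_snd]

theorem tmul_mul_snd (a : A) (b b' : B) : tmul φ a b * snd φ b' = tmul φ a (b * b') := by
  rw [← fst_mul_snd, mul_assoc, ← map_mul, fst_mul_snd]

/-- The commutation relation between the two factors of the Drinfeld double. -/
theorem snd_mul_fst {m : ℕ} {U : Fin m → Fin m → B} (hU : IsComatrix (k := k) U)
    (i j : Fin m) (a : A) : snd φ (U i j) * fst φ a = ∑ l, ∑ r,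
      tmul φ (φ.hitLeft (U i l) (φ.hitRight (U r j) a)) (U l r) := by
  rw [snd_apply, tmul_mul, map_one]
  refine (φ.twist_comatrix hU i j a 1).trans ?_
  simp only [mul_one]
  rfl

theorem counit_tmul (a : A) (b : B) :
    counit (R := k) (tmul φ a b) = counit (R := k) a * counit (R := k) b :=
  (TensorProduct.counit_tmul (R := k) (S := k) a b).trans (mul_comm _ _)

theorem comul_tmul_comatrix {m m' : ℕ} {W : Fin m → Fin m → A} (hW : IsComatrix (k := k) W)
    {U : Fin m' → Fin m' → B} (hU : IsComatrix (k := k) U) (p q : Fin m) (i j : Fin m') :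
    comul (R := k) (tmul φ (W p q) (U i j)) =
      ∑ t, ∑ l, tmul φ (W p t) (U i l) ⊗ₜ[k] tmul φ (W t q) (U l j) := by
  refine (TensorProduct.comul_tmul (R := k) (S := k) (W p q) (U i j)).trans ?_
  rw [hW.comul_eq, hU.comul_eq, TensorProduct.sum_tmul, map_sum]
  simp only [TensorProduct.tmul_sum, map_sum]
  rfl

theorem comul_fst {m : ℕ} {W : Fin m → Fin m → A} (hW : IsComatrix (k := k) W) (p q : Fin m) :
    comul (R := k) (fst φ (W p q)) = ∑ t, fst φ (W p t) ⊗ₜ[k] fst φ (W t q) := by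
  refine (TensorProduct.comul_tmul (R := k) (S := k) (W p q) (1 : B)).trans ?_
  rw [hW.comul_eq, Bialgebra.comul_one, Algebra.TensorProduct.one_def]
  simp only [TensorProduct.sum_tmul, map_sum]
  rfl

theorem comul_snd {m : ℕ} {U : Fin m → Fin m → B} (hU : IsComatrix (k := k) U) (i j : Fin m) :
    comul (R := k) (snd φ (U i j)) = ∑ l, snd φ (U i l) ⊗ₜ[k] snd φ (U l j) := by
  refine (TensorProduct.comul_tmul (R := k) (S := k) (1 : A) (U i j)).trans ?_
  rw [hU.comul_eq, Bialgebra.comul_one, Algebra.TensorProduct.one_def]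
  simp only [TensorProduct.tmul_sum, map_sum]
  rfl

theorem induction_tmul {φ : SkewHopfPairing k A B} {P : DrinfeldDouble φ → Prop} (h0 : P 0)
    (hadd : ∀ x y, P x → P y → P (x + y)) (h : ∀ a b, P (tmul φ a b)) (x) : P x :=
  TensorProduct.induction_on (motive := P) x h0 h hadd

theorem induction_comatrix {φ : SkewHopfPairing k A B} {P : DrinfeldDouble φ → Prop} (h0 : P 0)
    (hadd : ∀ x y, P x → P y → P (x + y)) (hsmul : ∀ (r : k) x, P x → P (r • x))
    (h : ∀ (m m' : ℕ) (W : Fin m → Fin m → A) (U : Fin m' → Fin m' → B),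
      IsComatrix (k := k) W → IsComatrix (k := k) U → ∀ p q i j, P (tmul φ (W p q) (U i j)))
    (x) : P x := by
  have hsum : ∀ {n : ℕ} (f : Fin n → DrinfeldDouble φ), (∀ i, P (f i)) → P (∑ i, f i) :=
    fun f hf => Finset.sum_induction _ P hadd h0 (fun i _ => hf i)
  refine induction_tmul h0 hadd (fun a b => ?_) x
  obtain ⟨m, W, w, hW, rfl⟩ := exists_comatrix (k := k) a
  obtain ⟨m', U, u, hU, rfl⟩ := exists_comatrix (k := k) b
  rw [← fst_mul_snd]
  simp only [map_sum, map_smul, Finset.sum_mul, Finset.mul_sum, smul_mul_smul_comm, fst_mul_snd]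
  exact hsum _ fun i => hsum _ fun j => hsum _ fun p => hsum _ fun q => hsmul _ _ (h _ _ _ _ hW hU _ _ _ _)

theorem counit_mul (x y : DrinfeldDouble φ) :
    counit (R := k) (x * y) = counit (R := k) x * counit (R := k) y := by
  have hl : ∀ (a : A) (y : DrinfeldDouble φ),
      counit (R := k) (fst φ a * y) = counit (R := k) a * counit (R := k) y := by
    intro a y
    induction y using induction_tmul
    · simp
    · rename_i x y hx hy
      simp only [mul_add, map_add, hx, hy]
    rename_i a' b'
    rw [fst_mul_tmul, counit_tmul, counit_tmul, Bialgebra.counit_mul, mul_assoc]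
  have hr : ∀ (b : B) (x : DrinfeldDouble φ),
      counit (R := k) (x * snd φ b) = counit (R := k) x * counit (R := k) b := by
    intro b x
    induction x using induction_tmul
    · simp
    · rename_i x y hx hy
      simp only [add_mul, map_add, hx, hy]
    rename_i a' b'
    rw [tmul_mul_snd, counit_tmul, counit_tmul, Bialgebra.counit_mul, mul_assoc]
  have hm : ∀ (b : B) (a : A), counit (R := k) (snd φ b * fst φ a) =
      counit (R := k) b * counit (R := k) a := by
    intro b a
    obtain ⟨m, W, w, hW, rfl⟩ := exists_comatrix (k := k) a
    obtain ⟨m', U, u, hU, rfl⟩ := exists_comatrix (k := k) b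
    have key : ∀ p q i j, counit (R := k) (snd φ (U i j) * fst φ (W p q)) =
        counit (R := k) (U i j) * counit (R := k) (W p q) := by
      intro p q i j
      have h1 : ∀ b p q, counit (R := k) (φ.hitLeft b (W p q)) =
          φ.toLin (W p q) (HopfAlgebra.antipode k b) := by
        intro b p q
        simp [φ.hitLeft_comatrix hW, hW.counit_eq]
      simp only [snd_mul_fst φ hU, map_sum, counit_tmul, hU.counit_eq, mul_ite, mul_one, mul_zero,
        Finset.sum_ite_eq, Finset.mem_univ, if_true, φ.hitRight_comatrix hW, map_smul, h1,
        smul_eq_mul]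
      have h2 : ∀ x, ∑ y, φ.toLin (W y q) (U x j) *
          φ.toLin (W p y) (HopfAlgebra.antipode k (U i x)) =
          φ.toLin (W p q) (HopfAlgebra.antipode k (U i x) * U x j) := by
        intro x
        rw [φ.mul_right_comatrix hW]
        exact Finset.sum_congr rfl fun _ _ => mul_comm _ _
      simp only [h2, ← map_sum, hU.sum_antipode_mul]
      split_ifs <;> simp [φ.one_right, hW.counit_eq]
    simp only [map_sum, map_smul, Finset.sum_mul, Finset.mul_sum, smul_mul_smul_comm, key]
  induction x using induction_tmul
  · simp
  · rename_i x y hx hy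
    simp only [add_mul, map_add, hx, hy]
  rename_i a b
  induction y using induction_tmul
  · simp
  · rename_i x y hx hy
    simp only [mul_add, map_add, hx, hy]
  rename_i a' b'
  rw [← fst_mul_snd, ← fst_mul_snd]
  rw [show fst φ a * snd φ b * (fst φ a' * snd φ b') =
    fst φ a * (snd φ b * fst φ a' * snd φ b') by simp only [mul_assoc]]
  rw [hl, hr, hm, hr, hl, fst_apply, snd_apply, counit_tmul, counit_tmul, Bialgebra.counit_one,
    Bialgebra.counit_one]
  ring

theorem comul_mul (x y : DrinfeldDouble φ) :
    comul (R := k) (x * y) = comul (R := k) x * comul (R := k) y := by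
  have hl : ∀ (a : A) (y : DrinfeldDouble φ),
      comul (R := k) (fst φ a * y) = comul (R := k) (fst φ a) * comul (R := k) y := by
    intro a y
    obtain ⟨m, W, w, hW, rfl⟩ := exists_comatrix (k := k) a
    induction y using induction_comatrix
    · simp
    · rename_i x y hx hy
      simp only [mul_add, map_add, hx, hy]
    · rename_i r x hx
      simp only [mul_smul_comm, map_smul, hx]
    rename_i n n' W' U hW' hU p q i j
    simp only [map_sum, map_smul, Finset.sum_mul, smul_mul_assoc]
    refine Finset.sum_congr rfl fun s _ => Finset.sum_congr rfl fun t _ => ?_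
    congr 1
    rw [fst_mul_tmul, comul_fst φ hW, comul_tmul_comatrix φ hW' hU]
    refine (TensorProduct.comul_tmul (R := k) (S := k) (W s t * W' p q) (U i j)).trans ?_
    rw [SkewHopfPairing.comatrix_mul hW hW', hU.comul_eq]
    simp only [TensorProduct.sum_tmul, TensorProduct.tmul_sum, map_sum,
      Finset.mul_sum, Finset.sum_mul, Algebra.TensorProduct.tmul_mul_tmul, fst_mul_tmul]
    exact (sum_rotate_three _).trans rfl
  have hr : ∀ (b : B) (x : DrinfeldDouble φ),
      comul (R := k) (x * snd φ b) = comul (R := k) x * comul (R := k) (snd φ b) := by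
    intro b x
    obtain ⟨m, U', w, hU', rfl⟩ := exists_comatrix (k := k) b
    induction x using induction_comatrix
    · simp
    · rename_i x y hx hy
      simp only [add_mul, map_add, hx, hy]
    · rename_i r x hx
      simp only [smul_mul_assoc, map_smul, hx]
    rename_i n n' W U hW hU p q i j
    simp only [map_sum, map_smul, Finset.mul_sum, mul_smul_comm]
    refine Finset.sum_congr rfl fun s _ => Finset.sum_congr rfl fun t _ => ?_
    congr 1
    rw [tmul_mul_snd, comul_snd φ hU', comul_tmul_comatrix φ hW hU]
    refine (TensorProduct.comul_tmul (R := k) (S := k) (W p q) (U i j * U' s t)).trans ?_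
    rw [SkewHopfPairing.comatrix_mul hU hU', hW.comul_eq, TensorProduct.sum_tmul, map_sum]
    simp only [TensorProduct.tmul_sum, map_sum,
      Finset.mul_sum, Finset.sum_mul, Algebra.TensorProduct.tmul_mul_tmul, tmul_mul_snd]
    exact (sum_rotate_three _).trans rfl
  have hm : ∀ (b : B) (a : A), comul (R := k) (snd φ b * fst φ a) =
      comul (R := k) (snd φ b) * comul (R := k) (fst φ a) := by
    intro b a
    obtain ⟨m, W, w, hW, rfl⟩ := exists_comatrix (k := k) a
    obtain ⟨m', U, u, hU, rfl⟩ := exists_comatrix (k := k) b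
    have key : ∀ p q i j, comul (R := k) (snd φ (U i j) * fst φ (W p q)) =
        comul (R := k) (snd φ (U i j)) * comul (R := k) (fst φ (W p q)) := by
      intro p q i j
      let G : Fin m' → Fin m' → Fin m' → Fin m' →
          (A ⊗[k] A →ₗ[k] DrinfeldDouble φ ⊗[k] DrinfeldDouble φ) := fun l r l' r' =>
        TensorProduct.map
          (LinearMap.mulRight k (snd φ (U l r)) ∘ₗ (fst φ).toLinearMap ∘ₗ φ.hitLeft (U i l))
          (LinearMap.mulRight k (snd φ (U l' r')) ∘ₗ (fst φ).toLinearMap ∘ₗ φ.hitRight (U r' j))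
      have hG : ∀ l r l' r' a a', G l r l' r' (a ⊗ₜ a') =
          tmul φ (φ.hitLeft (U i l) a) (U l r) ⊗ₜ tmul φ (φ.hitRight (U r' j) a') (U l' r') := by
        intro l r l' r' a a'
        simp [G, fst_mul_snd]
      have hcoll : ∀ r l', ∑ y, ∑ x, φ.hitRight (U r x) (W p y) ⊗ₜ[k] φ.hitLeft (U x l') (W y q)
          = if r = l' then ∑ y, W p y ⊗ₜ[k] W y q else 0 := by
        intro r l'
        have h1 : ∀ u t, ∑ y, ∑ x, φ.toLin (W u y) (U r x) *
            φ.toLin (W y t) (HopfAlgebra.antipode k (U x l')) =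
            if r = l' then (if u = t then 1 else 0) else 0 := by
          intro u t
          rw [Finset.sum_comm]
          simp only [← φ.mul_right_comatrix hW, ← map_sum, hU.sum_mul_antipode]
          split_ifs <;> simp_all [φ.one_right, hW.counit_eq]
        simp only [φ.hitRight_comatrix hW, φ.hitLeft_comatrix hW, TensorProduct.sum_tmul,
          TensorProduct.tmul_sum, TensorProduct.tmul_smul, ← TensorProduct.smul_tmul']
        rw [sum_rotate_three]
        have h2 : ∀ t u, ∑ y, ∑ x, (φ.toLin (W y t) (HopfAlgebra.antipode k (U x l')) *
            φ.toLin (W u y) (U r x)) • (W p u ⊗ₜ[k] W t q) =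
            (if r = l' then (if u = t then (1 : k) else 0) else 0) • (W p u ⊗ₜ[k] W t q) := by
          intro t u
          simp only [← h1, Finset.sum_smul, mul_comm]
        simp only [Finset.smul_sum, smul_smul]
        refine (Finset.sum_congr rfl fun t _ => (sum_rotate_three _).trans
          (Finset.sum_congr rfl fun u _ => h2 t u)).trans ?_
        by_cases hrl : r = l'
        · simp [hrl]
        · simp [hrl]
      have hΔ : ∀ l r, comul (R := k) (tmul φ (φ.hitLeft (U i l) (φ.hitRight (U r j) (W p q)))
          (U l r)) = ∑ y, ∑ s, G l s s r (W p y ⊗ₜ W y q) := by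
        intro l r
        simp only [hG, φ.hitRight_comatrix hW, φ.hitLeft_comatrix hW, ← fst_mul_snd, map_sum,
          map_smul, Finset.sum_mul, smul_mul_assoc, TensorProduct.sum_tmul,
          TensorProduct.tmul_sum, TensorProduct.tmul_smul, ← TensorProduct.smul_tmul']
        simp only [fst_mul_snd, comul_tmul_comatrix φ hW hU, Finset.smul_sum, smul_smul]
        exact (sum_rotate_three _).trans
          (Finset.sum_congr rfl fun _ _ => (sum_rotate_three _))
      rw [snd_mul_fst φ hU, comul_snd φ hU, comul_fst φ hW, Finset.sum_mul_sum]
      simp only [map_sum, hΔ, Algebra.TensorProduct.tmul_mul_tmul, snd_mul_fst φ hU,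
        TensorProduct.sum_tmul, TensorProduct.tmul_sum]
      have hfold : ∀ l' r' l r, ∑ x, ∑ y,
          tmul φ (φ.hitLeft (U i l) (φ.hitRight (U r x) (W p y))) (U l r) ⊗ₜ[k]
            tmul φ (φ.hitLeft (U x l') (φ.hitRight (U r' j) (W y q))) (U l' r') =
          if r = l' then ∑ y, G l l' l' r' (W p y ⊗ₜ W y q) else 0 := by
        intro l' r' l r
        have := congrArg (G l r l' r') (hcoll r l')
        simp only [map_sum, hG] at this
        rw [Finset.sum_comm]
        refine Eq.trans (Finset.sum_congr rfl fun y _ => Finset.sum_congr rfl fun x _ => ?_)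
          (this.trans ?_)
        · rw [show φ.hitLeft (U x l') (φ.hitRight (U r' j) (W y q)) =
            φ.hitRight (U r' j) (φ.hitLeft (U x l') (W y q)) from
            LinearMap.congr_fun (φ.hitLeft_comm_hitRight (U x l') (U r' j)) (W y q)]
        · by_cases hrl : r = l'
          · subst hrl; simp [hG]
          · simp [hrl]
      refine Eq.trans ?_ ((sum_rotate_three _).trans (Finset.sum_congr rfl fun l' _ =>
        (sum_rotate_three _).trans (Finset.sum_congr rfl fun r' _ =>
        (sum_rotate_three _).trans (Finset.sum_congr rfl fun l _ =>
        (sum_rotate_three _).trans (Finset.sum_congr rfl fun r _ => hfold l' r' l r))))).symm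
      simp only [Finset.sum_ite_eq', Finset.mem_univ, if_true]
      refine (Finset.sum_congr rfl fun l _ => Finset.sum_congr rfl fun r' _ =>
        Finset.sum_comm).trans ((sum_rotate_three _).trans
        (Finset.sum_congr rfl fun l' _ => Finset.sum_comm))
    simp only [map_sum, map_smul, Finset.sum_mul, Finset.mul_sum, smul_mul_smul_comm, key]
  induction x using induction_tmul
  · simp
  · rename_i x y hx hy
    simp only [add_mul, map_add, hx, hy]
  rename_i a b
  induction y using induction_tmul
  · simp
  · rename_i x y hx hy
    simp only [mul_add, map_add, hx, hy]
  rename_i a' b'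
  rw [← fst_mul_snd, ← fst_mul_snd]
  rw [show fst φ a * snd φ b * (fst φ a' * snd φ b') =
    fst φ a * (snd φ b * fst φ a' * snd φ b') by simp only [mul_assoc]]
  rw [hl, hr, hm, hr, hl]
  simp only [mul_assoc]

instance : Bialgebra k (DrinfeldDouble φ) := Bialgebra.mk' k (DrinfeldDouble φ)
  (by rw [one_def, counit_tmul]; simp)
  (fun {x y} => counit_mul φ x y)
  (by
    refine (TensorProduct.comul_tmul (R := k) (S := k) (1 : A) (1 : B)).trans ?_
    rw [Bialgebra.comul_one, Bialgebra.comul_one]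
    rfl)
  (fun {x y} => comul_mul φ x y)

end DrinfeldDouble
end Double

namespace DrinfeldDouble

variable {k A B : Type*} [Field k] [Ring A] [Ring B] [HopfAlgebra k A] [HopfAlgebra k B]
variable (φ : SkewHopfPairing k A B)

/-- The antipode `S(a ⊗ b) = (1 ⊗ S b)(S a ⊗ 1)` of the Drinfeld double. -/
def antipodeLin : DrinfeldDouble φ →ₗ[k] DrinfeldDouble φ :=
  TensorProduct.lift ((LinearMap.mul k (DrinfeldDouble φ)).flip.compl₁₂
    ((fst φ).toLinearMap ∘ₗ HopfAlgebra.antipode k) ((snd φ).toLinearMap ∘ₗ HopfAlgebra.antipode k))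

theorem antipodeLin_tmul (a : A) (b : B) : antipodeLin φ (tmul φ a b) =
    snd φ (HopfAlgebra.antipode k b) * fst φ (HopfAlgebra.antipode k a) := rfl

instance : HopfAlgebra k (DrinfeldDouble φ) where
  antipode := antipodeLin φ
  mul_antipode_rTensor_comul := by
    ext x
    induction x using induction_comatrix
    · simp
    · rename_i x y hx hy
      simp only [map_add, hx, hy]
    · rename_i r x hx
      simp only [map_smul, hx]
    rename_i m m' W U hW hU p q i j
    simp only [LinearMap.comp_apply, comul_tmul_comatrix φ hW hU, map_sum,
      LinearMap.rTensor_tmul, antipodeLin_tmul, LinearMap.mul'_apply, counit_tmul, hW.counit_eq,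
      hU.counit_eq]
    rw [Finset.sum_comm]
    have h : ∀ l, ∑ t, snd φ (HopfAlgebra.antipode k (U i l)) *
        fst φ (HopfAlgebra.antipode k (W p t)) * tmul φ (W t q) (U l j) =
        if p = q then snd φ (HopfAlgebra.antipode k (U i l) * U l j) else 0 := by
      intro l
      have h1 : ∀ t, snd φ (HopfAlgebra.antipode k (U i l)) *
          fst φ (HopfAlgebra.antipode k (W p t)) * tmul φ (W t q) (U l j) =
          snd φ (HopfAlgebra.antipode k (U i l)) *
          fst φ (HopfAlgebra.antipode k (W p t) * W t q) * snd φ (U l j) := by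
        intro t
        simp only [← fst_mul_snd, map_mul, mul_assoc]
      simp only [h1, ← Finset.sum_mul, ← Finset.mul_sum, ← map_sum, hW.sum_antipode_mul]
      split_ifs <;> simp
    simp only [h]
    by_cases hpq : p = q
    · simp only [hpq, if_true, ← map_sum, hU.sum_antipode_mul]
      split_ifs <;> simp
    · simp [hpq]
  mul_antipode_lTensor_comul := by
    ext x
    induction x using induction_comatrix
    · simp
    · rename_i x y hx hy
      simp only [map_add, hx, hy]
    · rename_i r x hx
      simp only [map_smul, hx]
    rename_i m m' W U hW hU p q i j
    simp only [LinearMap.comp_apply, comul_tmul_comatrix φ hW hU, map_sum,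
      LinearMap.lTensor_tmul, antipodeLin_tmul, LinearMap.mul'_apply, counit_tmul, hW.counit_eq,
      hU.counit_eq]
    have h : ∀ t, ∑ l, tmul φ (W p t) (U i l) * (snd φ (HopfAlgebra.antipode k (U l j)) *
        fst φ (HopfAlgebra.antipode k (W t q))) =
        if i = j then fst φ (W p t * HopfAlgebra.antipode k (W t q)) else 0 := by
      intro t
      have h1 : ∀ l, tmul φ (W p t) (U i l) * (snd φ (HopfAlgebra.antipode k (U l j)) *
          fst φ (HopfAlgebra.antipode k (W t q))) =
          fst φ (W p t) * snd φ (U i l * HopfAlgebra.antipode k (U l j)) *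
          fst φ (HopfAlgebra.antipode k (W t q)) := by
        intro l
        simp only [← fst_mul_snd, map_mul, mul_assoc]
      simp only [h1, ← Finset.sum_mul, ← Finset.mul_sum, ← map_sum, hU.sum_mul_antipode]
      split_ifs <;> simp
    simp only [h]
    by_cases hij : i = j
    · simp only [hij, if_true, ← map_sum, hW.sum_mul_antipode]
      split_ifs <;> simp
    · simp [hij]

end DrinfeldDouble

section PathAlgebra

/-- The path algebra of a quiver over `k`: the vector space on all paths, where `p * q` is the
path "first `q`, then `p`" if `p` starts where `q` ends, and `0` otherwise. -/
def PathAlgebra (k V : Type*) [Field k] [Quiver V] : Type _ :=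
  (Σ x y : V, Quiver.Path x y) →₀ k

namespace PathAlgebra

variable {k V : Type*} [Field k] [Quiver V]

instance : AddCommGroup (PathAlgebra k V) :=
  inferInstanceAs (AddCommGroup ((Σ x y : V, Quiver.Path x y) →₀ k))

instance : Module k (PathAlgebra k V) :=
  inferInstanceAs (Module k ((Σ x y : V, Quiver.Path x y) →₀ k))

/-- A path as an element of the path algebra. -/
def path {x y : V} (p : Quiver.Path x y) : PathAlgebra k V :=
  Finsupp.single (⟨x, y, p⟩ : Σ x y : V, Quiver.Path x y) (1 : k)

/-- The idempotent `e_x` of a vertex. -/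
def vertex (x : V) : PathAlgebra k V := path (Quiver.Path.nil : Quiver.Path x x)

/-- An arrow as an element of the path algebra. -/
def arrow {x y : V} (a : x ⟶ y) : PathAlgebra k V := path a.toPath

/-- Linear extension of a function on paths. -/
def linearLift {M : Type*} [AddCommGroup M] [Module k M]
    (f : ∀ x y : V, Quiver.Path x y → M) : PathAlgebra k V →ₗ[k] M :=
  Finsupp.lift M k (Σ x y : V, Quiver.Path x y) fun p => f p.1 p.2.1 p.2.2

theorem linearLift_path {M : Type*} [AddCommGroup M] [Module k M]
    (f : ∀ x y : V, Quiver.Path x y → M) {x y : V} (p : Quiver.Path x y) :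
    linearLift (k := k) f (path p) = f x y p := by
  refine (Finsupp.sum_single_index (h := fun (p : Σ x y : V, Quiver.Path x y) (r : k) =>
    r • f p.1 p.2.1 p.2.2) ?_).trans ?_
  · exact zero_smul k _
  · exact one_smul k _

theorem induction_path {P : PathAlgebra k V → Prop} (h0 : P 0)
    (hadd : ∀ x y, P x → P y → P (x + y)) (hsmul : ∀ (r : k) x, P x → P (r • x))
    (h : ∀ (x y : V) (p : Quiver.Path x y), P (path p)) (z) : P z := by
  refine Finsupp.induction_linear (motive := P) z h0 hadd ?_
  rintro ⟨x, y, p⟩ r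
  have : Finsupp.single (⟨x, y, p⟩ : Σ x y : V, Quiver.Path x y) r =
      r • (Finsupp.single (⟨x, y, p⟩ : Σ x y : V, Quiver.Path x y) (1 : k)) := by simp
  rw [this]
  exact hsmul _ _ (h x y p)

variable [DecidableEq V]

/-- The product of two paths. -/
def pathMul {x y z w : V} (p : Quiver.Path x y) (q : Quiver.Path z w) : PathAlgebra k V :=
  if h : w = x then path ((q.cast rfl h).comp p) else 0

/-- Multiplication of the path algebra, linearly in both arguments. -/
def mulLin : PathAlgebra k V →ₗ[k] PathAlgebra k V →ₗ[k] PathAlgebra k V :=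
  linearLift fun _ _ p => linearLift fun _ _ q => pathMul p q

theorem mulLin_path {x y z w : V} (p : Quiver.Path x y) (q : Quiver.Path z w) :
    mulLin (path p) (path q) = (pathMul p q : PathAlgebra k V) := by
  rw [mulLin, linearLift_path, linearLift_path]

theorem pathMul_comp {x y z : V} (p : Quiver.Path y z) (q : Quiver.Path x y) :
    pathMul p q = (path (q.comp p) : PathAlgebra k V) := by
  simp [pathMul]

theorem pathMul_ne {x y z w : V} (p : Quiver.Path x y) (q : Quiver.Path z w) (h : w ≠ x) :
    pathMul p q = (0 : PathAlgebra k V) := dif_neg h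

theorem mulLin_assoc (a b c : PathAlgebra k V) :
    mulLin (mulLin a b) c = mulLin a (mulLin b c) := by
  induction a using induction_path
  · simp
  · rename_i x y hx hy
    simp only [map_add, LinearMap.add_apply, hx, hy]
  · rename_i r x hx
    simp only [map_smul, LinearMap.smul_apply, hx]
  rename_i x y p
  induction b using induction_path
  · simp
  · rename_i x y hx hy
    simp only [map_add, LinearMap.add_apply, hx, hy]
  · rename_i r x hx
    simp only [map_smul, LinearMap.smul_apply, hx]
  rename_i z w q
  induction c using induction_path
  · simp
  · rename_i x y hx hy
    simp only [map_add, hx, hy]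
  · rename_i r x hx
    simp only [map_smul, hx]
  rename_i u v s
  rw [mulLin_path, mulLin_path]
  by_cases h1 : w = x
  · subst h1
    rw [pathMul_comp, mulLin_path]
    by_cases h2 : v = z
    · subst h2
      rw [pathMul_comp, pathMul_comp, mulLin_path, pathMul_comp, Quiver.Path.comp_assoc]
    · rw [pathMul_ne _ _ h2, pathMul_ne _ _ h2, map_zero]
  · rw [pathMul_ne _ _ h1, map_zero, LinearMap.zero_apply]
    by_cases h2 : v = z
    · subst h2
      rw [pathMul_comp, mulLin_path, pathMul_ne _ _ h1]
    · rw [pathMul_ne _ _ h2, map_zero]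

variable [Fintype V]

theorem one_mulLin (a : PathAlgebra k V) : mulLin (∑ x, vertex x) a = a := by
  induction a using induction_path
  · simp
  · rename_i x y hx hy
    simp only [map_add, hx, hy]
  · rename_i r x hx
    simp only [map_smul, hx]
  rename_i x y p
  simp only [map_sum, LinearMap.sum_apply, vertex, mulLin_path]
  rw [Finset.sum_eq_single y]
  · rw [pathMul_comp, Quiver.Path.comp_nil]
  · intro b _ hb
    exact pathMul_ne _ _ hb.symm
  · simp

theorem mulLin_one (a : PathAlgebra k V) : mulLin a (∑ x, vertex x) = a := by
  induction a using induction_path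
  · simp
  · rename_i x y hx hy
    simp only [map_add, LinearMap.add_apply, hx, hy]
  · rename_i r x hx
    simp only [map_smul, LinearMap.smul_apply, hx]
  rename_i x y p
  simp only [map_sum, vertex, mulLin_path]
  rw [Finset.sum_eq_single x]
  · rw [pathMul_comp, Quiver.Path.nil_comp]
  · intro b _ hb
    exact pathMul_ne _ _ hb
  · simp

instance : Ring (PathAlgebra k V) where
  __ := (inferInstance : AddCommGroup (PathAlgebra k V))
  mul a b := mulLin a b
  one := ∑ x, vertex x
  mul_assoc := mulLin_assoc
  one_mul := one_mulLin
  mul_one := mulLin_one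
  left_distrib a b c := map_add (mulLin a) b c
  right_distrib a b c := by
    change mulLin (a + b) c = mulLin a c + mulLin b c
    simp
  zero_mul a := by
    change mulLin 0 a = 0
    simp
  mul_zero a := map_zero (mulLin a)

instance : Algebra k (PathAlgebra k V) := Algebra.ofModule
  (fun r a b => by
    change mulLin (r • a) b = r • mulLin a b
    simp)
  (fun r a b => map_smul (mulLin a) r b)

theorem sum_vertex : ∑ x, vertex x = (1 : PathAlgebra k V) := rfl

theorem path_mul_path {x y z : V} (p : Quiver.Path y z) (q : Quiver.Path x y) :
    path p * path q = (path (q.comp p) : PathAlgebra k V) :=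
  (mulLin_path p q).trans (pathMul_comp p q)

theorem path_mul_path_ne {x y z w : V} (p : Quiver.Path x y) (q : Quiver.Path z w) (h : w ≠ x) :
    path p * path q = (0 : PathAlgebra k V) :=
  (mulLin_path p q).trans (pathMul_ne p q h)

theorem vertex_mul_vertex (x y : V) :
    vertex x * vertex y = if x = y then (vertex x : PathAlgebra k V) else 0 := by
  split_ifs with h
  · subst h
    exact path_mul_path _ _
  · exact path_mul_path_ne _ _ (Ne.symm h)

theorem vertex_mul_arrow {x y : V} (a : x ⟶ y) :
    vertex y * arrow a = (arrow a : PathAlgebra k V) := path_mul_path _ _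

theorem arrow_mul_vertex {x y : V} (a : x ⟶ y) :
    arrow a * vertex x = (arrow a : PathAlgebra k V) :=
  (path_mul_path _ _).trans (by rw [Quiver.Path.nil_comp]; rfl)

theorem path_cons {x y z : V} (p : Quiver.Path x y) (a : y ⟶ z) :
    (path (p.cons a) : PathAlgebra k V) = arrow a * path p :=
  (path_mul_path a.toPath p).symm

theorem adjoin_eq_top : Algebra.adjoin k (Set.range (vertex : V → PathAlgebra k V) ∪
    {z | ∃ (x y : V) (a : x ⟶ y), z = arrow a}) = ⊤ := by
  rw [eq_top_iff]
  rintro z -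
  induction z using induction_path
  · exact Subalgebra.zero_mem _
  · rename_i x y hx hy
    exact Subalgebra.add_mem _ hx hy
  · rename_i r x hx
    exact Subalgebra.smul_mem _ hx r
  rename_i x y p
  induction p with
  | nil => exact Algebra.subset_adjoin (Or.inl ⟨x, rfl⟩)
  | cons p a ih =>
    rw [path_cons]
    exact Subalgebra.mul_mem _ (Algebra.subset_adjoin (Or.inr ⟨_, _, a, rfl⟩)) ih

end PathAlgebra

namespace PathAlgebra

section Lift

variable {k V R : Type*} [Field k] [Quiver V] [Ring R] [Algebra k R]

/-- The value of a path under an assignment of vertices and arrows. -/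
def liftPath (e : V → R) (f : ∀ x y : V, (x ⟶ y) → R) {x : V} :
    ∀ {y : V}, Quiver.Path x y → R
  | _, Quiver.Path.nil => e x
  | _, Quiver.Path.cons p a => f _ _ a * liftPath e f p

/-- `liftPath` extended linearly. -/
def liftLin (k : Type*) [Field k] [Algebra k R] (e : V → R) (f : ∀ x y : V, (x ⟶ y) → R) :
    PathAlgebra k V →ₗ[k] R :=
  linearLift fun _ _ p => liftPath e f p

theorem liftLin_path (e : V → R) (f : ∀ x y : V, (x ⟶ y) → R) {x y : V} (p : Quiver.Path x y) :
    liftLin k e f (path p) = liftPath e f p :=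
  linearLift_path _ p

variable [DecidableEq V]

theorem vertex_mul_liftPath {e : V → R} {f : ∀ x y : V, (x ⟶ y) → R}
    (he : ∀ x y, e x * e y = if x = y then e x else 0)
    (hl : ∀ x y (a : x ⟶ y), e y * f x y a = f x y a) {x y : V} (p : Quiver.Path x y) :
    e y * liftPath e f p = liftPath e f p := by
  cases p with
  | nil => simp [liftPath, he]
  | cons p a => simp only [liftPath, ← mul_assoc, hl]

theorem liftPath_mul_vertex {e : V → R} {f : ∀ x y : V, (x ⟶ y) → R}
    (he : ∀ x y, e x * e y = if x = y then e x else 0) {x y : V} (p : Quiver.Path x y) :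
    liftPath e f p * e x = liftPath e f p := by
  induction p with
  | nil => simp [liftPath, he]
  | cons p a ih => simp only [liftPath, mul_assoc, ih]

theorem liftPath_comp {e : V → R} {f : ∀ x y : V, (x ⟶ y) → R}
    (he : ∀ x y, e x * e y = if x = y then e x else 0)
    (hl : ∀ x y (a : x ⟶ y), e y * f x y a = f x y a) {x y z : V}
    (q : Quiver.Path x y) (p : Quiver.Path y z) :
    liftPath e f (q.comp p) = liftPath e f p * liftPath e f q := by
  induction p with
  | nil => simp [liftPath, vertex_mul_liftPath he hl]
  | cons p a ih => simp only [Quiver.Path.comp_cons, liftPath, mul_assoc, ih]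

variable [Fintype V]

/-- The algebra map out of the path algebra determined by images of vertices and arrows. -/
def lift (e : V → R) (f : ∀ x y : V, (x ⟶ y) → R)
    (he : ∀ x y, e x * e y = if x = y then e x else 0) (h1 : ∑ x, e x = 1)
    (hl : ∀ x y (a : x ⟶ y), e y * f x y a = f x y a) : PathAlgebra k V →ₐ[k] R :=
  AlgHom.ofLinearMap (liftLin k e f)
    (by
      rw [← sum_vertex, map_sum, ← h1]
      exact Finset.sum_congr rfl fun x _ => liftLin_path e f _)
    (fun a b => by
      induction a using induction_path
      · simp
      · rename_i x y hx hy
        simp only [map_add, add_mul, hx, hy]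
      · rename_i r x hx
        simp only [map_smul, smul_mul_assoc, hx]
      rename_i x y p
      induction b using induction_path
      · simp
      · rename_i x y hx hy
        simp only [map_add, mul_add, hx, hy]
      · rename_i r x hx
        simp only [map_smul, mul_smul_comm, hx]
      rename_i z w q
      rw [liftLin_path, liftLin_path]
      by_cases h : w = x
      · subst h
        rw [path_mul_path, liftLin_path, liftPath_comp he hl]
      · rw [path_mul_path_ne _ _ h, map_zero, ← liftPath_mul_vertex he p,
          ← vertex_mul_liftPath he hl q, mul_assoc, ← mul_assoc (e x), he, if_neg (Ne.symm h)]
        simp)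

theorem lift_vertex (e : V → R) (f : ∀ x y : V, (x ⟶ y) → R)
    (he : ∀ x y, e x * e y = if x = y then e x else 0) (h1 : ∑ x, e x = 1)
    (hl : ∀ x y (a : x ⟶ y), e y * f x y a = f x y a) (x : V) :
    lift (k := k) e f he h1 hl (vertex x) = e x := liftLin_path e f _

theorem lift_arrow (e : V → R) (f : ∀ x y : V, (x ⟶ y) → R)
    (he : ∀ x y, e x * e y = if x = y then e x else 0) (h1 : ∑ x, e x = 1)
    (hl : ∀ x y (a : x ⟶ y), e y * f x y a = f x y a)
    (hr : ∀ x y (a : x ⟶ y), f x y a * e x = f x y a) {x y : V} (a : x ⟶ y) :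
    lift (k := k) e f he h1 hl (arrow a) = f x y a :=
  (liftLin_path e f _).trans (hr x y a)

end Lift

end PathAlgebra

end PathAlgebra

/-- A positive definite symmetric Cartan matrix `C = (a_ij)` of size `t` and a primitive `n`-th
root of unity `q` in `k`, where `n ≥ 5`. -/
structure QuantumDatum (k : Type*) [Field k] where
  n : ℕ
  five_le : 5 ≤ n
  q : k
  isPrimitiveRoot : IsPrimitiveRoot q n
  t : ℕ
  C : Matrix (Fin t) (Fin t) ℤ
  diag : ∀ i, C i i = 2
  off_diag : ∀ i j, i ≠ j → C i j ≤ 0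
  symm : C.IsSymm
  posDef : (C.map (Int.cast : ℤ → ℝ)).PosDef

namespace QuantumDatum

variable {k : Type*} [Field k] (D : QuantumDatum k)

instance : NeZero D.n := ⟨by have := D.five_le; omega⟩

/-- `m ↦ q ^ m` for residue classes `m` modulo `n`. -/
def qpow : AddChar (ZMod D.n) k := AddChar.zmodChar D.n D.isPrimitiveRoot.pow_eq_one

theorem qpow_natCast (m : ℕ) : D.qpow m = D.q ^ m := AddChar.zmodChar_apply' _ m

theorem q_ne_zero : D.q ≠ 0 := D.isPrimitiveRoot.ne_zero (NeZero.ne D.n)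

theorem qpow_intCast (m : ℤ) : D.qpow m = D.q ^ m := by
  obtain ⟨l, rfl | rfl⟩ := m.eq_nat_or_neg
  · simp [qpow_natCast]
  · rw [Int.cast_neg, AddChar.map_neg_eq_inv, Int.cast_natCast, qpow_natCast]
    simp

theorem qpow_mul_neg (a : ZMod D.n) : D.qpow a * D.qpow (-a) = 1 := by
  rw [← AddChar.map_add_eq_mul]; simp

theorem qpow_neg_mul (a : ZMod D.n) : D.qpow (-a) * D.qpow a = 1 := by
  rw [mul_comm, qpow_mul_neg]

/-- The scalar `(q^m - q^(-m)) / (q - q⁻¹)`. -/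
def qnum (m : ZMod D.n) : k := (D.qpow m - D.qpow (-m)) / (D.q - D.q⁻¹)

theorem qnum_neg (a : ZMod D.n) : D.qnum (-a) = -D.qnum a := by
  rw [qnum, qnum, neg_neg, ← neg_sub, neg_div]

/-- Vertices of the quiver: the `t`-tuples of integers modulo `n`. -/
def Vertex : Type := Fin D.t → ZMod D.n

instance : AddCommGroup D.Vertex := inferInstanceAs (AddCommGroup (Fin D.t → ZMod D.n))

instance : Fintype D.Vertex := inferInstanceAs (Fintype (Fin D.t → ZMod D.n))

instance : DecidableEq D.Vertex := inferInstanceAs (DecidableEq (Fin D.t → ZMod D.n))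

/-- The `i`-th column of the Cartan matrix modulo `n`. -/
def col (i : Fin D.t) : D.Vertex := fun j => (D.C j i : ZMod D.n)

/-- The quiver with one arrow `x - c^i → x` for every vertex `x` and every `i`. -/
instance : Quiver D.Vertex := ⟨fun x y => {i : Fin D.t // x = y - D.col i}⟩

/-- The double quiver, with additional arrows `x → x - c^i`. -/
abbrev DoubleQuiver : Type := Quiver.Symmetrify D.Vertex

instance : Fintype D.DoubleQuiver := inferInstanceAs (Fintype D.Vertex)

instance : DecidableEq D.DoubleQuiver := inferInstanceAs (DecidableEq D.Vertex)

/-- The path algebra of the double quiver. -/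
abbrev DoublePathAlgebra : Type _ := PathAlgebra k D.DoubleQuiver

/-- The trivial path at `x`. -/
def pathE (x : D.Vertex) : D.DoublePathAlgebra := PathAlgebra.vertex (V := D.DoubleQuiver) x

/-- The arrow `a(x, i) : x - c^i → x`. -/
def pathA (x : D.Vertex) (i : Fin D.t) : D.DoublePathAlgebra :=
  PathAlgebra.arrow (V := D.DoubleQuiver) (x := x - D.col i) (y := x)
    (Sum.inl (⟨i, rfl⟩ : {i' : Fin D.t // x - D.col i = x - D.col i'}))

/-- The arrow `a(x, i)^* : x → x - c^i`. -/
def pathAStar (x : D.Vertex) (i : Fin D.t) : D.DoublePathAlgebra :=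
  PathAlgebra.arrow (V := D.DoubleQuiver) (x := x) (y := x - D.col i)
    (Sum.inr (⟨i, rfl⟩ : {i' : Fin D.t // x - D.col i = x - D.col i'}))

/-- The defining relations of `Π`. -/
inductive PiRel : D.DoublePathAlgebra → D.DoublePathAlgebra → Prop
  | preprojective (x : D.Vertex) (i : Fin D.t) :
      PiRel (D.pathA x i * D.pathAStar x i -
        D.pathAStar (x + D.col i) i * D.pathA (x + D.col i) i) (D.qnum (x i) • D.pathE x)
  | exchange (x : D.Vertex) (i j : Fin D.t) (h : i ≠ j) :
      PiRel (D.pathAStar x j * D.pathA x i)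
        (D.pathA (x - D.col j) i * D.pathAStar (x - D.col i) j)

/-- The algebra `Π`: the path algebra of the double quiver modulo the relations. -/
def PiAlgebra : Type _ := RingQuot D.PiRel

/-- Elements `e_x`, `E_i`, `F_i` of an algebra that satisfy the relations which `e_x`,
`∑ a(x, i)` and `∑ a(x, i)^*` satisfy in `Π`. -/
structure PiRep (R : Type*) [Ring R] [Algebra k R] where
  e : D.Vertex → R
  E : Fin D.t → R
  F : Fin D.t → R
  e_mul_e : ∀ x y, e x * e y = if x = y then e x else 0
  sum_e : ∑ x, e x = 1
  e_mul_E : ∀ x i, e x * E i = E i * e (x - D.col i)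
  F_mul_e : ∀ x i, F i * e x = e (x - D.col i) * F i
  comm : ∀ i, E i * F i - F i * E i = ∑ x, D.qnum (x i) • e x
  comm_ne : ∀ i j, i ≠ j → E i * F j = F j * E i

instance : Ring D.PiAlgebra := inferInstanceAs (Ring (RingQuot D.PiRel))

instance : Algebra k D.PiAlgebra := inferInstanceAs (Algebra k (RingQuot D.PiRel))

/-- The quotient map. -/
def piMk : D.DoublePathAlgebra →ₐ[k] D.PiAlgebra := RingQuot.mkAlgHom k D.PiRel

/-- The class of `e_x` in `Π`. -/
def e (x : D.Vertex) : D.PiAlgebra := D.piMk (D.pathE x)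

/-- The class of `a(x, i)` in `Π`. -/
def a (x : D.Vertex) (i : Fin D.t) : D.PiAlgebra := D.piMk (D.pathA x i)

/-- The class of `a(x, i)^*` in `Π`. -/
def aStar (x : D.Vertex) (i : Fin D.t) : D.PiAlgebra := D.piMk (D.pathAStar x i)

theorem pathE_mul_pathE (x y : D.Vertex) :
    D.pathE x * D.pathE y = if x = y then D.pathE x else 0 :=
  PathAlgebra.vertex_mul_vertex (V := D.DoubleQuiver) x y

theorem pathE_mul_pathA (x : D.Vertex) (i : Fin D.t) : D.pathE x * D.pathA x i = D.pathA x i :=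
  PathAlgebra.vertex_mul_arrow (V := D.DoubleQuiver) _

theorem pathA_mul_pathE (x : D.Vertex) (i : Fin D.t) :
    D.pathA x i * D.pathE (x - D.col i) = D.pathA x i :=
  PathAlgebra.arrow_mul_vertex (V := D.DoubleQuiver) _

theorem pathE_mul_pathAStar (x : D.Vertex) (i : Fin D.t) :
    D.pathE (x - D.col i) * D.pathAStar x i = D.pathAStar x i :=
  PathAlgebra.vertex_mul_arrow (V := D.DoubleQuiver) _

theorem pathAStar_mul_pathE (x : D.Vertex) (i : Fin D.t) :
    D.pathAStar x i * D.pathE x = D.pathAStar x i :=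
  PathAlgebra.arrow_mul_vertex (V := D.DoubleQuiver) _

theorem e_mul_e (x y : D.Vertex) : D.e x * D.e y = if x = y then D.e x else 0 := by
  rw [e, e, ← map_mul, pathE_mul_pathE]
  split_ifs <;> simp

theorem sum_e : ∑ x, D.e x = 1 := by
  rw [← map_one D.piMk, ← PathAlgebra.sum_vertex, map_sum]
  rfl

theorem e_mul_a_self (x : D.Vertex) (i : Fin D.t) : D.e x * D.a x i = D.a x i := by
  rw [e, a, ← map_mul, pathE_mul_pathA]

theorem a_mul_e_self (x : D.Vertex) (i : Fin D.t) : D.a x i * D.e (x - D.col i) = D.a x i := by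
  rw [e, a, ← map_mul, pathA_mul_pathE]

theorem e_mul_aStar_self (x : D.Vertex) (i : Fin D.t) :
    D.e (x - D.col i) * D.aStar x i = D.aStar x i := by
  rw [e, aStar, ← map_mul, pathE_mul_pathAStar]

theorem aStar_mul_e_self (x : D.Vertex) (i : Fin D.t) : D.aStar x i * D.e x = D.aStar x i := by
  rw [e, aStar, ← map_mul, pathAStar_mul_pathE]

theorem preprojective_relation (x : D.Vertex) (i : Fin D.t) :
    D.a x i * D.aStar x i - D.aStar (x + D.col i) i * D.a (x + D.col i) i =
      D.qnum (x i) • D.e x := by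
  simp only [a, aStar, e, ← map_mul, ← map_sub, ← map_smul]
  exact RingQuot.mkAlgHom_rel k (.preprojective x i)

theorem exchange_relation (x : D.Vertex) (i j : Fin D.t) (h : i ≠ j) :
    D.aStar x j * D.a x i = D.a (x - D.col j) i * D.aStar (x - D.col i) j := by
  simp only [a, aStar, ← map_mul]
  exact RingQuot.mkAlgHom_rel k (.exchange x i j h)

theorem e_mul_a (x y : D.Vertex) (i : Fin D.t) :
    D.e x * D.a y i = if x = y then D.a x i else 0 := by
  rw [← e_mul_a_self, ← mul_assoc, e_mul_e]
  split_ifs with h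
  · subst h; exact e_mul_a_self _ _ _
  · simp

theorem a_mul_e (x y : D.Vertex) (i : Fin D.t) :
    D.a x i * D.e y = if y = x - D.col i then D.a x i else 0 := by
  rw [← a_mul_e_self, mul_assoc, e_mul_e]
  by_cases h : y = x - D.col i
  · simp [h, a_mul_e_self]
  · simp [h, Ne.symm h]

theorem e_mul_aStar (x y : D.Vertex) (i : Fin D.t) :
    D.e y * D.aStar x i = if y = x - D.col i then D.aStar x i else 0 := by
  rw [← e_mul_aStar_self, ← mul_assoc, e_mul_e]
  split_ifs with h
  · rw [h]
  · simp

theorem aStar_mul_e (x y : D.Vertex) (i : Fin D.t) :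
    D.aStar x i * D.e y = if x = y then D.aStar x i else 0 := by
  rw [← aStar_mul_e_self, mul_assoc, e_mul_e]
  split_ifs with h
  · rfl
  · simp

/-- The universal instance, in `Π` itself. -/
def piRep : D.PiRep D.PiAlgebra where
  e := D.e
  E i := ∑ x, D.a x i
  F i := ∑ x, D.aStar x i
  e_mul_e := D.e_mul_e
  sum_e := D.sum_e
  e_mul_E x i := by
    simp only [Finset.mul_sum, Finset.sum_mul, e_mul_a, a_mul_e, sub_left_inj]
    simp
  F_mul_e x i := by
    simp only [Finset.mul_sum, Finset.sum_mul, e_mul_aStar, aStar_mul_e, sub_left_inj]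
    simp
  comm i := by
    have h1 : ∀ x, ∑ y, D.a x i * D.aStar y i = D.a x i * D.aStar x i := by
      intro x
      refine Finset.sum_eq_single_of_mem x (Finset.mem_univ x) fun y _ hy => ?_
      rw [← D.e_mul_aStar_self y i, ← mul_assoc, a_mul_e,
        if_neg (fun h => hy (sub_left_inj.1 h)), zero_mul]
    have h2 : ∀ x, ∑ y, D.aStar x i * D.a y i = D.aStar x i * D.a x i := by
      intro x
      refine Finset.sum_eq_single_of_mem x (Finset.mem_univ x) fun y _ hy => ?_
      rw [← D.e_mul_a_self y i, ← mul_assoc, aStar_mul_e, if_neg (Ne.symm hy), zero_mul]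
    rw [Finset.sum_mul_sum, Finset.sum_mul_sum, Finset.sum_congr rfl fun x _ => h1 x,
      Finset.sum_congr rfl fun x _ => h2 x,
      Finset.sum_congr rfl fun x _ => (D.preprojective_relation x i).symm,
      Finset.sum_sub_distrib]
    congr 1
    exact (Fintype.sum_equiv (Equiv.addRight (D.col i)) _ _ fun x => rfl).symm
  comm_ne i j hij := by
    have h1 : ∀ x, ∑ y, D.a x i * D.aStar y j =
        D.a x i * D.aStar (x - D.col i + D.col j) j := by
      intro x
      refine Finset.sum_eq_single_of_mem _ (Finset.mem_univ _) fun y _ hy => ?_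
      rw [← D.e_mul_aStar_self y j, ← mul_assoc, a_mul_e,
        if_neg (fun h => hy (by rw [← h, sub_add_cancel])), zero_mul]
    have h2 : ∀ x, ∑ y, D.aStar x j * D.a y i = D.aStar x j * D.a x i := by
      intro x
      refine Finset.sum_eq_single_of_mem x (Finset.mem_univ x) fun y _ hy => ?_
      rw [← D.e_mul_a_self y i, ← mul_assoc, aStar_mul_e, if_neg (Ne.symm hy), zero_mul]
    rw [Finset.sum_mul_sum, Finset.sum_mul_sum, Finset.sum_congr rfl fun x _ => h1 x,
      Finset.sum_congr rfl fun x _ => h2 x,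
      Finset.sum_congr rfl fun x _ => D.exchange_relation x i j hij]
    refine (Fintype.sum_equiv (Equiv.subRight (D.col j)) _ _ fun x => ?_).symm
    change _ = D.a (x - D.col j) i * D.aStar (x - D.col j - D.col i + D.col j) j
    congr 2
    abel

namespace PiRep

variable {D} {R : Type*} [Ring R] [Algebra k R] (ρ : D.PiRep R)

theorem e_mul_self (x : D.Vertex) : ρ.e x * ρ.e x = ρ.e x := by rw [ρ.e_mul_e, if_pos rfl]

theorem E_mul_e (x : D.Vertex) (i : Fin D.t) : ρ.E i * ρ.e x = ρ.e (x + D.col i) * ρ.E i := by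
  rw [ρ.e_mul_E, add_sub_cancel_right]

theorem e_mul_F (x : D.Vertex) (i : Fin D.t) : ρ.e x * ρ.F i = ρ.F i * ρ.e (x + D.col i) := by
  rw [ρ.F_mul_e, add_sub_cancel_right]

/-- The images of the arrows. -/
def arrowImage (x y : D.Vertex) : Quiver.Hom (V := D.DoubleQuiver) x y → R
  | Sum.inl i => ρ.e y * ρ.E i.1
  | Sum.inr i => ρ.F i.1 * ρ.e x

theorem mul_arrowImage (x y : D.Vertex) (f : Quiver.Hom (V := D.DoubleQuiver) x y) :
    ρ.e y * ρ.arrowImage x y f = ρ.arrowImage x y f := by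
  rcases f with ⟨i, hi⟩ | ⟨i, hi⟩
  · change ρ.e y * (ρ.e y * ρ.E i) = ρ.e y * ρ.E i
    rw [← mul_assoc, e_mul_self]
  · change ρ.e y * (ρ.F i * ρ.e x) = ρ.F i * ρ.e x
    rw [ρ.F_mul_e, ← hi, ← mul_assoc, e_mul_self]

theorem arrowImage_mul (x y : D.Vertex) (f : Quiver.Hom (V := D.DoubleQuiver) x y) :
    ρ.arrowImage x y f * ρ.e x = ρ.arrowImage x y f := by
  rcases f with ⟨i, hi⟩ | ⟨i, hi⟩
  · change ρ.e y * ρ.E i * ρ.e x = ρ.e y * ρ.E i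
    rw [hi, mul_assoc, ← ρ.e_mul_E, ← mul_assoc, e_mul_self]
  · change ρ.F i * ρ.e x * ρ.e x = ρ.F i * ρ.e x
    rw [mul_assoc, e_mul_self]

/-- The induced map on the path algebra. -/
def pathLift : D.DoublePathAlgebra →ₐ[k] R :=
  PathAlgebra.lift (V := D.DoubleQuiver) ρ.e ρ.arrowImage ρ.e_mul_e ρ.sum_e ρ.mul_arrowImage

theorem pathLift_pathE (x : D.Vertex) : ρ.pathLift (D.pathE x) = ρ.e x :=
  PathAlgebra.lift_vertex (V := D.DoubleQuiver) _ _ _ _ _ _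

theorem pathLift_pathA (x : D.Vertex) (i : Fin D.t) :
    ρ.pathLift (D.pathA x i) = ρ.e x * ρ.E i :=
  PathAlgebra.lift_arrow (V := D.DoubleQuiver) _ _ _ _ _ ρ.arrowImage_mul _

theorem pathLift_pathAStar (x : D.Vertex) (i : Fin D.t) :
    ρ.pathLift (D.pathAStar x i) = ρ.F i * ρ.e x :=
  PathAlgebra.lift_arrow (V := D.DoubleQuiver) _ _ _ _ _ ρ.arrowImage_mul _

theorem e_mul_sum (f : D.Vertex → k) (x : D.Vertex) :
    ρ.e x * ∑ y, f y • ρ.e y = f x • ρ.e x := by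
  simp [Finset.mul_sum, ρ.e_mul_e]

theorem sum_mul_e (f : D.Vertex → k) (x : D.Vertex) :
    (∑ y, f y • ρ.e y) * ρ.e x = f x • ρ.e x := by
  simp [Finset.sum_mul, ρ.e_mul_e]

theorem pathLift_rel ⦃u v : D.DoublePathAlgebra⦄ (h : D.PiRel u v) :
    ρ.pathLift u = ρ.pathLift v := by
  rcases h with ⟨x, i⟩ | ⟨x, i, j, hij⟩
  · simp only [map_sub, map_mul, map_smul, pathLift_pathE, pathLift_pathA, pathLift_pathAStar]
    have h1 : ρ.e x * ρ.E i * (ρ.F i * ρ.e x) = ρ.e x * (ρ.E i * ρ.F i) := by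
      rw [ρ.F_mul_e, ρ.e_mul_E, mul_assoc, ← mul_assoc (ρ.e _), e_mul_self, ← mul_assoc,
        ← ρ.e_mul_E, mul_assoc]
    have h2 : ρ.F i * ρ.e (x + D.col i) * (ρ.e (x + D.col i) * ρ.E i) =
        ρ.e x * (ρ.F i * ρ.E i) := by
      rw [mul_assoc, ← mul_assoc (ρ.e _), e_mul_self, ← mul_assoc, ← e_mul_F, mul_assoc]
    rw [h1, h2, ← mul_sub, ρ.comm, e_mul_sum]
  · simp only [map_mul, pathLift_pathA, pathLift_pathAStar]
    have h1 : ρ.F j * ρ.e x * (ρ.e x * ρ.E i) = ρ.e (x - D.col j) * (ρ.F j * ρ.E i) := by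
      rw [mul_assoc, ← mul_assoc (ρ.e x), e_mul_self, ← mul_assoc, ρ.F_mul_e, mul_assoc]
    have h2 : ρ.e (x - D.col j) * ρ.E i * (ρ.F j * ρ.e (x - D.col i)) =
        ρ.e (x - D.col j) * (ρ.E i * ρ.F j) := by
      rw [ρ.F_mul_e, sub_right_comm, ρ.e_mul_E, mul_assoc, ← mul_assoc (ρ.e _), e_mul_self,
        ← mul_assoc, ← ρ.e_mul_E, mul_assoc]
    rw [h1, h2, ρ.comm_ne i j hij]

/-- The induced map on `Π`. -/
def lift : D.PiAlgebra →ₐ[k] R := RingQuot.liftAlgHom k ⟨ρ.pathLift, ρ.pathLift_rel⟩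

theorem lift_piMk (z : D.DoublePathAlgebra) : ρ.lift (D.piMk z) = ρ.pathLift z :=
  RingQuot.liftAlgHom_mkAlgHom_apply k ρ.pathLift ρ.pathLift_rel z

theorem lift_e (x : D.Vertex) : ρ.lift (D.e x) = ρ.e x :=
  (ρ.lift_piMk _).trans (ρ.pathLift_pathE x)

theorem lift_a (x : D.Vertex) (i : Fin D.t) : ρ.lift (D.a x i) = ρ.e x * ρ.E i :=
  (ρ.lift_piMk _).trans (ρ.pathLift_pathA x i)

theorem lift_aStar (x : D.Vertex) (i : Fin D.t) : ρ.lift (D.aStar x i) = ρ.F i * ρ.e x :=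
  (ρ.lift_piMk _).trans (ρ.pathLift_pathAStar x i)

theorem lift_E (i : Fin D.t) : ρ.lift (D.piRep.E i) = ρ.E i := by
  change ρ.lift (∑ x, D.a x i) = _
  simp only [map_sum, lift_a]
  rw [← Finset.sum_mul, ρ.sum_e, one_mul]

theorem lift_F (i : Fin D.t) : ρ.lift (D.piRep.F i) = ρ.F i := by
  change ρ.lift (∑ x, D.aStar x i) = _
  simp only [map_sum, lift_aStar]
  rw [← Finset.mul_sum, ρ.sum_e, mul_one]

end PiRep

theorem piMk_surjective : Function.Surjective D.piMk := RingQuot.mkAlgHom_surjective k D.PiRel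

theorem e_mul_piE (x : D.Vertex) (i : Fin D.t) : D.e x * D.piRep.E i = D.a x i := by
  change D.e x * ∑ y, D.a y i = _
  simp [Finset.mul_sum, e_mul_a]

theorem piF_mul_e (x : D.Vertex) (i : Fin D.t) : D.piRep.F i * D.e x = D.aStar x i := by
  change (∑ y, D.aStar y i) * D.e x = _
  simp [Finset.sum_mul, aStar_mul_e]

/-- Algebra generators of `Π`. -/
def piGen : Set D.PiAlgebra :=
  Set.range D.e ∪ (Set.range D.piRep.E ∪ Set.range D.piRep.F)

theorem adjoin_piGen : Algebra.adjoin k D.piGen = ⊤ := by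
  have hE : ∀ x, D.e x ∈ Algebra.adjoin k D.piGen :=
    fun x => Algebra.subset_adjoin (Or.inl ⟨x, rfl⟩)
  have ha : ∀ x i, D.a x i ∈ Algebra.adjoin k D.piGen := fun x i => by
    rw [← e_mul_piE]
    exact Subalgebra.mul_mem _ (hE x) (Algebra.subset_adjoin (Or.inr (Or.inl ⟨i, rfl⟩)))
  have hs : ∀ x i, D.aStar x i ∈ Algebra.adjoin k D.piGen := fun x i => by
    rw [← piF_mul_e]
    exact Subalgebra.mul_mem _ (Algebra.subset_adjoin (Or.inr (Or.inr ⟨i, rfl⟩))) (hE x)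
  have h := congrArg (Subalgebra.map D.piMk)
    (PathAlgebra.adjoin_eq_top (k := k) (V := D.DoubleQuiver))
  rw [Algebra.map_top, (AlgHom.range_eq_top D.piMk).2 D.piMk_surjective, AlgHom.map_adjoin] at h
  rw [eq_top_iff, ← h]
  refine Algebra.adjoin_le ?_
  rintro _ ⟨z, ⟨x, rfl⟩ | ⟨x, y, f, rfl⟩, rfl⟩
  · exact hE x
  · rcases f with ⟨i, hi⟩ | ⟨i, hi⟩
    · cases (show x = (show D.Vertex from y) - D.col i from hi)
      exact ha y i
    · cases (show y = (show D.Vertex from x) - D.col i from hi)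
      exact hs x i

theorem pi_algHom_ext {R : Type*} [Ring R] [Algebra k R] {f g : D.PiAlgebra →ₐ[k] R}
    (he : ∀ x, f (D.e x) = g (D.e x)) (hE : ∀ i, f (D.piRep.E i) = g (D.piRep.E i))
    (hF : ∀ i, f (D.piRep.F i) = g (D.piRep.F i)) : f = g := by
  refine AlgHom.ext_of_adjoin_eq_top D.adjoin_piGen ?_
  rintro _ (⟨x, rfl⟩ | ⟨i, rfl⟩ | ⟨i, rfl⟩)
  exacts [he x, hE i, hF i]

end QuantumDatum

namespace QuantumDatum

variable {k : Type*} [Field k] {D : QuantumDatum k}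

namespace PiRep

variable {R : Type*} [Ring R] [Algebra k R] (ρ : D.PiRep R)

/-- The element `K_i = ∑ q^(x_i) e_x`. -/
def K (i : Fin D.t) : R := ∑ x, D.qpow (x i) • ρ.e x

/-- The element `K_i⁻¹ = ∑ q^(-x_i) e_x`. -/
def Kinv (i : Fin D.t) : R := ∑ x, D.qpow (-x i) • ρ.e x

theorem e_mul_K (x : D.Vertex) (i : Fin D.t) : ρ.e x * ρ.K i = D.qpow (x i) • ρ.e x :=
  ρ.e_mul_sum (fun x => D.qpow (x i)) x

theorem K_mul_e (x : D.Vertex) (i : Fin D.t) : ρ.K i * ρ.e x = D.qpow (x i) • ρ.e x :=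
  ρ.sum_mul_e (fun x => D.qpow (x i)) x

theorem e_mul_Kinv (x : D.Vertex) (i : Fin D.t) : ρ.e x * ρ.Kinv i = D.qpow (-x i) • ρ.e x :=
  ρ.e_mul_sum (fun x => D.qpow (-x i)) x

theorem Kinv_mul_e (x : D.Vertex) (i : Fin D.t) : ρ.Kinv i * ρ.e x = D.qpow (-x i) • ρ.e x :=
  ρ.sum_mul_e (fun x => D.qpow (-x i)) x

/-- Elements are equal if they agree after left multiplication by all idempotents. -/
theorem ext_left {u v : R} (h : ∀ x, ρ.e x * u = ρ.e x * v) : u = v := by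
  rw [← one_mul u, ← one_mul v, ← ρ.sum_e, Finset.sum_mul, Finset.sum_mul]
  exact Finset.sum_congr rfl fun x _ => h x

theorem K_mul_Kinv (i : Fin D.t) : ρ.K i * ρ.Kinv i = 1 :=
  ρ.ext_left fun x => by
    rw [← mul_assoc, e_mul_K, smul_mul_assoc, e_mul_Kinv, smul_smul, D.qpow_mul_neg, one_smul,
      mul_one]

theorem Kinv_mul_K (i : Fin D.t) : ρ.Kinv i * ρ.K i = 1 :=
  ρ.ext_left fun x => by
    rw [← mul_assoc, e_mul_Kinv, smul_mul_assoc, e_mul_K, smul_smul, mul_comm, D.qpow_mul_neg,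
      one_smul, mul_one]

theorem K_mul_E (i j : Fin D.t) :
    ρ.K i * ρ.E j = D.qpow (D.C i j : ZMod D.n) • (ρ.E j * ρ.K i) :=
  ρ.ext_left fun x => by
    rw [← mul_assoc, e_mul_K, mul_smul_comm, ← mul_assoc, e_mul_E, mul_assoc, e_mul_K,
      smul_mul_assoc, e_mul_E, mul_smul_comm, smul_smul, ← AddChar.map_add_eq_mul]
    congr 2
    change x i = (D.C i j : ZMod D.n) + (x i - (D.C i j : ZMod D.n))
    ring

theorem K_mul_F (i j : Fin D.t) :
    ρ.K i * ρ.F j = D.qpow (-(D.C i j : ZMod D.n)) • (ρ.F j * ρ.K i) :=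
  ρ.ext_left fun x => by
    rw [← mul_assoc, e_mul_K, mul_smul_comm, ← mul_assoc, e_mul_F, mul_assoc, e_mul_K,
      smul_mul_assoc, e_mul_F, mul_smul_comm, smul_smul, ← AddChar.map_add_eq_mul]
    congr 2
    change x i = -(D.C i j : ZMod D.n) + (x i + (D.C i j : ZMod D.n))
    ring

theorem Kinv_mul_E (i j : Fin D.t) :
    ρ.Kinv i * ρ.E j = D.qpow (-(D.C i j : ZMod D.n)) • (ρ.E j * ρ.Kinv i) :=
  ρ.ext_left fun x => by
    rw [← mul_assoc, e_mul_Kinv, mul_smul_comm, ← mul_assoc, e_mul_E, mul_assoc, e_mul_Kinv,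
      smul_mul_assoc, e_mul_E, mul_smul_comm, smul_smul, ← AddChar.map_add_eq_mul]
    congr 2
    change -x i = -(D.C i j : ZMod D.n) + -(x i - (D.C i j : ZMod D.n))
    ring

theorem comm_eq (i : Fin D.t) :
    ρ.E i * ρ.F i - ρ.F i * ρ.E i = (D.q - D.q⁻¹)⁻¹ • (ρ.K i - ρ.Kinv i) := by
  rw [ρ.comm, K, Kinv, ← Finset.sum_sub_distrib, Finset.smul_sum]
  refine Finset.sum_congr rfl fun x _ => ?_
  rw [← sub_smul, smul_smul, qnum, div_eq_inv_mul]

theorem tensor_comm (i j : Fin D.t) :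
    (ρ.E i ⊗ₜ[k] (1 : R) + ρ.K i ⊗ₜ ρ.E i) * (1 ⊗ₜ ρ.F j + ρ.F j ⊗ₜ ρ.Kinv j) -
      ((1 : R) ⊗ₜ[k] ρ.F j + ρ.F j ⊗ₜ ρ.Kinv j) * (ρ.E i ⊗ₜ 1 + ρ.K i ⊗ₜ ρ.E i) =
    ρ.K i ⊗ₜ (ρ.E i * ρ.F j - ρ.F j * ρ.E i) + (ρ.E i * ρ.F j - ρ.F j * ρ.E i) ⊗ₜ ρ.Kinv j := by
  simp only [mul_add, add_mul, Algebra.TensorProduct.tmul_mul_tmul, one_mul, mul_one, K_mul_F,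
    Kinv_mul_E, TensorProduct.smul_tmul', TensorProduct.tmul_smul, TensorProduct.tmul_sub,
    TensorProduct.sub_tmul, D.symm.apply]
  abel

theorem sum_qpow_tensor (i : Fin D.t) :
    ∑ x, D.qpow (x i) • ∑ u, ρ.e u ⊗ₜ[k] ρ.e (x - u) = ρ.K i ⊗ₜ ρ.K i := by
  simp only [Finset.smul_sum, K, TensorProduct.sum_tmul, TensorProduct.tmul_sum]
  rw [Finset.sum_comm]
  conv_rhs => rw [Finset.sum_comm]
  refine Finset.sum_congr rfl fun u _ => Fintype.sum_equiv (Equiv.subRight u) _ _ fun x => ?_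
  change _ = (D.qpow (u i) • ρ.e u) ⊗ₜ[k] (D.qpow (x i - u i) • ρ.e (x - u))
  rw [TensorProduct.tmul_smul, ← TensorProduct.smul_tmul', smul_smul, ← AddChar.map_add_eq_mul,
    sub_add_cancel]

theorem sum_qpow_neg_tensor (i : Fin D.t) :
    ∑ x, D.qpow (-x i) • ∑ u, ρ.e u ⊗ₜ[k] ρ.e (x - u) = ρ.Kinv i ⊗ₜ ρ.Kinv i := by
  simp only [Finset.smul_sum, Kinv, TensorProduct.sum_tmul, TensorProduct.tmul_sum]
  rw [Finset.sum_comm]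
  conv_rhs => rw [Finset.sum_comm]
  refine Finset.sum_congr rfl fun u _ => Fintype.sum_equiv (Equiv.subRight u) _ _ fun x => ?_
  change _ = (D.qpow (-u i) • ρ.e u) ⊗ₜ[k] (D.qpow (-(x i - u i)) • ρ.e (x - u))
  rw [TensorProduct.tmul_smul, ← TensorProduct.smul_tmul', smul_smul, ← AddChar.map_add_eq_mul]
  congr 2
  ring

theorem sum_qnum (f : D.Vertex → R) (i : Fin D.t) : ∑ x, D.qnum (x i) • f x =
    (D.q - D.q⁻¹)⁻¹ • (∑ x, D.qpow (x i) • f x - ∑ x, D.qpow (-x i) • f x) := by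
  rw [← Finset.sum_sub_distrib, Finset.smul_sum]
  refine Finset.sum_congr rfl fun x _ => ?_
  rw [← sub_smul, smul_smul, qnum, div_eq_inv_mul]

theorem Kinv_mul_F (i j : Fin D.t) :
    ρ.Kinv i * ρ.F j = D.qpow (D.C i j : ZMod D.n) • (ρ.F j * ρ.Kinv i) :=
  ρ.ext_left fun x => by
    rw [← mul_assoc, e_mul_Kinv, mul_smul_comm, ← mul_assoc, e_mul_F, mul_assoc, e_mul_Kinv,
      smul_mul_assoc, e_mul_F, mul_smul_comm, smul_smul, ← AddChar.map_add_eq_mul]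
    congr 2
    change -x i = (D.C i j : ZMod D.n) + -(x i + (D.C i j : ZMod D.n))
    ring

theorem op_comm (i j : Fin D.t) :
    ρ.F j * ρ.K j * (ρ.Kinv i * ρ.E i) - ρ.Kinv i * ρ.E i * (ρ.F j * ρ.K j) =
      (D.qpow (-(D.C i i : ZMod D.n)) * D.qpow (D.C i j : ZMod D.n)) •
        ((ρ.F j * ρ.E i - ρ.E i * ρ.F j) * (ρ.K j * ρ.Kinv i)) := by
  have hK : ρ.Kinv i * ρ.K j = ρ.K j * ρ.Kinv i := ρ.ext_left fun x => by
    rw [← mul_assoc, e_mul_Kinv, ← mul_assoc, e_mul_K, smul_mul_assoc, smul_mul_assoc,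
      e_mul_K, e_mul_Kinv, smul_comm]
  have h1 : ρ.F j * ρ.K j * (ρ.Kinv i * ρ.E i) =
      (D.qpow (-(D.C i i : ZMod D.n)) * D.qpow (D.C i j : ZMod D.n)) •
        (ρ.F j * ρ.E i * (ρ.K j * ρ.Kinv i)) := by
    rw [Kinv_mul_E, mul_smul_comm, mul_assoc, ← mul_assoc (ρ.K j), K_mul_E, smul_mul_assoc,
      mul_smul_comm, smul_smul, D.symm.apply i j, mul_assoc, mul_assoc]
  have h2 : ρ.Kinv i * ρ.E i * (ρ.F j * ρ.K j) =
      (D.qpow (-(D.C i i : ZMod D.n)) * D.qpow (D.C i j : ZMod D.n)) •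
        (ρ.E i * ρ.F j * (ρ.K j * ρ.Kinv i)) := by
    rw [Kinv_mul_E, smul_mul_assoc, mul_assoc, ← mul_assoc (ρ.Kinv i), Kinv_mul_F,
      smul_mul_assoc, mul_smul_comm, smul_smul, mul_assoc (ρ.F j), hK, mul_assoc]
  rw [h1, h2, ← smul_sub, ← sub_mul]

theorem sum_neg (f : ZMod D.n → k) (i : Fin D.t) :
    ∑ x : D.Vertex, f (x i) • ρ.e (-x) = ∑ x : D.Vertex, f (-x i) • ρ.e x :=
  Fintype.sum_equiv (Equiv.neg D.Vertex) _ _ fun x => by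
    change _ = f (-(-x i)) • ρ.e (-x)
    rw [neg_neg]

/-- The comultiplication, as an instance of the relations in `R ⊗ R`. -/
def tensor : D.PiRep (R ⊗[k] R) where
  e x := ∑ u, ρ.e u ⊗ₜ ρ.e (x - u)
  E i := ρ.E i ⊗ₜ 1 + ρ.K i ⊗ₜ ρ.E i
  F i := 1 ⊗ₜ ρ.F i + ρ.F i ⊗ₜ ρ.Kinv i
  e_mul_e x y := by
    simp only [Finset.sum_mul_sum, Algebra.TensorProduct.tmul_mul_tmul, ρ.e_mul_e]
    simp only [TensorProduct.ite_tmul, Finset.sum_ite_eq, Finset.mem_univ, if_true]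
    by_cases h : x = y
    · simp [h]
    · simp [h]
  sum_e := by
    rw [Finset.sum_comm]
    have h : ∀ u : D.Vertex, ∑ x, ρ.e u ⊗ₜ[k] ρ.e (x - u) = ρ.e u ⊗ₜ 1 := by
      intro u
      rw [← TensorProduct.tmul_sum, ← ρ.sum_e]
      congr 1
      exact Fintype.sum_equiv (Equiv.subRight u) _ _ fun x => rfl
    simp only [h, ← TensorProduct.sum_tmul, ρ.sum_e]
    rfl
  e_mul_E x i := by
    rw [mul_add, add_mul]
    simp only [Finset.sum_mul, Finset.mul_sum,
      Algebra.TensorProduct.tmul_mul_tmul, mul_one, one_mul]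
    refine congrArg₂ (· + ·) ?_ ?_
    · refine Fintype.sum_equiv (Equiv.subRight (D.col i)) _ _ fun u => ?_
      change _ = (ρ.E i * ρ.e (u - D.col i)) ⊗ₜ ρ.e (x - D.col i - (u - D.col i))
      rw [ρ.e_mul_E, sub_sub_sub_cancel_right]
    · refine Finset.sum_congr rfl fun u _ => ?_
      rw [ρ.e_mul_E, e_mul_K, K_mul_e, sub_right_comm]
  F_mul_e x i := by
    rw [mul_add, add_mul]
    simp only [Finset.sum_mul, Finset.mul_sum,
      Algebra.TensorProduct.tmul_mul_tmul, mul_one, one_mul]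
    refine congrArg₂ (· + ·) ?_ ?_
    · refine Finset.sum_congr rfl fun u _ => ?_
      rw [ρ.F_mul_e, sub_right_comm]
    · refine Fintype.sum_equiv (Equiv.subRight (D.col i)) _ _ fun u => ?_
      change _ = (ρ.e (u - D.col i) * ρ.F i) ⊗ₜ (ρ.e (x - D.col i - (u - D.col i)) * ρ.Kinv i)
      rw [ρ.F_mul_e, sub_sub_sub_cancel_right, e_mul_Kinv, Kinv_mul_e]
  comm i := by
    rw [tensor_comm, sum_qnum, sum_qpow_tensor, sum_qpow_neg_tensor, comm_eq]
    simp only [TensorProduct.tmul_smul, TensorProduct.tmul_sub, TensorProduct.sub_tmul,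
      ← TensorProduct.smul_tmul', ← smul_add]
    congr 1
    abel
  comm_ne i j hij := by
    rw [← sub_eq_zero, tensor_comm, ρ.comm_ne i j hij]
    simp

/-- The counit, as an instance of the relations in `k`. -/
def counit (D : QuantumDatum k) : D.PiRep k where
  e x := if x = 0 then 1 else 0
  E _ := 0
  F _ := 0
  e_mul_e x y := by
    by_cases hx : x = 0
    · subst hx; simp [eq_comm]
    · simp [hx]
  sum_e := by simp
  e_mul_E := by simp
  F_mul_e := by simp
  comm i := by
    simp only [smul_eq_mul, mul_ite, mul_one, mul_zero, Finset.sum_ite_eq', Finset.mem_univ,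
      if_true, sub_self]
    change 0 = D.qnum 0
    simp [qnum]
  comm_ne := by simp

/-- The antipode, as an instance of the relations in the opposite algebra. -/
def op : D.PiRep Rᵐᵒᵖ where
  e x := MulOpposite.op (ρ.e (-x))
  E i := MulOpposite.op (-(ρ.Kinv i * ρ.E i))
  F i := MulOpposite.op (-(ρ.F i * ρ.K i))
  e_mul_e x y := by
    rw [← MulOpposite.op_mul, ρ.e_mul_e]
    by_cases h : x = y
    · simp [h]
    · simp [h, Ne.symm h]
  sum_e := by
    rw [← MulOpposite.op_one, ← ρ.sum_e, ← Finset.op_sum]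
    congr 1
    exact Fintype.sum_equiv (Equiv.neg D.Vertex) _ _ fun x => rfl
  e_mul_E x i := by
    rw [← MulOpposite.op_mul, ← MulOpposite.op_mul]
    congr 1
    rw [neg_mul, mul_neg, ← mul_assoc, e_mul_Kinv, mul_assoc, E_mul_e, ← mul_assoc, Kinv_mul_e,
      neg_sub', sub_neg_eq_add]
  F_mul_e x i := by
    rw [← MulOpposite.op_mul, ← MulOpposite.op_mul]
    congr 1
    rw [neg_mul, mul_neg, ← mul_assoc, e_mul_F, mul_assoc, e_mul_K, mul_assoc, K_mul_e,
      neg_sub', sub_neg_eq_add]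
  comm i := by
    rw [← MulOpposite.op_mul, ← MulOpposite.op_mul, ← MulOpposite.op_sub, neg_mul_neg, neg_mul_neg,
      op_comm, D.qpow_neg_mul, one_smul, K_mul_Kinv, mul_one, ← neg_sub, comm_eq]
    simp only [← MulOpposite.op_smul, ← Finset.op_sum]
    congr 1
    rw [ρ.sum_neg D.qnum, ← comm_eq, ρ.comm, ← Finset.sum_neg_distrib]
    exact Finset.sum_congr rfl fun x _ => by rw [qnum_neg, neg_smul]
  comm_ne i j hij := by
    rw [← MulOpposite.op_mul, ← MulOpposite.op_mul, neg_mul_neg, neg_mul_neg]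
    congr 1
    rw [← sub_eq_zero, op_comm, ρ.comm_ne i j hij]
    simp

end PiRep

end QuantumDatum

namespace QuantumDatum

variable {k : Type*} [Field k] (D : QuantumDatum k)

/-- The comultiplication of `Π` as an algebra map. -/
def piComul : D.PiAlgebra →ₐ[k] D.PiAlgebra ⊗[k] D.PiAlgebra := D.piRep.tensor.lift

/-- The counit of `Π` as an algebra map. -/
def piCounit : D.PiAlgebra →ₐ[k] k := (PiRep.counit D).lift

theorem piComul_e (x : D.Vertex) : D.piComul (D.e x) = ∑ u, D.e u ⊗ₜ D.e (x - u) :=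
  PiRep.lift_e _ _

theorem piComul_E (i : Fin D.t) : D.piComul (D.piRep.E i) =
    D.piRep.E i ⊗ₜ 1 + D.piRep.K i ⊗ₜ D.piRep.E i := PiRep.lift_E _ _

theorem piComul_F (i : Fin D.t) : D.piComul (D.piRep.F i) =
    1 ⊗ₜ D.piRep.F i + D.piRep.F i ⊗ₜ D.piRep.Kinv i := PiRep.lift_F _ _

theorem piComul_K (i : Fin D.t) : D.piComul (D.piRep.K i) = D.piRep.K i ⊗ₜ D.piRep.K i := by
  rw [← PiRep.sum_qpow_tensor]
  change D.piComul (∑ x, D.qpow (x i) • D.e x) = _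
  simp only [map_sum, map_smul, piComul_e]
  rfl

theorem piComul_Kinv (i : Fin D.t) :
    D.piComul (D.piRep.Kinv i) = D.piRep.Kinv i ⊗ₜ D.piRep.Kinv i := by
  rw [← PiRep.sum_qpow_neg_tensor]
  change D.piComul (∑ x, D.qpow (-x i) • D.e x) = _
  simp only [map_sum, map_smul, piComul_e]
  rfl

theorem piCounit_e (x : D.Vertex) : D.piCounit (D.e x) = if x = 0 then 1 else 0 :=
  PiRep.lift_e _ _

theorem piCounit_E (i : Fin D.t) : D.piCounit (D.piRep.E i) = 0 := PiRep.lift_E _ _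

theorem piCounit_F (i : Fin D.t) : D.piCounit (D.piRep.F i) = 0 := PiRep.lift_F _ _

theorem piCounit_K (i : Fin D.t) : D.piCounit (D.piRep.K i) = 1 := by
  change D.piCounit (∑ x, D.qpow (x i) • D.e x) = _
  simp only [map_sum, map_smul, piCounit_e, smul_ite, smul_zero, Finset.sum_ite_eq',
    Finset.mem_univ, if_true]
  change D.qpow 0 • (1 : k) = 1
  simp

theorem piCounit_Kinv (i : Fin D.t) : D.piCounit (D.piRep.Kinv i) = 1 := by
  change D.piCounit (∑ x, D.qpow (-x i) • D.e x) = _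
  simp only [map_sum, map_smul, piCounit_e, smul_ite, smul_zero, Finset.sum_ite_eq',
    Finset.mem_univ, if_true]
  change D.qpow (-0) • (1 : k) = 1
  simp

instance : Bialgebra k D.PiAlgebra := Bialgebra.ofAlgHom D.piComul D.piCounit
  (by
    refine D.pi_algHom_ext (fun x => ?_) (fun i => ?_) (fun i => ?_)
    · simp only [AlgHom.comp_apply, piComul_e, map_sum, Algebra.TensorProduct.map_tmul,
        TensorProduct.sum_tmul, TensorProduct.tmul_sum, AlgHom.id_apply]
      rw [Finset.sum_comm]
      refine Finset.sum_congr rfl fun w _ =>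
        Fintype.sum_equiv (Equiv.subRight w) _ _ fun u => ?_
      change D.e w ⊗ₜ[k] (D.e (u - w) ⊗ₜ[k] D.e (x - u)) =
        D.e w ⊗ₜ[k] (D.e (u - w) ⊗ₜ[k] D.e (x - w - (u - w)))
      rw [sub_sub_sub_cancel_right]
    · simp only [AlgHom.comp_apply, piComul_E, piComul_K, map_add, Algebra.TensorProduct.map_tmul,
        AlgHom.id_apply, TensorProduct.add_tmul, TensorProduct.tmul_add, map_one,
        Algebra.TensorProduct.one_def]
      exact add_assoc _ _ _
    · simp only [AlgHom.comp_apply, piComul_F, piComul_Kinv, map_add,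
        Algebra.TensorProduct.map_tmul, AlgHom.id_apply, TensorProduct.add_tmul,
        TensorProduct.tmul_add, map_one, Algebra.TensorProduct.one_def]
      exact (add_assoc _ _ _).symm)
  (by
    refine D.pi_algHom_ext (fun x => ?_) (fun i => ?_) (fun i => ?_)
    · simp [piComul_e, piCounit_e, TensorProduct.ite_tmul]
    · simp [piComul_E, piCounit_E, piCounit_K]
    · simp [piComul_F, piCounit_F])
  (by
    refine D.pi_algHom_ext (fun x => ?_) (fun i => ?_) (fun i => ?_)
    · simp [piComul_e, piCounit_e, TensorProduct.tmul_ite, sub_eq_zero]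
    · simp [piComul_E, piCounit_E]
    · simp [piComul_F, piCounit_F, piCounit_Kinv])

/-- The antipode of `Π` as an algebra map to the opposite algebra. -/
def piAntipode : D.PiAlgebra →ₐ[k] D.PiAlgebraᵐᵒᵖ := D.piRep.op.lift

theorem piAntipode_e (x : D.Vertex) : D.piAntipode (D.e x) = MulOpposite.op (D.e (-x)) :=
  PiRep.lift_e _ _

theorem piAntipode_E (i : Fin D.t) : D.piAntipode (D.piRep.E i) =
    MulOpposite.op (-(D.piRep.Kinv i * D.piRep.E i)) := PiRep.lift_E _ _

theorem piAntipode_F (i : Fin D.t) : D.piAntipode (D.piRep.F i) =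
    MulOpposite.op (-(D.piRep.F i * D.piRep.K i)) := PiRep.lift_F _ _

theorem piAntipode_K (i : Fin D.t) :
    D.piAntipode (D.piRep.K i) = MulOpposite.op (D.piRep.Kinv i) := by
  change D.piAntipode (∑ x, D.qpow (x i) • D.e x) = _
  simp only [map_sum, map_smul, piAntipode_e, ← MulOpposite.op_smul, ← Finset.op_sum]
  exact congrArg _ (D.piRep.sum_neg D.qpow i)

theorem piAntipode_Kinv (i : Fin D.t) :
    D.piAntipode (D.piRep.Kinv i) = MulOpposite.op (D.piRep.K i) := by
  change D.piAntipode (∑ x, D.qpow (-x i) • D.e x) = _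
  simp only [map_sum, map_smul, piAntipode_e, ← MulOpposite.op_smul, ← Finset.op_sum]
  refine congrArg _ ((D.piRep.sum_neg (fun m => D.qpow (-m)) i).trans ?_)
  simp only [neg_neg]
  rfl

theorem comul_eq_piComul (z : D.PiAlgebra) : comul (R := k) z = D.piComul z := rfl

theorem counit_eq_piCounit (z : D.PiAlgebra) : counit (R := k) z = D.piCounit z := rfl

instance : HopfAlgebra k D.PiAlgebra := hopfOfGenerators D.piAntipode D.piGen D.adjoin_piGen <| by
  rintro _ (⟨x, rfl⟩ | ⟨i, rfl⟩ | ⟨i, rfl⟩)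
  · constructor
    · rw [comul_eq_piComul, counit_eq_piCounit, piComul_e, piCounit_e]
      simp only [map_sum, LinearMap.rTensor_tmul, LinearMap.mul'_apply, LinearMap.comp_apply]
      change ∑ u, (D.piAntipode (D.e u)).unop * D.e (x - u) = _
      simp only [piAntipode_e, MulOpposite.unop_op, D.e_mul_e]
      by_cases h : x = 0
      · subst h
        simp only [zero_sub, if_true, map_one, ← D.sum_e]
        exact Fintype.sum_equiv (Equiv.neg D.Vertex) _ _ fun x => rfl
      · simp [h, sub_eq_add_neg]
    · rw [comul_eq_piComul, counit_eq_piCounit, piComul_e, piCounit_e]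
      simp only [map_sum, LinearMap.lTensor_tmul, LinearMap.mul'_apply, LinearMap.comp_apply]
      change ∑ u, D.e u * (D.piAntipode (D.e (x - u))).unop = _
      simp only [piAntipode_e, MulOpposite.unop_op, D.e_mul_e]
      by_cases h : x = 0
      · simp [h, D.sum_e]
      · rw [if_neg h, map_zero]
        refine Finset.sum_eq_zero fun u _ => if_neg fun h' => h ?_
        rw [neg_sub] at h'
        exact sub_eq_self.1 h'.symm
  · constructor
    · rw [comul_eq_piComul, counit_eq_piCounit, piComul_E, piCounit_E]
      simp only [map_add, LinearMap.rTensor_tmul, LinearMap.mul'_apply, LinearMap.comp_apply]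
      change (D.piAntipode (D.piRep.E i)).unop * 1 +
        (D.piAntipode (D.piRep.K i)).unop * D.piRep.E i = _
      simp [piAntipode_E, piAntipode_K]
    · rw [comul_eq_piComul, counit_eq_piCounit, piComul_E, piCounit_E]
      simp only [map_add, LinearMap.lTensor_tmul, LinearMap.mul'_apply, LinearMap.comp_apply]
      change D.piRep.E i * (D.piAntipode 1).unop +
        D.piRep.K i * (D.piAntipode (D.piRep.E i)).unop = _
      simp [piAntipode_E, ← mul_assoc, PiRep.K_mul_Kinv]
  · constructor
    · rw [comul_eq_piComul, counit_eq_piCounit, piComul_F, piCounit_F]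
      simp only [map_add, LinearMap.rTensor_tmul, LinearMap.mul'_apply, LinearMap.comp_apply]
      change (D.piAntipode 1).unop * D.piRep.F i +
        (D.piAntipode (D.piRep.F i)).unop * D.piRep.Kinv i = _
      simp [piAntipode_F, mul_assoc, PiRep.K_mul_Kinv]
    · rw [comul_eq_piComul, counit_eq_piCounit, piComul_F, piCounit_F]
      simp only [map_add, LinearMap.lTensor_tmul, LinearMap.mul'_apply, LinearMap.comp_apply]
      change 1 * (D.piAntipode (D.piRep.F i)).unop +
        D.piRep.F i * (D.piAntipode (D.piRep.Kinv i)).unop = _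
      simp [piAntipode_F, piAntipode_Kinv]

theorem antipode_eq_piAntipode (z : D.PiAlgebra) :
    HopfAlgebra.antipode k z = (D.piAntipode z).unop := rfl

theorem comul_e (x : D.Vertex) : comul (R := k) (D.e x) = ∑ u, D.e u ⊗ₜ D.e (x - u) :=
  D.piComul_e x

theorem comul_a (x : D.Vertex) (i : Fin D.t) : comul (R := k) (D.a x i) =
    ∑ u, D.qpow (u i) • (D.e u ⊗ₜ[k] D.a (x - u) i) + ∑ u, D.a u i ⊗ₜ[k] D.e (x - u) := by
  rw [comul_eq_piComul, ← e_mul_piE, map_mul, piComul_e, piComul_E, mul_add, add_comm]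
  simp only [Finset.sum_mul, Algebra.TensorProduct.tmul_mul_tmul, e_mul_piE, mul_one]
  congr 1
  refine Finset.sum_congr rfl fun u _ => ?_
  rw [show D.e u * D.piRep.K i = D.qpow (u i) • D.e u from D.piRep.e_mul_K u i,
    TensorProduct.smul_tmul']

theorem comul_aStar (x : D.Vertex) (i : Fin D.t) : comul (R := k) (D.aStar x i) =
    ∑ u, D.e u ⊗ₜ[k] D.aStar (x - u) i +
      ∑ u, D.qpow (-(x - u) i) • (D.aStar u i ⊗ₜ[k] D.e (x - u)) := by
  rw [comul_eq_piComul, ← piF_mul_e, map_mul, piComul_e, piComul_F, add_mul]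
  simp only [Finset.mul_sum, Algebra.TensorProduct.tmul_mul_tmul, piF_mul_e, one_mul]
  congr 1
  refine Finset.sum_congr rfl fun u _ => ?_
  rw [show D.piRep.Kinv i * D.e (x - u) = D.qpow (-(x - u) i) • D.e (x - u) from
    D.piRep.Kinv_mul_e _ i, TensorProduct.tmul_smul]

theorem counit_e (x : D.Vertex) : counit (R := k) (D.e x) = if x = 0 then 1 else 0 :=
  D.piCounit_e x

theorem counit_a (x : D.Vertex) (i : Fin D.t) : counit (R := k) (D.a x i) = 0 := by
  rw [counit_eq_piCounit, ← e_mul_piE, map_mul, piCounit_E, mul_zero]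

theorem counit_aStar (x : D.Vertex) (i : Fin D.t) : counit (R := k) (D.aStar x i) = 0 := by
  rw [counit_eq_piCounit, ← piF_mul_e, map_mul, piCounit_F, zero_mul]

theorem antipode_e (x : D.Vertex) : HopfAlgebra.antipode k (D.e x) = D.e (-x) := by
  rw [antipode_eq_piAntipode, piAntipode_e, MulOpposite.unop_op]

theorem antipode_a (x : D.Vertex) (i : Fin D.t) : HopfAlgebra.antipode k (D.a x i) =
    -(D.qpow (x i - 2) • D.a (-x + D.col i) i) := by
  rw [antipode_eq_piAntipode, ← e_mul_piE, map_mul, MulOpposite.unop_mul, piAntipode_e,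
    piAntipode_E, MulOpposite.unop_op, MulOpposite.unop_op, neg_mul, mul_assoc,
    show D.piRep.E i * D.e (-x) = D.e (-x + D.col i) * D.piRep.E i from D.piRep.E_mul_e _ i,
    ← mul_assoc, show D.piRep.Kinv i * D.e (-x + D.col i) = D.qpow (-(-x + D.col i) i) •
      D.e (-x + D.col i) from D.piRep.Kinv_mul_e _ i, smul_mul_assoc, e_mul_piE]
  congr 3
  change -(-x i + (D.C i i : ZMod D.n)) = x i - 2
  rw [D.diag]
  push_cast
  ring

theorem antipode_aStar (x : D.Vertex) (i : Fin D.t) : HopfAlgebra.antipode k (D.aStar x i) =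
    -(D.qpow (-x i + 2) • D.aStar (-x + D.col i) i) := by
  rw [antipode_eq_piAntipode, ← piF_mul_e, map_mul, MulOpposite.unop_mul, piAntipode_e,
    piAntipode_F, MulOpposite.unop_op, MulOpposite.unop_op, mul_neg, ← mul_assoc,
    show D.e (-x) * D.piRep.F i = D.piRep.F i * D.e (-x + D.col i) from D.piRep.e_mul_F _ i,
    mul_assoc, show D.e (-x + D.col i) * D.piRep.K i = D.qpow ((-x + D.col i) i) •
      D.e (-x + D.col i) from D.piRep.e_mul_K _ i, mul_smul_comm, piF_mul_e]
  congr 3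
  change -x i + (D.C i i : ZMod D.n) = -x i + 2
  rw [D.diag]
  push_cast
  ring

end QuantumDatum

namespace QuantumDatum

variable {k : Type*} [Field k] (D : QuantumDatum k)

/-- Generators `K_i` (left) and `X_i` (right). -/
abbrev BorelFree : Type _ := FreeAlgebra k (Fin D.t ⊕ Fin D.t)

/-- The relations `K_i^n = 1`, `K_i K_j = K_j K_i`, `K_i X_j = q^(s a_ij) X_j K_i`. -/
inductive BorelRel (s : ℤ) : D.BorelFree → D.BorelFree → Prop
  | pow (i : Fin D.t) : BorelRel s (FreeAlgebra.ι k (Sum.inl i) ^ D.n) 1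
  | comm (i j : Fin D.t) : BorelRel s
      (FreeAlgebra.ι k (Sum.inl i) * FreeAlgebra.ι k (Sum.inl j))
      (FreeAlgebra.ι k (Sum.inl j) * FreeAlgebra.ι k (Sum.inl i))
  | skew (i j : Fin D.t) : BorelRel s
      (FreeAlgebra.ι k (Sum.inl i) * FreeAlgebra.ι k (Sum.inr j))
      (D.q ^ (s * D.C i j) • (FreeAlgebra.ι k (Sum.inr j) * FreeAlgebra.ι k (Sum.inl i)))

/-- Elements of an algebra that satisfy the relations. -/
structure BorelRep (s : ℤ) (R : Type*) [Ring R] [Algebra k R] where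
  K : Fin D.t → R
  X : Fin D.t → R
  K_pow : ∀ i, K i ^ D.n = 1
  K_comm : ∀ i j, K i * K j = K j * K i
  K_mul_X : ∀ i j, K i * X j = D.q ^ (s * D.C i j) • (X j * K i)

/-- The algebra given by the generators and relations. -/
abbrev Borel (s : ℤ) : Type _ := RingQuot (D.BorelRel s)

/-- The universal instance. -/
def borelRep (s : ℤ) : D.BorelRep s (D.Borel s) where
  K i := RingQuot.mkAlgHom k (D.BorelRel s) (FreeAlgebra.ι k (Sum.inl i))
  X i := RingQuot.mkAlgHom k (D.BorelRel s) (FreeAlgebra.ι k (Sum.inr i))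
  K_pow i := by
    rw [← map_pow, ← map_one (RingQuot.mkAlgHom k (D.BorelRel s))]
    exact RingQuot.mkAlgHom_rel k (.pow i)
  K_comm i j := by
    simp only [← map_mul]
    exact RingQuot.mkAlgHom_rel k (.comm i j)
  K_mul_X i j := by
    simp only [← map_mul, ← map_smul]
    exact RingQuot.mkAlgHom_rel k (.skew i j)

theorem borel_algHom_ext {s : ℤ} {R : Type*} [Ring R] [Algebra k R] {f g : D.Borel s →ₐ[k] R}
    (hK : ∀ i, f ((D.borelRep s).K i) = g ((D.borelRep s).K i))
    (hX : ∀ i, f ((D.borelRep s).X i) = g ((D.borelRep s).X i)) : f = g := by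
  apply RingQuot.ringQuot_ext'
  ext (i | i)
  · exact hK i
  · exact hX i

/-- Algebra generators. -/
def borelGen (s : ℤ) : Set (D.Borel s) :=
  Set.range (D.borelRep s).K ∪ Set.range (D.borelRep s).X

theorem adjoin_borelGen (s : ℤ) : Algebra.adjoin k (D.borelGen s) = ⊤ := by
  have h := congrArg (Subalgebra.map (RingQuot.mkAlgHom k (D.BorelRel s)))
    (FreeAlgebra.adjoin_range_ι (R := k) (X := Fin D.t ⊕ Fin D.t))
  rw [Algebra.map_top, (AlgHom.range_eq_top _).2 (RingQuot.mkAlgHom_surjective k _),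
    AlgHom.map_adjoin] at h
  rw [eq_top_iff, ← h]
  refine Algebra.adjoin_mono ?_
  rintro _ ⟨_, ⟨i | i, rfl⟩, rfl⟩
  · exact Or.inl ⟨i, rfl⟩
  · exact Or.inr ⟨i, rfl⟩

namespace BorelRep

variable {D} {s : ℤ} {R : Type*} [Ring R] [Algebra k R] (ρ : D.BorelRep s R)

/-- The induced map. -/
def lift : D.Borel s →ₐ[k] R :=
  RingQuot.liftAlgHom k ⟨FreeAlgebra.lift k (Sum.elim ρ.K ρ.X), by
    rintro x y (i | ⟨i, j⟩ | ⟨i, j⟩)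
    · simp [ρ.K_pow]
    · simp [ρ.K_comm i j]
    · simp [ρ.K_mul_X]⟩

theorem lift_K (i : Fin D.t) : ρ.lift ((D.borelRep s).K i) = ρ.K i :=
  (RingQuot.liftAlgHom_mkAlgHom_apply k _ _ _).trans (by simp)

theorem lift_X (i : Fin D.t) : ρ.lift ((D.borelRep s).X i) = ρ.X i :=
  (RingQuot.liftAlgHom_mkAlgHom_apply k _ _ _).trans (by simp)

/-- The inverse `K_i^(n-1)` of `K_i`. -/
def Kinv (i : Fin D.t) : R := ρ.K i ^ (D.n - 1)

theorem K_mul_Kinv (i : Fin D.t) : ρ.K i * ρ.Kinv i = 1 := by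
  rw [Kinv, ← pow_succ', Nat.sub_add_cancel (NeZero.pos D.n), ρ.K_pow]

theorem Kinv_mul_K (i : Fin D.t) : ρ.Kinv i * ρ.K i = 1 := by
  rw [Kinv, ← pow_succ, Nat.sub_add_cancel (NeZero.pos D.n), ρ.K_pow]

theorem commute_K_Kinv (i j : Fin D.t) : Commute (ρ.K i) (ρ.Kinv j) :=
  Commute.pow_right (ρ.K_comm i j) _

theorem Kinv_pow (i : Fin D.t) : ρ.Kinv i ^ D.n = 1 := by
  rw [Kinv, pow_right_comm, ρ.K_pow, one_pow]

/-- The counit. -/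
def counit (D : QuantumDatum k) (s : ℤ) : D.BorelRep s k where
  K _ := 1
  X _ := 0
  K_pow _ := one_pow _
  K_comm _ _ := rfl
  K_mul_X _ _ := by simp

theorem Kinv_mul_X (i j : Fin D.t) :
    ρ.X j * ρ.Kinv i = D.q ^ (s * D.C i j) • (ρ.Kinv i * ρ.X j) := by
  have h : ρ.Kinv i * (ρ.K i * ρ.X j) * ρ.Kinv i =
      ρ.Kinv i * (D.q ^ (s * D.C i j) • (ρ.X j * ρ.K i)) * ρ.Kinv i := by rw [ρ.K_mul_X]
  rw [← mul_assoc, Kinv_mul_K, one_mul, mul_smul_comm, smul_mul_assoc, mul_assoc, mul_assoc,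
    K_mul_Kinv, mul_one] at h
  exact h

/-- The comultiplication with `Δ(X) = X ⊗ 1 + K ⊗ X`. -/
def tensorPlus : D.BorelRep s (R ⊗[k] R) where
  K i := ρ.K i ⊗ₜ ρ.K i
  X i := ρ.X i ⊗ₜ 1 + ρ.K i ⊗ₜ ρ.X i
  K_pow i := by
    rw [Algebra.TensorProduct.tmul_pow, ρ.K_pow]
    rfl
  K_comm i j := by
    rw [Algebra.TensorProduct.tmul_mul_tmul, Algebra.TensorProduct.tmul_mul_tmul, ρ.K_comm i j]
  K_mul_X i j := by
    simp only [mul_add, add_mul, Algebra.TensorProduct.tmul_mul_tmul, ρ.K_mul_X, one_mul, mul_one,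
      TensorProduct.tmul_smul, TensorProduct.smul_tmul', smul_add, ρ.K_comm i j]

/-- The comultiplication with `Δ(X) = X ⊗ K⁻¹ + 1 ⊗ X`. -/
def tensorMinus : D.BorelRep s (R ⊗[k] R) where
  K i := ρ.K i ⊗ₜ ρ.K i
  X i := ρ.X i ⊗ₜ ρ.Kinv i + 1 ⊗ₜ ρ.X i
  K_pow i := by
    rw [Algebra.TensorProduct.tmul_pow, ρ.K_pow]
    rfl
  K_comm i j := by
    rw [Algebra.TensorProduct.tmul_mul_tmul, Algebra.TensorProduct.tmul_mul_tmul, ρ.K_comm i j]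
  K_mul_X i j := by
    simp only [mul_add, add_mul, Algebra.TensorProduct.tmul_mul_tmul, ρ.K_mul_X, one_mul, mul_one,
      TensorProduct.tmul_smul, TensorProduct.smul_tmul', smul_add, (ρ.commute_K_Kinv i j).eq]

/-- The antipode with `S(X) = -K⁻¹ X`. -/
def opPlus : D.BorelRep s Rᵐᵒᵖ where
  K i := MulOpposite.op (ρ.Kinv i)
  X i := MulOpposite.op (-(ρ.Kinv i * ρ.X i))
  K_pow i := by rw [← MulOpposite.op_pow, Kinv_pow, MulOpposite.op_one]
  K_comm i j := by
    rw [← MulOpposite.op_mul, ← MulOpposite.op_mul, Kinv, Kinv,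
      (Commute.pow_pow (ρ.K_comm i j) _ _).eq]
  K_mul_X i j := by
    rw [← MulOpposite.op_mul, ← MulOpposite.op_mul, ← MulOpposite.op_smul]
    congr 1
    rw [neg_mul, mul_neg, mul_assoc, Kinv_mul_X, mul_smul_comm, smul_neg, ← mul_assoc,
      ← mul_assoc, Kinv, Kinv, (Commute.pow_pow (ρ.K_comm i j) _ _).eq]

/-- The antipode with `S(X) = -X K`. -/
def opMinus : D.BorelRep s Rᵐᵒᵖ where
  K i := MulOpposite.op (ρ.Kinv i)
  X i := MulOpposite.op (-(ρ.X i * ρ.K i))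
  K_pow i := by rw [← MulOpposite.op_pow, Kinv_pow, MulOpposite.op_one]
  K_comm i j := by
    rw [← MulOpposite.op_mul, ← MulOpposite.op_mul, Kinv, Kinv,
      (Commute.pow_pow (ρ.K_comm i j) _ _).eq]
  K_mul_X i j := by
    rw [← MulOpposite.op_mul, ← MulOpposite.op_mul, ← MulOpposite.op_smul]
    congr 1
    rw [neg_mul, mul_neg, mul_assoc, (ρ.commute_K_Kinv j i).eq, ← mul_assoc, Kinv_mul_X,
      smul_mul_assoc, smul_neg, mul_assoc]

end BorelRep

/-- The algebra `𝔲_q^+`, with generators `K_i`, `E_i`. -/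
def UPlus : Type _ := D.Borel 1

/-- The algebra `𝔲_q^-`, with generators `K_i`, `F_i`. -/
def UMinus : Type _ := D.Borel (-1)

instance : Ring D.UPlus := inferInstanceAs (Ring (D.Borel 1))

instance : Algebra k D.UPlus := inferInstanceAs (Algebra k (D.Borel 1))

instance : Ring D.UMinus := inferInstanceAs (Ring (D.Borel (-1)))

instance : Algebra k D.UMinus := inferInstanceAs (Algebra k (D.Borel (-1)))

/-- The generators of `𝔲_q^+`. -/
def plusRep : D.BorelRep 1 D.UPlus := D.borelRep 1

/-- The generators of `𝔲_q^-`. -/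
def minusRep : D.BorelRep (-1) D.UMinus := D.borelRep (-1)

/-- Algebra generators of `𝔲_q^+`. -/
def plusGen : Set D.UPlus := Set.range D.plusRep.K ∪ Set.range D.plusRep.X

/-- Algebra generators of `𝔲_q^-`. -/
def minusGen : Set D.UMinus := Set.range D.minusRep.K ∪ Set.range D.minusRep.X

theorem adjoin_plusGen : Algebra.adjoin k D.plusGen = ⊤ := D.adjoin_borelGen 1

theorem adjoin_minusGen : Algebra.adjoin k D.minusGen = ⊤ := D.adjoin_borelGen (-1)

theorem plus_algHom_ext {R : Type*} [Ring R] [Algebra k R] {f g : D.UPlus →ₐ[k] R}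
    (hK : ∀ i, f (D.plusRep.K i) = g (D.plusRep.K i))
    (hX : ∀ i, f (D.plusRep.X i) = g (D.plusRep.X i)) : f = g := D.borel_algHom_ext hK hX

theorem minus_algHom_ext {R : Type*} [Ring R] [Algebra k R] {f g : D.UMinus →ₐ[k] R}
    (hK : ∀ i, f (D.minusRep.K i) = g (D.minusRep.K i))
    (hX : ∀ i, f (D.minusRep.X i) = g (D.minusRep.X i)) : f = g := D.borel_algHom_ext hK hX

/-- Algebra map out of `𝔲_q^+`. -/
def plusLift {R : Type*} [Ring R] [Algebra k R] (ρ : D.BorelRep 1 R) : D.UPlus →ₐ[k] R := ρ.lift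

/-- Algebra map out of `𝔲_q^-`. -/
def minusLift {R : Type*} [Ring R] [Algebra k R] (ρ : D.BorelRep (-1) R) :
    D.UMinus →ₐ[k] R := ρ.lift

theorem plusLift_K {R : Type*} [Ring R] [Algebra k R] (ρ : D.BorelRep 1 R) (i : Fin D.t) :
    D.plusLift ρ (D.plusRep.K i) = ρ.K i := ρ.lift_K i

theorem plusLift_X {R : Type*} [Ring R] [Algebra k R] (ρ : D.BorelRep 1 R) (i : Fin D.t) :
    D.plusLift ρ (D.plusRep.X i) = ρ.X i := ρ.lift_X i

theorem plusLift_Kinv {R : Type*} [Ring R] [Algebra k R] (ρ : D.BorelRep 1 R) (i : Fin D.t) :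
    D.plusLift ρ (D.plusRep.Kinv i) = ρ.Kinv i := by
  rw [BorelRep.Kinv, map_pow, plusLift_K, BorelRep.Kinv]

theorem minusLift_K {R : Type*} [Ring R] [Algebra k R] (ρ : D.BorelRep (-1) R) (i : Fin D.t) :
    D.minusLift ρ (D.minusRep.K i) = ρ.K i := ρ.lift_K i

theorem minusLift_X {R : Type*} [Ring R] [Algebra k R] (ρ : D.BorelRep (-1) R) (i : Fin D.t) :
    D.minusLift ρ (D.minusRep.X i) = ρ.X i := ρ.lift_X i

theorem minusLift_Kinv {R : Type*} [Ring R] [Algebra k R] (ρ : D.BorelRep (-1) R) (i : Fin D.t) :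
    D.minusLift ρ (D.minusRep.Kinv i) = ρ.Kinv i := by
  rw [BorelRep.Kinv, map_pow, minusLift_K, BorelRep.Kinv]

/-- The comultiplication of `𝔲_q^+`. -/
def plusComul : D.UPlus →ₐ[k] D.UPlus ⊗[k] D.UPlus := D.plusLift D.plusRep.tensorPlus

/-- The counit of `𝔲_q^+`. -/
def plusCounit : D.UPlus →ₐ[k] k := D.plusLift (BorelRep.counit D 1)

/-- The antipode of `𝔲_q^+`. -/
def plusAntipode : D.UPlus →ₐ[k] D.UPlusᵐᵒᵖ := D.plusLift D.plusRep.opPlus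

/-- The comultiplication of `𝔲_q^-`. -/
def minusComul : D.UMinus →ₐ[k] D.UMinus ⊗[k] D.UMinus := D.minusLift D.minusRep.tensorMinus

/-- The counit of `𝔲_q^-`. -/
def minusCounit : D.UMinus →ₐ[k] k := D.minusLift (BorelRep.counit D (-1))

/-- The antipode of `𝔲_q^-`. -/
def minusAntipode : D.UMinus →ₐ[k] D.UMinusᵐᵒᵖ := D.minusLift D.minusRep.opMinus

theorem plusComul_K (i : Fin D.t) :
    D.plusComul (D.plusRep.K i) = D.plusRep.K i ⊗ₜ D.plusRep.K i := D.plusLift_K _ i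

theorem plusComul_X (i : Fin D.t) : D.plusComul (D.plusRep.X i) =
    D.plusRep.X i ⊗ₜ 1 + D.plusRep.K i ⊗ₜ D.plusRep.X i := D.plusLift_X _ i

theorem minusComul_K (i : Fin D.t) :
    D.minusComul (D.minusRep.K i) = D.minusRep.K i ⊗ₜ D.minusRep.K i := D.minusLift_K _ i

theorem minusComul_X (i : Fin D.t) : D.minusComul (D.minusRep.X i) =
    D.minusRep.X i ⊗ₜ D.minusRep.Kinv i + 1 ⊗ₜ D.minusRep.X i := D.minusLift_X _ i

theorem minusComul_Kinv (i : Fin D.t) :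
    D.minusComul (D.minusRep.Kinv i) = D.minusRep.Kinv i ⊗ₜ D.minusRep.Kinv i := by
  rw [BorelRep.Kinv, map_pow, minusComul_K, Algebra.TensorProduct.tmul_pow]

theorem plusCounit_K (i : Fin D.t) : D.plusCounit (D.plusRep.K i) = 1 := D.plusLift_K _ i

theorem plusCounit_X (i : Fin D.t) : D.plusCounit (D.plusRep.X i) = 0 := D.plusLift_X _ i

theorem minusCounit_K (i : Fin D.t) : D.minusCounit (D.minusRep.K i) = 1 := D.minusLift_K _ i

theorem minusCounit_X (i : Fin D.t) : D.minusCounit (D.minusRep.X i) = 0 := D.minusLift_X _ i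

theorem minusCounit_Kinv (i : Fin D.t) : D.minusCounit (D.minusRep.Kinv i) = 1 := by
  rw [BorelRep.Kinv, map_pow, minusCounit_K, one_pow]

theorem plusAntipode_K (i : Fin D.t) :
    D.plusAntipode (D.plusRep.K i) = MulOpposite.op (D.plusRep.Kinv i) := D.plusLift_K _ i

theorem plusAntipode_X (i : Fin D.t) : D.plusAntipode (D.plusRep.X i) =
    MulOpposite.op (-(D.plusRep.Kinv i * D.plusRep.X i)) := D.plusLift_X _ i

theorem minusAntipode_K (i : Fin D.t) :
    D.minusAntipode (D.minusRep.K i) = MulOpposite.op (D.minusRep.Kinv i) := D.minusLift_K _ i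

theorem minusAntipode_X (i : Fin D.t) : D.minusAntipode (D.minusRep.X i) =
    MulOpposite.op (-(D.minusRep.X i * D.minusRep.K i)) := D.minusLift_X _ i

theorem minusAntipode_Kinv (i : Fin D.t) :
    D.minusAntipode (D.minusRep.Kinv i) = MulOpposite.op (D.minusRep.K i) := by
  have h : D.minusAntipode (D.minusRep.Kinv i) * D.minusAntipode (D.minusRep.K i) = 1 := by
    rw [← map_mul, BorelRep.Kinv_mul_K, map_one]
  refine left_inv_eq_right_inv h ?_
  rw [minusAntipode_K, ← MulOpposite.op_mul, BorelRep.K_mul_Kinv, MulOpposite.op_one]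

instance : Bialgebra k D.UPlus := Bialgebra.ofAlgHom D.plusComul D.plusCounit
  (by
    refine D.plus_algHom_ext (fun i => ?_) (fun i => ?_)
    · simp [plusComul_K]
    · simp only [AlgHom.comp_apply, plusComul_X, plusComul_K, map_add,
        Algebra.TensorProduct.map_tmul, AlgHom.id_apply, TensorProduct.add_tmul,
        TensorProduct.tmul_add, map_one, Algebra.TensorProduct.one_def]
      exact add_assoc _ _ _)
  (by
    refine D.plus_algHom_ext (fun i => ?_) (fun i => ?_)
    · simp [plusComul_K, plusCounit_K]
    · simp [plusComul_X, plusCounit_X, plusCounit_K])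
  (by
    refine D.plus_algHom_ext (fun i => ?_) (fun i => ?_)
    · simp [plusComul_K, plusCounit_K]
    · simp [plusComul_X, plusCounit_X])

instance : Bialgebra k D.UMinus := Bialgebra.ofAlgHom D.minusComul D.minusCounit
  (by
    refine D.minus_algHom_ext (fun i => ?_) (fun i => ?_)
    · simp [minusComul_K]
    · simp only [AlgHom.comp_apply, minusComul_X, minusComul_Kinv, map_add,
        Algebra.TensorProduct.map_tmul, AlgHom.id_apply, TensorProduct.add_tmul,
        TensorProduct.tmul_add, map_one, Algebra.TensorProduct.one_def]
      exact add_assoc _ _ _)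
  (by
    refine D.minus_algHom_ext (fun i => ?_) (fun i => ?_)
    · simp [minusComul_K, minusCounit_K]
    · simp [minusComul_X, minusCounit_X])
  (by
    refine D.minus_algHom_ext (fun i => ?_) (fun i => ?_)
    · simp [minusComul_K, minusCounit_K]
    · simp [minusComul_X, minusCounit_X, minusCounit_Kinv])

theorem comul_eq_plusComul (z : D.UPlus) : comul (R := k) z = D.plusComul z := rfl

theorem counit_eq_plusCounit (z : D.UPlus) : counit (R := k) z = D.plusCounit z := rfl

theorem comul_eq_minusComul (z : D.UMinus) : comul (R := k) z = D.minusComul z := rfl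

theorem counit_eq_minusCounit (z : D.UMinus) : counit (R := k) z = D.minusCounit z := rfl

/-- The Hopf algebra `𝔲_q^+`. -/
instance : HopfAlgebra k D.UPlus :=
  hopfOfGenerators D.plusAntipode D.plusGen D.adjoin_plusGen <| by
  rintro _ (⟨i, rfl⟩ | ⟨i, rfl⟩)
  · constructor
    · rw [comul_eq_plusComul, counit_eq_plusCounit, plusComul_K, plusCounit_K]
      change (D.plusAntipode (D.plusRep.K i)).unop * D.plusRep.K i = _
      simp [plusAntipode_K, BorelRep.Kinv_mul_K]
    · rw [comul_eq_plusComul, counit_eq_plusCounit, plusComul_K, plusCounit_K]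
      change D.plusRep.K i * (D.plusAntipode (D.plusRep.K i)).unop = _
      simp [plusAntipode_K, BorelRep.K_mul_Kinv]
  · constructor
    · rw [comul_eq_plusComul, counit_eq_plusCounit, plusComul_X, plusCounit_X]
      simp only [map_add]
      change (D.plusAntipode (D.plusRep.X i)).unop * 1 +
        (D.plusAntipode (D.plusRep.K i)).unop * D.plusRep.X i = _
      simp [plusAntipode_K, plusAntipode_X]
    · rw [comul_eq_plusComul, counit_eq_plusCounit, plusComul_X, plusCounit_X]
      simp only [map_add]
      change D.plusRep.X i * (D.plusAntipode 1).unop +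
        D.plusRep.K i * (D.plusAntipode (D.plusRep.X i)).unop = _
      simp [plusAntipode_X, ← mul_assoc, BorelRep.K_mul_Kinv]

/-- The Hopf algebra `𝔲_q^-`. -/
instance : HopfAlgebra k D.UMinus :=
  hopfOfGenerators D.minusAntipode D.minusGen D.adjoin_minusGen <| by
  rintro _ (⟨i, rfl⟩ | ⟨i, rfl⟩)
  · constructor
    · rw [comul_eq_minusComul, counit_eq_minusCounit, minusComul_K, minusCounit_K]
      change (D.minusAntipode (D.minusRep.K i)).unop * D.minusRep.K i = _
      simp [minusAntipode_K, BorelRep.Kinv_mul_K]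
    · rw [comul_eq_minusComul, counit_eq_minusCounit, minusComul_K, minusCounit_K]
      change D.minusRep.K i * (D.minusAntipode (D.minusRep.K i)).unop = _
      simp [minusAntipode_K, BorelRep.K_mul_Kinv]
  · constructor
    · rw [comul_eq_minusComul, counit_eq_minusCounit, minusComul_X, minusCounit_X]
      simp only [map_add]
      change (D.minusAntipode (D.minusRep.X i)).unop * D.minusRep.Kinv i +
        (D.minusAntipode 1).unop * D.minusRep.X i = _
      simp [minusAntipode_X, mul_assoc, BorelRep.K_mul_Kinv]
    · rw [comul_eq_minusComul, counit_eq_minusCounit, minusComul_X, minusCounit_X]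
      simp only [map_add]
      change D.minusRep.X i * (D.minusAntipode (D.minusRep.Kinv i)).unop +
        1 * (D.minusAntipode (D.minusRep.X i)).unop = _
      simp [minusAntipode_X, minusAntipode_Kinv]

theorem antipode_eq_plusAntipode (z : D.UPlus) :
    HopfAlgebra.antipode k z = (D.plusAntipode z).unop := rfl

theorem antipode_eq_minusAntipode (z : D.UMinus) :
    HopfAlgebra.antipode k z = (D.minusAntipode z).unop := rfl

end QuantumDatum

namespace QuantumDatum

variable {k : Type*} [Field k] (D : QuantumDatum k)

theorem plus_induction {P : D.UPlus → Prop} (hK : ∀ i, P (D.plusRep.K i))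
    (hX : ∀ i, P (D.plusRep.X i)) (h1 : ∀ r : k, P (algebraMap k D.UPlus r))
    (hadd : ∀ x y, P x → P y → P (x + y)) (hmul : ∀ x y, P x → P y → P (x * y)) (x) : P x := by
  have hx : x ∈ Algebra.adjoin k D.plusGen := by
    rw [D.adjoin_plusGen]
    exact Algebra.mem_top
  refine Algebra.adjoin_induction (p := fun x _ => P x) ?_ h1 (fun x y _ _ => hadd x y)
    (fun x y _ _ => hmul x y) hx
  rintro _ (⟨i, rfl⟩ | ⟨i, rfl⟩)
  exacts [hK i, hX i]

theorem minus_induction {P : D.UMinus → Prop} (hK : ∀ i, P (D.minusRep.K i))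
    (hX : ∀ i, P (D.minusRep.X i)) (h1 : ∀ r : k, P (algebraMap k D.UMinus r))
    (hadd : ∀ x y, P x → P y → P (x + y)) (hmul : ∀ x y, P x → P y → P (x * y)) (x) : P x := by
  have hx : x ∈ Algebra.adjoin k D.minusGen := by
    rw [D.adjoin_minusGen]
    exact Algebra.mem_top
  refine Algebra.adjoin_induction (p := fun x _ => P x) ?_ h1 (fun x y _ _ => hadd x y)
    (fun x y _ _ => hmul x y) hx
  rintro _ (⟨i, rfl⟩ | ⟨i, rfl⟩)
  exacts [hK i, hX i]

/-- The character `K_j ↦ q^(x_j)`, `F_j ↦ 0` of `𝔲_q^-`. -/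
def charHom (x : D.Vertex) : D.UMinus →ₐ[k] k := D.minusLift
  { K := fun j => D.qpow (x j)
    X := fun _ => 0
    K_pow := fun j => by
      rw [← AddChar.map_nsmul_eq_pow]
      simp
    K_comm := fun _ _ => mul_comm _ _
    K_mul_X := by simp }

theorem charHom_K (x : D.Vertex) (j : Fin D.t) :
    D.charHom x (D.minusRep.K j) = D.qpow (x j) := D.minusLift_K _ j

theorem charHom_X (x : D.Vertex) (j : Fin D.t) : D.charHom x (D.minusRep.X j) = 0 :=
  D.minusLift_X _ j

theorem charHom_Kinv (x : D.Vertex) (j : Fin D.t) :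
    D.charHom x (D.minusRep.Kinv j) = D.qpow (-x j) := by
  have h : D.charHom x (D.minusRep.Kinv j) * D.charHom x (D.minusRep.K j) = 1 := by
    rw [← map_mul, BorelRep.Kinv_mul_K, map_one]
  rw [charHom_K] at h
  rw [AddChar.map_neg_eq_inv]
  exact eq_inv_of_mul_eq_one_left h

theorem charHom_zero : D.charHom 0 = D.minusCounit := by
  refine D.minus_algHom_ext (fun i => ?_) (fun i => ?_)
  · rw [charHom_K, minusCounit_K]
    exact AddChar.map_zero_eq_one _
  · rw [charHom_X, minusCounit_X]

/-- Linear functionals on `𝔲_q^-` under convolution. -/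
abbrev Dual : Type _ := WithConv (D.UMinus →ₗ[k] k)

/-- A character as an element of the convolution algebra. -/
def charDual (x : D.Vertex) : D.Dual := WithConv.toConv (D.charHom x).toLinearMap

theorem charDual_zero : D.charDual 0 = 1 := by
  ext b
  change D.charHom 0 b = D.minusCounit b
  rw [charHom_zero]

theorem charDual_add (x y : D.Vertex) : D.charDual (x + y) = D.charDual x * D.charDual y := by
  have h : D.charHom (x + y) = (Algebra.TensorProduct.lift (D.charHom x) (D.charHom y)
      (fun _ _ => Commute.all _ _)).comp D.minusComul := by
    refine D.minus_algHom_ext (fun i => ?_) (fun i => ?_)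
    · simp only [AlgHom.comp_apply, minusComul_K, Algebra.TensorProduct.lift_tmul, charHom_K]
      exact AddChar.map_add_eq_mul _ _ _
    · simp [minusComul_X, charHom_X]
  ext b
  change D.charHom (x + y) b = LinearMap.mul' k k (TensorProduct.map (D.charHom x).toLinearMap
    (D.charHom y).toLinearMap (D.minusComul b))
  rw [h, AlgHom.comp_apply]
  induction D.minusComul b with
  | zero => simp
  | add u v hu hv => simp only [map_add, hu, hv]
  | tmul u v => simp

theorem charDual_nsmul (m : ℕ) (x : D.Vertex) : D.charDual (m • x) = D.charDual x ^ m := by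
  induction m with
  | zero => rw [zero_smul, charDual_zero, pow_zero]
  | succ m ih => rw [succ_nsmul, charDual_add, ih, pow_succ]

theorem nsmul_vertex (x : D.Vertex) (j : Fin D.t) : (D.n • x) j = 0 := by
  change D.n • x j = 0
  simp

/-- The exponents of the character `φ(K_i, -)`: the negative of the `i`-th row of `C`. -/
def weight (i : Fin D.t) : D.Vertex := fun j => -(D.C i j : ZMod D.n)

/-- The value `φ(E_i, F_i) = -1 / (q - q⁻¹)`. -/
def pairingConst : k := -(D.q - D.q⁻¹)⁻¹

/-- The representation `K_j ↦ diag(q^(-a_ij), 1)`, `F_j ↦ -δ_ij / (q - q⁻¹) E_12` of `𝔲_q^-` by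
triangular matrices. -/
def matHom (i : Fin D.t) : D.UMinus →ₐ[k] Matrix (Fin 2) (Fin 2) k := D.minusLift
  { K := fun j => !![D.qpow (D.weight i j), 0; 0, 1]
    X := fun j => if i = j then !![0, D.pairingConst; 0, 0] else 0
    K_pow := fun j => by
      have h : ∀ (x : k) (m : ℕ), !![x, 0; 0, 1] ^ m = !![x ^ m, 0; 0, 1] := by
        intro x m
        induction m with
        | zero => simp [Matrix.one_fin_two]
        | succ m ih => rw [pow_succ, ih]; simp [pow_succ]
      rw [h, ← AddChar.map_nsmul_eq_pow]
      simp [Matrix.one_fin_two]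
    K_comm := fun j l => by simp [mul_comm]
    K_mul_X := fun j l => by
      by_cases h : i = l
      · subst h
        simp [weight, ← D.qpow_intCast, D.symm.apply i j, Matrix.smul_of]
      · simp [h] }

theorem matHom_K (i j : Fin D.t) :
    D.matHom i (D.minusRep.K j) = !![D.qpow (D.weight i j), 0; 0, 1] := D.minusLift_K _ j

theorem matHom_X (i j : Fin D.t) : D.matHom i (D.minusRep.X j) =
    if i = j then !![0, D.pairingConst; 0, 0] else 0 := D.minusLift_X _ j

theorem matHom_entries (i : Fin D.t) (b : D.UMinus) : D.matHom i b 1 0 = 0 ∧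
    D.matHom i b 0 0 = D.charHom (D.weight i) b ∧ D.matHom i b 1 1 = D.minusCounit b := by
  induction b using minus_induction with
  | hK j => simp [matHom_K, charHom_K, minusCounit_K]
  | hX j =>
    rw [matHom_X, charHom_X, minusCounit_X]
    split_ifs <;> simp
  | h1 r => simp [Matrix.algebraMap_matrix_apply]
  | hadd x y hx hy => simp [hx, hy]
  | hmul x y hx hy => simp [Matrix.mul_apply, Fin.sum_univ_two, hx, hy]

/-- The functional `φ(E_i, -)`. -/
def skewDual (i : Fin D.t) : D.Dual := WithConv.toConv
  (Matrix.entryLinearMap k k 0 1 ∘ₗ (D.matHom i).toLinearMap)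

theorem skewDual_apply (i : Fin D.t) (b : D.UMinus) : D.skewDual i b = D.matHom i b 0 1 := rfl

theorem skewDual_mul (i : Fin D.t) (b b' : D.UMinus) : D.skewDual i (b * b') =
    D.charHom (D.weight i) b * D.skewDual i b' + D.skewDual i b * D.minusCounit b' := by
  simp only [skewDual_apply, map_mul, Matrix.mul_apply, Fin.sum_univ_two, D.matHom_entries i]

/-- Triangular representations that agree on generators up to a conjugation by a diagonal matrix
agree everywhere up to it. -/
theorem triangular_ext {M N : D.UMinus →ₐ[k] Matrix (Fin 2) (Fin 2) k} (s : k)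
    (hK : ∀ j, M (D.minusRep.K j) 0 0 = N (D.minusRep.K j) 0 0 ∧
      M (D.minusRep.K j) 1 1 = N (D.minusRep.K j) 1 1 ∧ M (D.minusRep.K j) 1 0 = 0 ∧
      N (D.minusRep.K j) 1 0 = 0 ∧ M (D.minusRep.K j) 0 1 = s * N (D.minusRep.K j) 0 1)
    (hX : ∀ j, M (D.minusRep.X j) 0 0 = N (D.minusRep.X j) 0 0 ∧
      M (D.minusRep.X j) 1 1 = N (D.minusRep.X j) 1 1 ∧ M (D.minusRep.X j) 1 0 = 0 ∧
      N (D.minusRep.X j) 1 0 = 0 ∧ M (D.minusRep.X j) 0 1 = s * N (D.minusRep.X j) 0 1)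
    (b : D.UMinus) : M b 0 0 = N b 0 0 ∧ M b 1 1 = N b 1 1 ∧ M b 1 0 = 0 ∧ N b 1 0 = 0 ∧
      M b 0 1 = s * N b 0 1 := by
  induction b using minus_induction with
  | hK j => exact hK j
  | hX j => exact hX j
  | h1 r => simp [Matrix.algebraMap_matrix_apply]
  | hadd x y hx hy => simp [hx, hy, mul_add]
  | hmul x y hx hy =>
    simp only [map_mul, Matrix.mul_apply, Fin.sum_univ_two, hx, hy, mul_zero, zero_mul, add_zero,
      zero_add, true_and]
    ring

theorem skewDual_mul_charDual (i j : Fin D.t) :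
    D.skewDual j * D.charDual (D.weight i) =
      D.q ^ (1 * D.C i j) • (D.charDual (D.weight i) * D.skewDual j) := by
  let c : D.UMinus →ₐ[k] Matrix (Fin 2) (Fin 2) k :=
    (Algebra.ofId k _).comp (D.charHom (D.weight i))
  have hc : ∀ b, c b = algebraMap k _ (D.charHom (D.weight i) b) := fun b => rfl
  have h1 : ∀ x y, Commute (D.matHom j x) (c y) := fun x y =>
    (Algebra.commutes (D.charHom (D.weight i) y) (D.matHom j x)).symm
  let M := (Algebra.TensorProduct.lift (D.matHom j) c h1).comp D.minusComul
  let N := (Algebra.TensorProduct.lift c (D.matHom j) fun x y => (h1 y x).symm).comp D.minusComul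
  have hMK : ∀ l, M (D.minusRep.K l) = D.matHom j (D.minusRep.K l) * c (D.minusRep.K l) := by
    intro l
    simp [M, minusComul_K]
  have hNK : ∀ l, N (D.minusRep.K l) = c (D.minusRep.K l) * D.matHom j (D.minusRep.K l) := by
    intro l
    simp [N, minusComul_K]
  have hMX : ∀ l, M (D.minusRep.X l) =
      D.matHom j (D.minusRep.X l) * c (D.minusRep.Kinv l) := by
    intro l
    simp [M, minusComul_X, hc, charHom_X]
  have hNX : ∀ l, N (D.minusRep.X l) = D.matHom j (D.minusRep.X l) := by
    intro l
    simp [N, minusComul_X, hc, charHom_X]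
  have h := D.triangular_ext (M := M) (N := N) (D.q ^ D.C i j)
    (fun l => by
      rw [hMK, hNK, matHom_K, hc, charHom_K]
      simp [Matrix.algebraMap_eq_diagonal, mul_comm])
    (fun l => by
      rw [hMX, hNX, matHom_X, hc, charHom_Kinv]
      by_cases hjl : j = l
      · subst hjl
        simp [Matrix.algebraMap_eq_diagonal, weight, D.qpow_intCast, mul_comm]
      · simp [hjl])
  have hM : ∀ z, Algebra.TensorProduct.lift (D.matHom j) c h1 z 0 1 = LinearMap.mul' k k
      (TensorProduct.map (D.skewDual j).ofConv (D.charDual (D.weight i)).ofConv z) := by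
    intro z
    induction z with
    | zero => simp
    | add u v hu hv => simp only [map_add, Matrix.add_apply, hu, hv]
    | tmul u v =>
      simp only [Algebra.TensorProduct.lift_tmul, hc, Matrix.algebraMap_eq_diagonal,
        TensorProduct.map_tmul, LinearMap.mul'_apply]
      rw [Matrix.mul_diagonal]
      rfl
  have hN : ∀ z, Algebra.TensorProduct.lift c (D.matHom j) (fun x y => (h1 y x).symm) z 0 1 =
      LinearMap.mul' k k
      (TensorProduct.map (D.charDual (D.weight i)).ofConv (D.skewDual j).ofConv z) := by
    intro z
    induction z with
    | zero => simp
    | add u v hu hv => simp only [map_add, Matrix.add_apply, hu, hv]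
    | tmul u v =>
      simp only [Algebra.TensorProduct.lift_tmul, hc, Matrix.algebraMap_eq_diagonal,
        TensorProduct.map_tmul, LinearMap.mul'_apply]
      rw [Matrix.diagonal_mul]
      rfl
  ext b
  rw [one_mul]
  refine (hM (D.minusComul b)).symm.trans ((h b).2.2.2.2.trans ?_)
  exact congrArg _ (hN (D.minusComul b))

/-- The functionals `φ(K_i, -)` and `φ(E_i, -)`. -/
def dualRep : D.BorelRep 1 D.Dualᵐᵒᵖ where
  K i := MulOpposite.op (D.charDual (D.weight i))
  X i := MulOpposite.op (D.skewDual i)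
  K_pow i := by
    rw [← MulOpposite.op_pow, ← charDual_nsmul,
      show D.n • D.weight i = 0 from funext fun j => D.nsmul_vertex _ j, charDual_zero, MulOpposite.op_one]
  K_comm i j := by
    rw [← MulOpposite.op_mul, ← MulOpposite.op_mul, ← charDual_add, ← charDual_add, add_comm]
  K_mul_X i j := by
    rw [← MulOpposite.op_mul, ← MulOpposite.op_mul, ← MulOpposite.op_smul,
      skewDual_mul_charDual]

/-- `a ↦ φ(a, -)`. -/
def dualHom : D.UPlus →ₐ[k] D.Dualᵐᵒᵖ := D.plusLift D.dualRep

/-- The pairing `φ`. -/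
def pairingLin : D.UPlus →ₗ[k] D.UMinus →ₗ[k] k :=
  (WithConv.linearEquiv k (D.UMinus →ₗ[k] k)).toLinearMap ∘ₗ
    (MulOpposite.opLinearEquiv k).symm.toLinearMap ∘ₗ D.dualHom.toLinearMap

theorem pairingLin_apply (a : D.UPlus) (b : D.UMinus) :
    D.pairingLin a b = (D.dualHom a).unop b := rfl

theorem pairingLin_one (b : D.UMinus) : D.pairingLin 1 b = counit (R := k) b := by
  rw [pairingLin_apply, map_one]
  rfl

theorem pairingLin_mul (a a' : D.UPlus) (b : D.UMinus) : D.pairingLin (a * a') b =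
    LinearMap.mul' k k (TensorProduct.map (D.pairingLin a') (D.pairingLin a)
      (comul (R := k) b)) := by
  rw [pairingLin_apply, map_mul]
  rfl

theorem pairingLin_K (i : Fin D.t) (b : D.UMinus) :
    D.pairingLin (D.plusRep.K i) b = D.charHom (D.weight i) b := by
  rw [pairingLin_apply, dualHom, plusLift_K]
  rfl

theorem pairingLin_X (i : Fin D.t) (b : D.UMinus) :
    D.pairingLin (D.plusRep.X i) b = D.skewDual i b := by
  rw [pairingLin_apply, dualHom, plusLift_X]
  rfl

theorem pairingLin_mul_right (a : D.UPlus) : ∀ b b', D.pairingLin a (b * b') =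
    LinearMap.mul' k k (TensorProduct.map (D.pairingLin.flip b) (D.pairingLin.flip b')
      (comul (R := k) a)) := by
  induction a using plus_induction with
  | hK i =>
    intro b b'
    rw [comul_eq_plusComul, plusComul_K]
    simp [pairingLin_K]
  | hX i =>
    intro b b'
    rw [comul_eq_plusComul, plusComul_X]
    simp only [map_add, TensorProduct.map_tmul, LinearMap.mul'_apply, LinearMap.flip_apply,
      pairingLin_K, pairingLin_X, pairingLin_one, skewDual_mul, counit_eq_minusCounit]
    ring
  | h1 r =>
    intro b b'
    simp [Algebra.algebraMap_eq_smul_one, pairingLin_one, Algebra.TensorProduct.one_def]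
  | hadd x y hx hy =>
    intro b b'
    simp only [map_add, LinearMap.add_apply, hx, hy]
  | hmul a a' ha ha' =>
    intro b b'
    obtain ⟨m, U, w, hU, rfl⟩ := exists_comatrix (k := k) b
    obtain ⟨m', U', w', hU', rfl⟩ := exists_comatrix (k := k) b'
    have hflip : ∀ {m : ℕ} {U : Fin m → Fin m → D.UMinus} (hU : IsComatrix (k := k) U) p q
        (a a' : D.UPlus), D.pairingLin (a * a') (U p q) =
        ∑ l, D.pairingLin a' (U p l) * D.pairingLin a (U l q) := by
      intro m U hU p q a a'
      rw [pairingLin_mul, hU.comul_eq]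
      simp
    have hT : ∀ p q i j (z z' : D.UPlus ⊗[k] D.UPlus),
        LinearMap.mul' k k (TensorProduct.map (D.pairingLin.flip (U p q))
          (D.pairingLin.flip (U' i j)) (z * z')) =
        ∑ l, ∑ r, LinearMap.mul' k k (TensorProduct.map (D.pairingLin.flip (U p l))
          (D.pairingLin.flip (U' i r)) z') *
        LinearMap.mul' k k (TensorProduct.map (D.pairingLin.flip (U l q))
          (D.pairingLin.flip (U' r j)) z) := by
      intro p q i j z z'
      induction z with
      | zero => simp
      | add u v hu hv => simp only [add_mul, map_add, hu, hv, mul_add, Finset.sum_add_distrib]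
      | tmul u v =>
        induction z' with
        | zero => simp
        | add u v hu hv => simp only [add_mul, map_add, hu, hv, mul_add, Finset.sum_add_distrib]
        | tmul u' v' =>
          simp only [Algebra.TensorProduct.tmul_mul_tmul, TensorProduct.map_tmul,
            LinearMap.mul'_apply, LinearMap.flip_apply, hflip hU, hflip hU', Finset.sum_mul_sum]
          exact Finset.sum_congr rfl fun l _ => Finset.sum_congr rfl fun r _ => by ring
    have key : ∀ p q i j, D.pairingLin (a * a') (U p q * U' i j) =
        LinearMap.mul' k k (TensorProduct.map (D.pairingLin.flip (U p q))
          (D.pairingLin.flip (U' i j)) (comul (R := k) (a * a'))) := by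
      intro p q i j
      rw [Bialgebra.comul_mul, hT, pairingLin_mul, Bialgebra.comul_mul, hU.comul_eq,
        hU'.comul_eq, Finset.sum_mul_sum]
      simp only [Algebra.TensorProduct.tmul_mul_tmul, map_sum, TensorProduct.map_tmul,
        LinearMap.mul'_apply, ha, ha']
    have key2 : ∀ z, ∃ B : D.UMinus →ₗ[k] D.UMinus →ₗ[k] k, ∀ b b', LinearMap.mul' k k
        (TensorProduct.map (D.pairingLin.flip b) (D.pairingLin.flip b') z) = B b b' := by
      intro z
      refine ⟨LinearMap.mk₂ k (fun b b' => LinearMap.mul' k k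
        (TensorProduct.map (D.pairingLin.flip b) (D.pairingLin.flip b') z)) ?_ ?_ ?_ ?_,
        fun b b' => rfl⟩
      · intro b c b'
        simp only [map_add, TensorProduct.map_add_left, LinearMap.add_apply]
      · intro r b b'
        simp only [map_smul, TensorProduct.map_smul_left, LinearMap.smul_apply]
      · intro b b' c
        simp only [map_add, TensorProduct.map_add_right, LinearMap.add_apply]
      · intro r b b'
        simp only [map_smul, TensorProduct.map_smul_right, LinearMap.smul_apply]
    obtain ⟨B, hB⟩ := key2 (comul (R := k) (a * a'))
    simp only [hB] at key ⊢
    simp only [Finset.sum_mul, Finset.mul_sum, smul_mul_smul_comm, map_sum, map_smul, key,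
      LinearMap.sum_apply, LinearMap.smul_apply, smul_smul, Finset.smul_sum, mul_comm]

/-- The skew Hopf pairing `𝔲_q^+ × 𝔲_q^- → k`, determined by `φ(K_i, K_j) = q^(-a_ij)`,
`φ(E_i, F_j) = -δ_ij / (q - q⁻¹)`, `φ(E_i, K_j) = φ(K_i, F_j) = 0`. -/
def pairing : SkewHopfPairing k D.UPlus D.UMinus where
  toLin := D.pairingLin
  one_left := D.pairingLin_one
  one_right a := by
    induction a using plus_induction with
    | hK i => rw [pairingLin_K, map_one, counit_eq_plusCounit, plusCounit_K]
    | hX i =>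
      rw [pairingLin_X, counit_eq_plusCounit, plusCounit_X, skewDual_apply, map_one]
      simp
    | h1 r => simp [Algebra.algebraMap_eq_smul_one, pairingLin_one]
    | hadd x y hx hy => simp only [map_add, LinearMap.add_apply, hx, hy]
    | hmul x y hx hy =>
      rw [pairingLin_mul, Bialgebra.comul_one, Algebra.TensorProduct.one_def,
        Bialgebra.counit_mul]
      simp [hx, hy, mul_comm]
  mul_left := D.pairingLin_mul
  mul_right := D.pairingLin_mul_right

end QuantumDatum

namespace QuantumDatum

variable {k : Type*} [Field k] (D : QuantumDatum k)

theorem pairing_K_K (i j : Fin D.t) :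
    D.pairing.toLin (D.plusRep.K i) (D.minusRep.K j) = D.q ^ (-D.C i j) := by
  refine (D.pairingLin_K i _).trans ?_
  rw [charHom_K, weight, ← qpow_intCast, Int.cast_neg]

theorem pairing_E_F (i j : Fin D.t) : D.pairing.toLin (D.plusRep.X i) (D.minusRep.X j) =
    if i = j then -(D.q - D.q⁻¹)⁻¹ else 0 := by
  refine (D.pairingLin_X i _).trans ?_
  rw [skewDual_apply, matHom_X]
  split_ifs <;> simp [pairingConst]

theorem pairing_E_K (i j : Fin D.t) :
    D.pairing.toLin (D.plusRep.X i) (D.minusRep.K j) = 0 := by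
  refine (D.pairingLin_X i _).trans ?_
  rw [skewDual_apply, matHom_K]
  simp

theorem pairing_K_F (i j : Fin D.t) :
    D.pairing.toLin (D.plusRep.K i) (D.minusRep.X j) = 0 :=
  (D.pairingLin_K i _).trans (D.charHom_X _ _)

/-- The Drinfeld double `𝒟(𝔲_q)` of the skew Hopf pairing `𝔲_q^+ × 𝔲_q^- → k`. -/
abbrev Double : Type _ := DrinfeldDouble D.pairing

/-- The two-sided ideal `I` of `𝒟(𝔲_q)` generated by the elements `K_i ⊗ 1 - 1 ⊗ K_i`. -/
def doubleIdeal : Ideal D.Double := (TwoSidedIdeal.span (Set.range fun i : Fin D.t =>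
  DrinfeldDouble.tmul D.pairing (D.plusRep.K i) 1 -
    DrinfeldDouble.tmul D.pairing 1 (D.minusRep.K i))).asIdeal

instance : D.doubleIdeal.IsTwoSided := by
  unfold doubleIdeal
  infer_instance

end QuantumDatum

end QuiverDouble

end

noncomputable section

namespace QuiverDouble

open scoped TensorProduct
open Coalgebra

/-! ### Comatrices and the compatibility of bialgebra maps with antipodes. -/

section Antipode

variable {k A B : Type*} [Field k] [Ring A] [Ring B] [HopfAlgebra k A] [HopfAlgebra k B]

/-! The vertex idempotents of $\Pi^{\mathcal C}$ and the group-likes $K_i$ carry the same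
information, and the two algebras are the same algebra described through one or the other. In
$\Pi^{\mathcal C}$ put $K_i=\sum_x q^{x_i}e_x$, $E_i=\sum_x a(x,i)$, $F_i=\sum_x a(x,i)^*$. The
quiver relations then say that $K_i^n=1$, that the $K_i$ commute, that $K_iE_j=q^{a_{ij}}E_jK_i$ and
$K_iF_j=q^{-a_{ij}}F_jK_i$, and that $E_iF_j-F_jE_i=\delta_{ij}(K_i-K_i^{-1})/(q-q^{-1})$. The
arrows come back as $a(x,i)=e_xE_i$ and $a(x,i)^*=F_ie_x$.

In the double, `DrinfeldDouble.snd_mul_fst` evaluated on generators gives the same cross relations,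
except that the commutator of $E_i$ and $F_i$ is $(K_i\otimes 1-1\otimes K_i^{-1})/(q-q^{-1})$, with
the two group-likes in different factors (`dblSnd_F_mul_E`). Dividing by $I$ identifies the two
copies of $K_i$. As $\mathfrak u_q^{\pm}$ carry no relations besides those between the $K$'s and
between $K$'s and $E$'s or $F$'s, the cross relations are all that is needed to map the double to
$\Pi^{\mathcal C}$: a pair of algebra maps on the two factors extends to the double once these hold
on generators (`DrinfeldDouble.lift`, `commSubalgebra_eq_top`).

For the inverse, the idempotents must be rebuilt from the $K_i$. Since $q$ is a primitive $n$-th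
root of unity, $n$ is invertible in $k$ and the powers $q^c$, $c\in\mathbb Z/n$, are distinct. Hence
commuting elements with $K_i^n=1$ are diagonalized by the discrete Fourier transform
$e_x=\prod_i\frac1n\sum_m q^{-mx_i}K_i^m$ (`exists_isWeightSystem`). An element that $q$-commutes
with the $K_i$ shifts weights (`IsWeightSystem.mul_shift`), so $E_i$ and $F_i$ shift by $\pm c^i$,
which is the shape of the quiver. The idempotents are determined by the $K_i$
(`IsWeightSystem.unique`), so they correspond under the two maps, which are therefore mutually
inverse (`quotEquiv`).

The Hopf part is a check on generators. The generators of $I$ are differences of group-likes, so the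
counit, the comultiplication and the antipode descend to the quotient; the isomorphism respects
counit and comultiplication because all maps concerned are algebra maps; and a bialgebra map between
Hopf algebras respects antipodes automatically (`bialgHom_antipode`). -/

theorem IsComatrix.map {m : ℕ} {U : Fin m → Fin m → A} (hU : IsComatrix (k := k) U)
    (f : A →ₐc[k] B) : IsComatrix (k := k) fun i j => f (U i j) where
  comul_eq i j := by
    rw [← CoalgHomClass.map_comp_comul_apply, hU.comul_eq, map_sum]
    rfl
  counit_eq i j := by
    rw [CoalgHomClass.counit_comp_apply, hU.counit_eq]

/-- A bialgebra homomorphism between Hopf algebras commutes with the antipodes. -/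
theorem bialgHom_antipode (f : A →ₐc[k] B) (x : A) :
    f (HopfAlgebra.antipode k x) = HopfAlgebra.antipode k (f x) := by
  refine LinearMap.congr_fun (f := (f : A →ₗ[k] B) ∘ₗ HopfAlgebra.antipode k)
    (g := HopfAlgebra.antipode k ∘ₗ (f : A →ₗ[k] B)) ?_ x
  refine linearMap_ext_comatrix (k := k) fun m U hU i j => ?_
  -- Uniqueness of convolution inverses in matrix form: with `Y` the image of a comatrix under `f`,
  -- the matrix `X` is a left inverse of `Y` by the antipode axiom of `A`, and `Z` a right inverse
  -- by that of `B`.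
  let X : Matrix (Fin m) (Fin m) B := Matrix.of fun i j => f (HopfAlgebra.antipode k (U i j))
  let Y : Matrix (Fin m) (Fin m) B := Matrix.of fun i j => f (U i j)
  let Z : Matrix (Fin m) (Fin m) B := Matrix.of fun i j => HopfAlgebra.antipode k (f (U i j))
  have h1 : X * Y = 1 := by
    ext i j
    simp only [X, Y, Matrix.mul_apply, Matrix.of_apply, ← map_mul, ← map_sum,
      hU.sum_antipode_mul, Matrix.one_apply]
    split_ifs <;> simp
  have h2 : Y * Z = 1 := by
    ext i j
    simp only [Y, Z, Matrix.mul_apply, Matrix.of_apply, (hU.map f).sum_mul_antipode,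
      Matrix.one_apply]
  have h3 := left_inv_eq_right_inv h1 h2
  exact congrFun (congrFun h3 i) j

/-- Group-likes are the comatrices of size one. In this form the general comatrix formulas for the
double apply directly to the $K_i$. -/
theorem isComatrix_of_comul_self {c : A} (h : comul (R := k) c = c ⊗ₜ[k] c)
    (h1 : counit (R := k) c = 1) : IsComatrix (k := k) fun _ _ : Fin 1 => c where
  comul_eq _ _ := by simpa using h
  counit_eq i j := by simpa [Subsingleton.elim i j] using h1

/-- A skew-primitive element and its two group-like elements form a comatrix. -/
theorem isComatrix_of_comul_skew {g h x : A} (hg : comul (R := k) g = g ⊗ₜ[k] g)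
    (hh : comul (R := k) h = h ⊗ₜ[k] h) (hx : comul (R := k) x = g ⊗ₜ[k] x + x ⊗ₜ[k] h)
    (hg1 : counit (R := k) g = 1) (hh1 : counit (R := k) h = 1)
    (hx0 : counit (R := k) x = 0) : IsComatrix (k := k) !![g, x; 0, h] where
  comul_eq i j := by
    fin_cases i <;> fin_cases j <;> simp [Fin.sum_univ_two, hg, hh, hx]
  counit_eq i j := by
    fin_cases i <;> fin_cases j <;> simp [hg1, hh1, hx0]

end Antipode

/-! ### Algebra maps out of a Drinfeld double. -/

namespace DrinfeldDouble

variable {k A B : Type*} [Field k] [Ring A] [Ring B] [HopfAlgebra k A] [HopfAlgebra k B]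
  {φ : SkewHopfPairing k A B} {R : Type*} [Ring R] [Algebra k R]

/-- The double is spanned by the products $(a\otimes1)(1\otimes b)=a\otimes b$, so it is generated
by its two factors. -/
theorem algHom_ext {f g : DrinfeldDouble φ →ₐ[k] R} (h1 : f.comp (fst φ) = g.comp (fst φ))
    (h2 : f.comp (snd φ) = g.comp (snd φ)) : f = g := by
  ext x
  induction x using induction_tmul with
  | h0 => simp
  | hadd x y hx hy => rw [map_add, map_add, hx, hy]
  | h a b =>
    rw [← fst_mul_snd, map_mul, map_mul]
    exact congrArg₂ (· * ·) (AlgHom.congr_fun h1 a) (AlgHom.congr_fun h2 b)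

/-- The linear map `a ⊗ b ↦ f(a) g(b)`. -/
def mulMap (φ : SkewHopfPairing k A B) (f : A →ₐ[k] R) (g : B →ₐ[k] R) :
    DrinfeldDouble φ →ₗ[k] R :=
  LinearMap.mul' k R ∘ₗ TensorProduct.map f.toLinearMap g.toLinearMap

theorem mulMap_tmul (f : A →ₐ[k] R) (g : B →ₐ[k] R) (a : A) (b : B) :
    mulMap φ f g (tmul φ a b) = f a * g b := rfl

/-- Here and in `mulMap_mul_snd` no relation between `f` and `g` is needed: these products never
move an element of `B` past an element of `A`. -/
theorem mulMap_fst_mul (f : A →ₐ[k] R) (g : B →ₐ[k] R) (a : A) (x : DrinfeldDouble φ) :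
    mulMap φ f g (fst φ a * x) = f a * mulMap φ f g x := by
  induction x using induction_tmul with
  | h0 => simp
  | hadd x y hx hy => simp only [mul_add, map_add, hx, hy]
  | h a' b => rw [fst_mul_tmul, mulMap_tmul, mulMap_tmul, map_mul, mul_assoc]

theorem mulMap_mul_snd (f : A →ₐ[k] R) (g : B →ₐ[k] R) (x : DrinfeldDouble φ) (b : B) :
    mulMap φ f g (x * snd φ b) = mulMap φ f g x * g b := by
  induction x using induction_tmul with
  | h0 => simp
  | hadd x y hx hy => simp only [add_mul, map_add, hx, hy]
  | h a b' => rw [tmul_mul_snd, mulMap_tmul, mulMap_tmul, map_mul, mul_assoc]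

/-- The elements of `B` for which the commutation relations of the Drinfeld double hold under
`f` and `g`. -/
def commSubalgebra (φ : SkewHopfPairing k A B) (f : A →ₐ[k] R) (g : B →ₐ[k] R) :
    Subalgebra k B where
  -- The condition is imposed for every `x` of the double and not only for elements $a\otimes1$: in
  -- this form it says that `mulMap` intertwines left multiplication by $1\otimes b$ with that by `g
  -- b`, which is visibly stable under products in `b`.
  carrier := {b | ∀ x, mulMap φ f g (snd φ b * x) = g b * mulMap φ f g x}
  algebraMap_mem' r x := by
    rw [AlgHom.commutes, AlgHom.commutes, ← Algebra.smul_def, ← Algebra.smul_def, map_smul]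
  add_mem' {b b'} hb hb' x := by
    rw [map_add, add_mul, map_add, hb, hb', map_add, add_mul]
  mul_mem' {b b'} hb hb' x := by
    rw [map_mul (snd φ), mul_assoc, hb, hb', map_mul g, mul_assoc]

/-- A right factor $1\otimes b'$ passes through `mulMap`, so the intertwining property only has to
be tested on $a\otimes1$. -/
theorem mem_commSubalgebra_of_fst {f : A →ₐ[k] R} {g : B →ₐ[k] R} {b : B}
    (h : ∀ a, mulMap φ f g (snd φ b * fst φ a) = g b * f a) : b ∈ commSubalgebra φ f g := by
  intro x
  induction x using induction_tmul with
  | h0 => simp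
  | hadd x y hx hy => simp only [mul_add, map_add, hx, hy]
  | h a b' =>
    rw [← fst_mul_snd, ← mul_assoc, mulMap_mul_snd, h, fst_mul_snd, mulMap_tmul, mul_assoc]

/-- Algebra maps on the two factors that satisfy the commutation relations induce an algebra map
on the Drinfeld double. -/
def lift (f : A →ₐ[k] R) (g : B →ₐ[k] R) (h : commSubalgebra φ f g = ⊤) :
    DrinfeldDouble φ →ₐ[k] R :=
  AlgHom.ofLinearMap (mulMap φ f g)
    (by rw [one_def, mulMap_tmul, map_one, map_one, one_mul])
    (fun x y => by
      induction x using induction_tmul with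
      | h0 => simp
      | hadd x y hx hy => simp only [add_mul, map_add, hx, hy]
      | h a b =>
        -- Left multiplication by $a\otimes b$ is that by $1\otimes b$ followed by that by
        -- $a\otimes1$. The second is always compatible with `mulMap`, the first by hypothesis.
        have hb : b ∈ commSubalgebra φ f g := h ▸ Algebra.mem_top
        rw [← fst_mul_snd, mul_assoc, mulMap_fst_mul, hb, fst_mul_snd, mulMap_tmul, mul_assoc])

theorem lift_fst (f : A →ₐ[k] R) (g : B →ₐ[k] R) (h : commSubalgebra φ f g = ⊤) (a : A) :
    lift f g h (fst φ a) = f a := by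
  change mulMap φ f g (tmul φ a 1) = _
  rw [mulMap_tmul, map_one, mul_one]

theorem lift_snd (f : A →ₐ[k] R) (g : B →ₐ[k] R) (h : commSubalgebra φ f g = ⊤) (b : B) :
    lift f g h (snd φ b) = g b := by
  change mulMap φ f g (tmul φ 1 b) = _
  rw [mulMap_tmul, map_one, one_mul]

theorem antipode_fst (a : A) :
    HopfAlgebra.antipode k (fst φ a) = fst φ (HopfAlgebra.antipode k a) := by
  change antipodeLin φ (tmul φ a 1) = _
  rw [antipodeLin_tmul, HopfAlgebra.antipode_one, map_one, one_mul]

theorem antipode_snd (b : B) :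
    HopfAlgebra.antipode k (snd φ b) = snd φ (HopfAlgebra.antipode k b) := by
  change antipodeLin φ (tmul φ 1 b) = _
  rw [antipodeLin_tmul, HopfAlgebra.antipode_one, map_one, mul_one]

end DrinfeldDouble

/-! ### Roots of unity and eigenprojections of an element of finite order. -/

namespace QuantumDatum

variable {k : Type*} [Field k] (D : QuantumDatum k)

theorem qpow_injective : Function.Injective D.qpow := by
  intro a b h
  rw [← ZMod.natCast_zmod_val a, ← ZMod.natCast_zmod_val b, qpow_natCast, qpow_natCast] at h
  rw [← ZMod.natCast_zmod_val a, ← ZMod.natCast_zmod_val b,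
    D.isPrimitiveRoot.pow_inj (ZMod.val_lt a) (ZMod.val_lt b) h]

/-- A field with a primitive $n$-th root of unity has characteristic prime to $n$. This permits the
factor $1/n$ in the Fourier projections. -/
theorem natCast_n_ne_zero : (D.n : k) ≠ 0 := D.isPrimitiveRoot.neZero'.out

/-- Orthogonality of characters of $\mathbb Z/n$: as $q$ is primitive, $m\mapsto q^{mc}$ is trivial
only for $c=0$. -/
theorem sum_qpow_mul (c : ZMod D.n) :
    ∑ m, D.qpow (m * c) = if c = 0 then (D.n : k) else 0 := by
  have h := AddChar.sum_mulShift c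
    (AddChar.zmodChar_primitive_of_primitive_root D.n D.isPrimitiveRoot)
  rw [ZMod.card] at h
  exact_mod_cast h

section Eigenprojection

variable {A : Type*} [Ring A] [Algebra k A] {u : A}

/-- The projection to the `q^c`-eigenspace of an element `u` with `u ^ n = 1`. -/
def eigenproj (u : A) (c : ZMod D.n) : A :=
  (D.n : k)⁻¹ • ∑ m, D.qpow (-(m * c)) • u ^ m.val

theorem mul_eigenproj (hu : u ^ D.n = 1) (c : ZMod D.n) :
    u * D.eigenproj u c = D.qpow c • D.eigenproj u c := by
  rw [eigenproj, mul_smul_comm, smul_comm]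
  congr 1
  rw [Finset.mul_sum, Finset.smul_sum]
  refine Fintype.sum_equiv (Equiv.addRight (1 : ZMod D.n)) _ _ fun m => ?_
  -- The exponent is the representative of a residue class in $[0,n)$, so the shift of the summation
  -- index wraps around at $n$; $u^n=1$ absorbs this.
  have h : u ^ (m + 1).val = u * u ^ m.val := by
    rw [← pow_succ', ZMod.val_add, pow_eq_pow_mod (m.val + 1) hu, ZMod.val_one_eq_one_mod,
      Nat.add_mod_mod]
  rw [Equiv.coe_addRight, h, mul_smul_comm, smul_smul, ← AddChar.map_add_eq_mul]
  congr 2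
  ring

theorem sum_eigenproj (u : A) : ∑ c, D.eigenproj u c = 1 := by
  simp only [eigenproj]
  rw [← Finset.smul_sum, Finset.sum_comm]
  -- With the sums exchanged, orthogonality leaves only the term $m=0$, which is $n\cdot u^0$ and
  -- cancels the factor $1/n$.
  have h : ∀ m : ZMod D.n, ∑ c, D.qpow (-(m * c)) • u ^ m.val =
      if m = 0 then (D.n : k) • (1 : A) else 0 := by
    intro m
    have h1 : ∀ c : ZMod D.n, -(m * c) = c * (-m) := fun c => by ring
    simp only [h1, ← Finset.sum_smul, sum_qpow_mul, neg_eq_zero]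
    split_ifs with h
    · simp [h]
    · simp
  simp only [h, Finset.sum_ite_eq', Finset.mem_univ, if_true, smul_smul]
  rw [inv_mul_cancel₀ D.natCast_n_ne_zero, one_smul]

theorem eigenproj_mul_eigenproj (hu : u ^ D.n = 1) (c d : ZMod D.n) :
    D.eigenproj u c * D.eigenproj u d = if c = d then D.eigenproj u c else 0 := by
  have h : ∀ m : ℕ, u ^ m * D.eigenproj u d = D.qpow (m * d) • D.eigenproj u d := by
    intro m
    induction m with
    | zero => simp
    | succ m ih =>
      rw [pow_succ', mul_assoc, ih, mul_smul_comm, mul_eigenproj D hu, smul_smul,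
        ← AddChar.map_add_eq_mul]
      congr 2
      push_cast
      ring
  -- Only the left factor is expanded. Its powers of `u` act on the right factor as $q^{md}$, so it
  -- becomes the scalar $\frac1n\sum_m q^{m(d-c)}$, which is $1$ or $0$ by orthogonality.
  conv_lhs => rw [eigenproj]
  simp only [smul_mul_assoc, Finset.sum_mul, h, smul_smul, ZMod.natCast_val, ZMod.cast_id,
    ← AddChar.map_add_eq_mul]
  have h1 : ∀ m : ZMod D.n, -(m * c) + m * d = m * (d - c) := fun m => by ring
  simp only [h1, ← Finset.sum_smul, sum_qpow_mul, smul_smul, sub_eq_zero, eq_comm (a := d)]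
  split_ifs with h
  · rw [inv_mul_cancel₀ D.natCast_n_ne_zero, one_smul, h]
  · simp

end Eigenprojection

/-! ### Weight idempotents: existence, uniqueness and shifts. -/

/-- A complete system of orthogonal idempotents that simultaneously diagonalizes elements `K_i`
with eigenvalues `q^(x_i)`. -/
structure IsWeightSystem {R : Type*} [Ring R] [Algebra k R] (K : Fin D.t → R)
    (e : D.Vertex → R) : Prop where
  mul_self : ∀ x y, e x * e y = if x = y then e x else 0
  sum_eq : ∑ x, e x = 1
  K_mul : ∀ i x, K i * e x = D.qpow (x i) • e x
  mul_K : ∀ i x, e x * K i = D.qpow (x i) • e x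

/-- The joint projection to weight $x$ is the product over $i$ of the projections of $K_i$ to the
eigenvalue $q^{x_i}$. -/
theorem exists_isWeightSystem_of_comm {A : Type*} [CommRing A] [Algebra k A] {K : Fin D.t → A}
    (hK : ∀ i, K i ^ D.n = 1) : ∃ e, D.IsWeightSystem K e := by
  have hmul : ∀ i (x : D.Vertex), K i * ∏ j, D.eigenproj (K j) (x j) =
      D.qpow (x i) • ∏ j, D.eigenproj (K j) (x j) := by
    intro i x
    rw [← Finset.mul_prod_erase _ _ (Finset.mem_univ i), ← mul_assoc, mul_eigenproj D (hK i),
      smul_mul_assoc]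
  refine ⟨fun x => ∏ i, D.eigenproj (K i) (x i), fun x y => ?_, ?_, hmul, fun i x => ?_⟩
  · simp only [← Finset.prod_mul_distrib, eigenproj_mul_eigenproj D (hK _)]
    split_ifs with h
    · simp [h]
    · obtain ⟨i, hi⟩ := Function.ne_iff.1 h
      exact Finset.prod_eq_zero (Finset.mem_univ i) (if_neg hi)
  -- Distributivity: $\prod_i\sum_c$ expands to $\sum_x\prod_i$, where $x$ runs through all choices
  -- of one residue class for each $i$; each inner sum on the left is $1$.
  · have h := Finset.prod_univ_sum (fun _ : Fin D.t => (Finset.univ : Finset (ZMod D.n)))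
      fun i c => D.eigenproj (K i) c
    simp only [sum_eigenproj, Finset.prod_const_one, Fintype.piFinset_univ] at h
    exact h.symm
  · rw [mul_comm, hmul]

-- Products over $i$ are formed in the subalgebra generated by the $K_i$, which is commutative, and
-- the idempotents are then carried to the ambient ring.
open scoped IsMulCommutative in
theorem exists_isWeightSystem {R : Type*} [Ring R] [Algebra k R] {K : Fin D.t → R}
    (hK : ∀ i, K i ^ D.n = 1) (hc : ∀ i j, K i * K j = K j * K i) :
    ∃ e, D.IsWeightSystem K e := by
  have : IsMulCommutative (Algebra.adjoin k (Set.range K)) := Algebra.isMulCommutative_adjoin k (by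
    rintro _ ⟨i, rfl⟩ _ ⟨j, rfl⟩
    exact hc i j)
  obtain ⟨e, he⟩ := D.exists_isWeightSystem_of_comm (A := Algebra.adjoin k (Set.range K))
    (K := fun i => ⟨K i, Algebra.subset_adjoin ⟨i, rfl⟩⟩) fun i => Subtype.ext (hK i)
  refine ⟨fun x => (e x : R), fun x y => ?_, ?_, fun i x => ?_, fun i x => ?_⟩
  · refine (congrArg Subtype.val (he.mul_self x y)).trans ?_
    split_ifs <;> rfl
  · have := congrArg (Algebra.adjoin k (Set.range K)).val he.sum_eq
    rwa [map_sum, map_one] at this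
  · exact congrArg Subtype.val (he.K_mul i x)
  · exact congrArg Subtype.val (he.mul_K i x)

namespace IsWeightSystem

variable {D} {R : Type*} [Ring R] [Algebra k R] {K : Fin D.t → R} {e : D.Vertex → R}

/-- In a coordinate where $x$ and $y$ differ, $q^{x_i}-q^{y_i}$ is a nonzero scalar, because $q$ is
primitive. This separation of weights underlies both uniqueness and the shift rule. -/
theorem eq_zero_of_smul {V : Type*} [AddCommGroup V] [Module k V] {x y : D.Vertex} {v : V}
    (h : ∀ i, D.qpow (x i) • v = D.qpow (y i) • v) (hxy : x ≠ y) : v = 0 := by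
  obtain ⟨i, hi⟩ := Function.ne_iff.1 hxy
  have h1 : (D.qpow (x i) - D.qpow (y i)) • v = 0 := by rw [sub_smul, h, sub_self]
  exact (smul_eq_zero.1 h1).resolve_left (sub_ne_zero.2 fun h => hi (D.qpow_injective h))

protected theorem map {S : Type*} [Ring S] [Algebra k S] (he : D.IsWeightSystem K e)
    (f : R →ₐ[k] S) : D.IsWeightSystem (fun i => f (K i)) fun x => f (e x) where
  mul_self x y := by rw [← map_mul, he.mul_self]; split_ifs <;> simp
  sum_eq := by rw [← map_sum, he.sum_eq, map_one]
  K_mul i x := by rw [← map_mul, he.K_mul, map_smul]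
  mul_K i x := by rw [← map_mul, he.mul_K, map_smul]

/-- Sandwiching $K_i$ in $e_xK_ie'_y$ gives $q^{x_i}e_xe'_y=q^{y_i}e_xe'_y$, so the product vanishes
for $x\ne y$. Summing over either index then gives $e_x=e_xe'_x=e'_x$. -/
theorem unique {e' : D.Vertex → R} (he : D.IsWeightSystem K e) (he' : D.IsWeightSystem K e') :
    e = e' := by
  have h : ∀ x y, x ≠ y → e x * e' y = 0 := fun x y hxy => by
    refine eq_zero_of_smul (x := x) (y := y) (fun i => ?_) hxy
    rw [← smul_mul_assoc, ← he.mul_K, mul_assoc, he'.K_mul, mul_smul_comm]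
  funext x
  calc e x = e x * ∑ y, e' y := by rw [he'.sum_eq, mul_one]
    _ = e x * e' x := by
      rw [Finset.mul_sum]
      exact Finset.sum_eq_single_of_mem x (Finset.mem_univ x) fun y _ hy => h x y hy.symm
    _ = (∑ y, e y) * e' x := by
      rw [Finset.sum_mul]
      exact (Finset.sum_eq_single_of_mem x (Finset.mem_univ x) fun y _ hy => h y x hy).symm
    _ = e' x := by rw [he.sum_eq, one_mul]

/-- An element that `q`-commutes with all `K_i` shifts the weights. -/
theorem mul_shift (he : D.IsWeightSystem K e) {X : R} {c : D.Vertex}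
    (hX : ∀ i, K i * X = D.qpow (c i) • (X * K i)) (x : D.Vertex) :
    e x * X = X * e (x - c) := by
  -- `X` carries weight $y$ to weight $c+y$. Evaluating $e_xK_iXe_y$ on either side gives the
  -- factors $q^{x_i}$ and $q^{c_i+y_i}$, so $e_xXe_y=0$ unless $x=c+y$; inserting $\sum e_y=1$ on
  -- the right and then on the left gives the claim.
  have h : ∀ x y, x ≠ c + y → e x * X * e y = 0 := fun x y hxy => by
    refine eq_zero_of_smul (x := x) (y := c + y) (fun i => ?_) hxy
    change _ = D.qpow (c i + y i) • _
    rw [← smul_mul_assoc, ← smul_mul_assoc, ← he.mul_K, mul_assoc (e x), hX, mul_smul_comm,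
      smul_mul_assoc, mul_assoc, mul_assoc, he.K_mul, mul_smul_comm, mul_smul_comm, smul_smul,
      ← AddChar.map_add_eq_mul, mul_assoc]
  calc e x * X = e x * X * ∑ y, e y := by rw [he.sum_eq, mul_one]
    _ = e x * X * e (x - c) := by
      rw [Finset.mul_sum]
      refine Finset.sum_eq_single_of_mem _ (Finset.mem_univ _) fun y _ hy => h x y ?_
      rintro rfl
      exact hy (by abel)
    _ = (∑ y, e y) * X * e (x - c) := by
      rw [Finset.sum_mul, Finset.sum_mul]
      refine (Finset.sum_eq_single_of_mem _ (Finset.mem_univ _) fun y _ hy => h y _ ?_).symm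
      rintro rfl
      exact hy (by abel)
    _ = X * e (x - c) := by rw [he.sum_eq, one_mul]

theorem K_eq (he : D.IsWeightSystem K e) (i : Fin D.t) :
    K i = ∑ x, D.qpow (x i) • e x := by
  rw [← mul_one (K i), ← he.sum_eq, Finset.mul_sum]
  exact Finset.sum_congr rfl fun x _ => he.K_mul i x

/-- Any left inverse of $K_i$ must act on $e_x$ by $q^{-x_i}$. In the quotient this is applied to an
inverse that comes from the second factor of the double. -/
theorem inv_eq (he : D.IsWeightSystem K e) {i : Fin D.t} {L : R} (hL : L * K i = 1) :
    L = ∑ x, D.qpow (-x i) • e x := by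
  rw [← mul_one L, ← he.sum_eq, Finset.mul_sum]
  refine Finset.sum_congr rfl fun x _ => ?_
  have h : D.qpow (-x i) • (L * (K i * e x)) = D.qpow (-x i) • e x := by
    rw [← mul_assoc, hL, one_mul]
  rwa [he.K_mul, mul_smul_comm, smul_smul, D.qpow_neg_mul, one_smul] at h

end IsWeightSystem

theorem PiRep.isWeightSystem {D : QuantumDatum k} {R : Type*} [Ring R] [Algebra k R]
    (ρ : D.PiRep R) : D.IsWeightSystem ρ.K ρ.e where
  mul_self := ρ.e_mul_e
  sum_eq := ρ.sum_e
  K_mul i x := ρ.K_mul_e x i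
  mul_K i x := ρ.e_mul_K x i

/-! ### Comatrices, antipodes and pairing values on the generators. -/

theorem isComatrix_plusK (i : Fin D.t) :
    IsComatrix (k := k) fun _ _ : Fin 1 => D.plusRep.K i :=
  isComatrix_of_comul_self (D.plusComul_K i) (D.plusCounit_K i)

theorem isComatrix_plusE (i : Fin D.t) :
    IsComatrix (k := k) !![D.plusRep.K i, D.plusRep.X i; 0, 1] :=
  isComatrix_of_comul_skew (D.plusComul_K i) Bialgebra.comul_one
    ((D.plusComul_X i).trans (add_comm _ _)) (D.plusCounit_K i) Bialgebra.counit_one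
    (D.plusCounit_X i)

theorem isComatrix_minusK (i : Fin D.t) :
    IsComatrix (k := k) fun _ _ : Fin 1 => D.minusRep.K i :=
  isComatrix_of_comul_self (D.minusComul_K i) (D.minusCounit_K i)

theorem isComatrix_minusF (i : Fin D.t) :
    IsComatrix (k := k) !![1, D.minusRep.X i; 0, D.minusRep.Kinv i] :=
  isComatrix_of_comul_skew Bialgebra.comul_one (D.minusComul_Kinv i)
    ((D.minusComul_X i).trans (add_comm _ _)) Bialgebra.counit_one (D.minusCounit_Kinv i)
    (D.minusCounit_X i)

theorem antipode_plusK (i : Fin D.t) :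
    HopfAlgebra.antipode k (D.plusRep.K i) = D.plusRep.Kinv i :=
  congrArg MulOpposite.unop (D.plusAntipode_K i)

theorem antipode_minusK (i : Fin D.t) :
    HopfAlgebra.antipode k (D.minusRep.K i) = D.minusRep.Kinv i :=
  congrArg MulOpposite.unop (D.minusAntipode_K i)

theorem antipode_minusF (i : Fin D.t) :
    HopfAlgebra.antipode k (D.minusRep.X i) = -(D.minusRep.X i * D.minusRep.K i) :=
  congrArg MulOpposite.unop (D.minusAntipode_X i)

theorem pairing_one_left (b : D.UMinus) : D.pairing.toLin 1 b = D.minusCounit b :=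
  D.pairingLin_one b

theorem pairing_K_left (i : Fin D.t) (b : D.UMinus) :
    D.pairing.toLin (D.plusRep.K i) b = D.charHom (D.weight i) b := D.pairingLin_K i b

theorem pairing_E_left (i : Fin D.t) (b : D.UMinus) :
    D.pairing.toLin (D.plusRep.X i) b = D.skewDual i b := D.pairingLin_X i b

theorem pairing_E_one (i : Fin D.t) : D.pairing.toLin (D.plusRep.X i) 1 = 0 :=
  (D.pairing.one_right _).trans (D.plusCounit_X i)

/-- $\varphi(E_i,-)$ is a skew derivation with respect to the character $\varphi(K_i,-)$ and the
counit. Applied to $K_jK_j^{-1}=1$ it gives $0=\varphi(K_i,K_j)\,\varphi(E_i,K_j^{-1})$, and the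
first factor is a unit. -/
theorem pairing_E_Kinv (i j : Fin D.t) :
    D.pairing.toLin (D.plusRep.X i) (D.minusRep.Kinv j) = 0 := by
  have h := D.skewDual_mul i (D.minusRep.K j) (D.minusRep.Kinv j)
  rw [BorelRep.K_mul_Kinv, ← pairing_E_left, ← pairing_E_left, ← pairing_E_left, pairing_E_one,
    pairing_E_K, zero_mul, add_zero, charHom_K] at h
  exact (mul_eq_zero.1 h.symm).resolve_left fun h0 => by
    have := D.qpow_mul_neg (D.weight i j)
    rw [h0, zero_mul] at this
    exact zero_ne_one this

/-- The element $F_jK_j$ enters through $S(F_j)=-F_jK_j$. By the skew derivation rule the factor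
$K_j$ contributes only its counit. -/
theorem pairing_E_FK (i j : Fin D.t) :
    D.pairing.toLin (D.plusRep.X i) (D.minusRep.X j * D.minusRep.K j) =
      if i = j then -(D.q - D.q⁻¹)⁻¹ else 0 := by
  rw [← pairing_E_F, pairing_E_left, pairing_E_left, skewDual_mul, charHom_X, minusCounit_K]
  simp

/-! ### Commutation relations between the two factors of the double. -/

/-- The inclusion of `𝔲_q^+` into the double. -/
abbrev dblFst : D.UPlus →ₐ[k] D.Double := DrinfeldDouble.fst D.pairing

/-- The inclusion of `𝔲_q^-` into the double. -/
abbrev dblSnd : D.UMinus →ₐ[k] D.Double := DrinfeldDouble.snd D.pairing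

theorem pairing_K_Kinv (i j : Fin D.t) :
    D.pairing.toLin (D.plusRep.K i) (D.minusRep.Kinv j) = D.qpow (D.C i j : ZMod D.n) := by
  rw [pairing_K_left, charHom_Kinv, weight, neg_neg]

theorem pairing_K_FK (i j : Fin D.t) :
    D.pairing.toLin (D.plusRep.K i) (D.minusRep.X j * D.minusRep.K j) = 0 := by
  rw [pairing_K_left, map_mul, charHom_X, zero_mul]

/-- A group-like element is a common eigenvector of both actions of $\mathfrak u_q^-$ on $\mathfrak
u_q^+$. -/
theorem hitLeft_K (i : Fin D.t) (b : D.UMinus) : D.pairing.hitLeft b (D.plusRep.K i) =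
    D.pairing.toLin (D.plusRep.K i) (HopfAlgebra.antipode k b) • D.plusRep.K i := by
  simpa using D.pairing.hitLeft_comatrix (D.isComatrix_plusK i) b 0 0

theorem hitRight_K (i : Fin D.t) (b : D.UMinus) : D.pairing.hitRight b (D.plusRep.K i) =
    D.pairing.toLin (D.plusRep.K i) b • D.plusRep.K i := by
  simpa using D.pairing.hitRight_comatrix (D.isComatrix_plusK i) b 0 0

theorem hitLeft_E (i : Fin D.t) (b : D.UMinus) : D.pairing.hitLeft b (D.plusRep.X i) =
    D.pairing.toLin (D.plusRep.K i) (HopfAlgebra.antipode k b) • D.plusRep.X i +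
      D.pairing.toLin (D.plusRep.X i) (HopfAlgebra.antipode k b) • 1 := by
  simpa [Fin.sum_univ_two] using D.pairing.hitLeft_comatrix (D.isComatrix_plusE i) b 0 1

theorem hitRight_E (i : Fin D.t) (b : D.UMinus) : D.pairing.hitRight b (D.plusRep.X i) =
    D.pairing.toLin (D.plusRep.X i) b • D.plusRep.K i + D.minusCounit b • D.plusRep.X i := by
  rw [← pairing_one_left]
  simpa [Fin.sum_univ_two] using D.pairing.hitRight_comatrix (D.isComatrix_plusE i) b 0 1

theorem dblSnd_K_mul (j : Fin D.t) (a : D.UPlus) :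
    D.dblSnd (D.minusRep.K j) * D.dblFst a =
      D.dblFst (D.pairing.hitLeft (D.minusRep.K j) (D.pairing.hitRight (D.minusRep.K j) a)) *
        D.dblSnd (D.minusRep.K j) := by
  rw [DrinfeldDouble.fst_mul_snd]
  simpa using DrinfeldDouble.snd_mul_fst D.pairing (D.isComatrix_minusK j) 0 0 a

/-- This is the entry $(0,1)$ of the comatrix with rows $(1,F_j)$ and $(0,K_j^{-1})$ in
`DrinfeldDouble.snd_mul_fst`. Of the four terms, the one that contains the lower left entry
vanishes. -/
theorem dblSnd_F_mul (j : Fin D.t) (a : D.UPlus) :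
    D.dblSnd (D.minusRep.X j) * D.dblFst a =
      D.dblFst (D.pairing.hitRight (D.minusRep.X j) a) +
      D.dblFst (D.pairing.hitRight (D.minusRep.Kinv j) a) * D.dblSnd (D.minusRep.X j) +
      D.dblFst (D.pairing.hitLeft (D.minusRep.X j) (D.pairing.hitRight (D.minusRep.Kinv j) a)) *
        D.dblSnd (D.minusRep.Kinv j) := by
  have h := DrinfeldDouble.snd_mul_fst D.pairing (D.isComatrix_minusF j) 0 1 a
  simp only [Fin.sum_univ_two, ← DrinfeldDouble.fst_mul_snd] at h
  simpa [← add_assoc] using h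

/-- The two actions of $K_j$ scale $K_i$ by inverse factors $q^{a_{ij}}$ and $q^{-a_{ij}}$. -/
theorem dblSnd_K_mul_K (i j : Fin D.t) :
    D.dblSnd (D.minusRep.K j) * D.dblFst (D.plusRep.K i) =
      D.dblFst (D.plusRep.K i) * D.dblSnd (D.minusRep.K j) := by
  rw [dblSnd_K_mul, hitRight_K, map_smul, hitLeft_K, antipode_minusK, pairing_K_Kinv,
    pairing_K_left, charHom_K, weight, smul_smul, D.qpow_neg_mul, one_smul]

/-- The right action fixes $E_i$ and the left action contributes $\varphi(K_i,K_j^{-1})=q^{a_{ij}}$.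
Symmetry of the Cartan matrix turns this into $q^{a_{ji}}$, so the $K_j$ of the second factor acts
on $E_i$ as the $K_j$ of the first does. -/
theorem dblSnd_K_mul_E (i j : Fin D.t) :
    D.dblSnd (D.minusRep.K j) * D.dblFst (D.plusRep.X i) =
      D.qpow (D.C j i : ZMod D.n) • (D.dblFst (D.plusRep.X i) * D.dblSnd (D.minusRep.K j)) := by
  rw [dblSnd_K_mul, hitRight_E, pairing_E_K, minusCounit_K, zero_smul, zero_add, one_smul,
    hitLeft_E, antipode_minusK, pairing_K_Kinv, pairing_E_Kinv, zero_smul, add_zero, map_smul,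
    smul_mul_assoc, D.symm.apply]

/-- The outer terms of `dblSnd_F_mul` vanish since $\varphi(K_i,-)$ is a character that kills $F_j$;
the middle one contributes $\varphi(K_i,K_j^{-1})$. -/
theorem dblSnd_F_mul_K (i j : Fin D.t) :
    D.dblSnd (D.minusRep.X j) * D.dblFst (D.plusRep.K i) =
      D.qpow (D.C i j : ZMod D.n) • (D.dblFst (D.plusRep.K i) * D.dblSnd (D.minusRep.X j)) := by
  rw [dblSnd_F_mul, hitRight_K, hitRight_K, pairing_K_F, pairing_K_Kinv, map_smul,
    map_smul (D.pairing.hitLeft _), hitLeft_K, antipode_minusF, map_neg, pairing_K_FK]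
  simp

/-- The outer terms of `dblSnd_F_mul` give $\varphi(E_i,F_j)\,K_i\otimes1$ and, through
$S(F_j)=-F_jK_j$, $-\varphi(E_i,F_j)\,1\otimes K_j^{-1}$. Hence the two group-likes lie in different
factors and occur with opposite signs. -/
theorem dblSnd_F_mul_E (i j : Fin D.t) :
    D.dblSnd (D.minusRep.X j) * D.dblFst (D.plusRep.X i) =
      D.dblFst (D.plusRep.X i) * D.dblSnd (D.minusRep.X j) -
        if i = j then (D.q - D.q⁻¹)⁻¹ •
          (D.dblFst (D.plusRep.K i) - D.dblSnd (D.minusRep.Kinv j)) else 0 := by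
  rw [dblSnd_F_mul, hitRight_E, hitRight_E, pairing_E_Kinv, minusCounit_X, minusCounit_Kinv,
    pairing_E_F, zero_smul, zero_smul, zero_add, add_zero, one_smul, hitLeft_E, antipode_minusF, map_neg,
    map_neg, pairing_K_FK, pairing_E_FK]
  split_ifs with h
  · simp only [neg_zero, zero_smul, zero_add, neg_neg, map_smul, map_one, smul_mul_assoc, one_mul,
      smul_sub, neg_smul, map_neg]
    abel
  · simp

/-! ### Reduction of the commutation relations to generators. -/

section Lift

variable {R : Type*} [Ring R] [Algebra k R]

/-- A predicate on `𝔲_q^+` holds if it is linear and stable under left multiplication by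
generators. -/
theorem plus_left_induction {P : D.UPlus → Prop} (h1 : P 1) (hadd : ∀ x y, P x → P y → P (x + y))
    (hsmul : ∀ (r : k) x, P x → P (r • x)) (hK : ∀ i x, P x → P (D.plusRep.K i * x))
    (hX : ∀ i x, P x → P (D.plusRep.X i * x)) (a : D.UPlus) : P a := by
  have h : ∀ x, P x → P (a * x) := by
    induction a using plus_induction with
    | hK i => exact hK i
    | hX i => exact hX i
    | h1 r => exact fun x hx => by rw [← Algebra.smul_def]; exact hsmul r x hx
    | hadd a b ha hb => exact fun x hx => by rw [add_mul]; exact hadd _ _ (ha x hx) (hb x hx)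
    | hmul a b ha hb => exact fun x hx => by rw [mul_assoc]; exact ha _ (hb x hx)
  simpa using h 1 h1

variable {f : D.UPlus →ₐ[k] R} {g : D.UMinus →ₐ[k] R}

/-- The elements $b$ to be treated form a subalgebra, so generators of $\mathfrak u_q^-$ suffice.
For each of them the first factor is handled by peeling generators off `a` from the left: the
relation in the double moves `b` past a generator, `mulMap_fst_mul` extracts the latter, and the
assumed relation in `R` moves it back. -/
theorem commSubalgebra_eq_top
    (hKK : ∀ i j, g (D.minusRep.K j) * f (D.plusRep.K i) = f (D.plusRep.K i) * g (D.minusRep.K j))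
    (hKE : ∀ i j, g (D.minusRep.K j) * f (D.plusRep.X i) =
      D.qpow (D.C j i : ZMod D.n) • (f (D.plusRep.X i) * g (D.minusRep.K j)))
    (hFK : ∀ i j, g (D.minusRep.X j) * f (D.plusRep.K i) =
      D.qpow (D.C i j : ZMod D.n) • (f (D.plusRep.K i) * g (D.minusRep.X j)))
    (hFE : ∀ i j, g (D.minusRep.X j) * f (D.plusRep.X i) =
      f (D.plusRep.X i) * g (D.minusRep.X j) -
        if i = j then (D.q - D.q⁻¹)⁻¹ • (f (D.plusRep.K i) - g (D.minusRep.Kinv j)) else 0) :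
    DrinfeldDouble.commSubalgebra D.pairing f g = ⊤ := by
  have hf := DrinfeldDouble.mulMap_fst_mul (φ := D.pairing) f g
  have hfst : ∀ a, DrinfeldDouble.mulMap D.pairing f g (D.dblFst a) = f a := fun a =>
    (DrinfeldDouble.mulMap_tmul f g a 1).trans (by rw [map_one, mul_one])
  have hsnd : ∀ b, DrinfeldDouble.mulMap D.pairing f g (D.dblSnd b) = g b := fun b =>
    (DrinfeldDouble.mulMap_tmul f g 1 b).trans (by rw [map_one, one_mul])
  have hK : ∀ j, D.minusRep.K j ∈ DrinfeldDouble.commSubalgebra D.pairing f g := by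
    refine fun j => DrinfeldDouble.mem_commSubalgebra_of_fst fun a => ?_
    induction a using plus_left_induction with
    | h1 => rw [map_one, map_one, mul_one, mul_one, hsnd]
    | hadd x y hx hy => simp only [map_add, mul_add, hx, hy]
    | hsmul r x hx => simp only [map_smul, mul_smul_comm, hx]
    | hK i x hx =>
      rw [map_mul (DrinfeldDouble.fst D.pairing), ← mul_assoc, dblSnd_K_mul_K, mul_assoc, hf, hx,
        map_mul f, ← mul_assoc, ← mul_assoc, hKK]
    | hX i x hx =>
      rw [map_mul (DrinfeldDouble.fst D.pairing), ← mul_assoc, dblSnd_K_mul_E, smul_mul_assoc,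
        mul_assoc, map_smul, hf, hx, map_mul f, ← mul_assoc, ← mul_assoc, hKE, smul_mul_assoc]
  -- Needed before the case of $F_j$: moving $F_j$ past $E_j$ leaves $1\otimes K_j^{-1}$ in front of
  -- the remaining element of $\mathfrak u_q^+$. Here $K_j^{-1}$ is by definition a power of $K_j$.
  have hKinv : ∀ j, D.minusRep.Kinv j ∈ DrinfeldDouble.commSubalgebra D.pairing f g :=
    fun j => pow_mem (hK j) _
  have hX : ∀ j, D.minusRep.X j ∈ DrinfeldDouble.commSubalgebra D.pairing f g := by
    refine fun j => DrinfeldDouble.mem_commSubalgebra_of_fst fun a => ?_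
    induction a using plus_left_induction with
    | h1 => rw [map_one, map_one, mul_one, mul_one, hsnd]
    | hadd x y hx hy => simp only [map_add, mul_add, hx, hy]
    | hsmul r x hx => simp only [map_smul, mul_smul_comm, hx]
    | hK i x hx =>
      rw [map_mul (DrinfeldDouble.fst D.pairing), ← mul_assoc, dblSnd_F_mul_K, smul_mul_assoc,
        mul_assoc, map_smul, hf, hx, map_mul f, ← mul_assoc, ← mul_assoc, hFK, smul_mul_assoc]
    | hX i x hx =>
      rw [map_mul (DrinfeldDouble.fst D.pairing), ← mul_assoc, dblSnd_F_mul_E, sub_mul, mul_assoc,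
        map_sub, hf, hx, map_mul f, ← mul_assoc, ← mul_assoc, hFE, sub_mul]
      congr 1
      split_ifs
      · rw [smul_mul_assoc, map_smul, sub_mul, map_sub, hf, hKinv, hfst, smul_mul_assoc, sub_mul]
      · simp
  rw [eq_top_iff, ← D.adjoin_minusGen]
  refine Algebra.adjoin_le ?_
  rintro _ (⟨j, rfl⟩ | ⟨j, rfl⟩)
  exacts [hK j, hX j]

end Lift

/-! ### The ideal $I$ is a Hopf ideal. -/

theorem doubleIdeal_le {R : Type*} [Ring R] [Algebra k R] (f : D.Double →ₐ[k] R)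
    (h : ∀ i, f (D.dblFst (D.plusRep.K i)) = f (D.dblSnd (D.minusRep.K i))) {x : D.Double}
    (hx : x ∈ D.doubleIdeal) : f x = 0 := by
  have hle : TwoSidedIdeal.span (Set.range fun i : Fin D.t =>
      DrinfeldDouble.tmul D.pairing (D.plusRep.K i) 1 -
        DrinfeldDouble.tmul D.pairing 1 (D.minusRep.K i)) ≤ TwoSidedIdeal.ker f := by
    refine TwoSidedIdeal.span_le.2 ?_
    rintro _ ⟨i, rfl⟩
    refine (TwoSidedIdeal.mem_ker f).2 ?_
    rw [map_sub, sub_eq_zero]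
    exact h i
  exact (TwoSidedIdeal.mem_ker f).1 (hle (TwoSidedIdeal.mem_asIdeal.1 hx))

/-- The quotient map. -/
abbrev dblMk : D.Double →ₐ[k] D.Double ⧸ D.doubleIdeal := Ideal.Quotient.mkₐ k D.doubleIdeal

/-- The only property of $I$ used to build the inverse map: in the quotient the two copies of $K_i$
agree. -/
theorem dblMk_K (i : Fin D.t) :
    D.dblMk (D.dblFst (D.plusRep.K i)) = D.dblMk (D.dblSnd (D.minusRep.K i)) := by
  refine Ideal.Quotient.eq.2 (TwoSidedIdeal.mem_asIdeal.2 (TwoSidedIdeal.subset_span ?_))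
  exact ⟨i, rfl⟩

theorem comul_dblFst_K (i : Fin D.t) : comul (R := k) (D.dblFst (D.plusRep.K i)) =
    D.dblFst (D.plusRep.K i) ⊗ₜ[k] D.dblFst (D.plusRep.K i) := by
  simpa using DrinfeldDouble.comul_fst D.pairing (D.isComatrix_plusK i) 0 0

theorem comul_dblFst_E (i : Fin D.t) : comul (R := k) (D.dblFst (D.plusRep.X i)) =
    D.dblFst (D.plusRep.K i) ⊗ₜ[k] D.dblFst (D.plusRep.X i) +
      D.dblFst (D.plusRep.X i) ⊗ₜ[k] 1 := by
  simpa [Fin.sum_univ_two] using DrinfeldDouble.comul_fst D.pairing (D.isComatrix_plusE i) 0 1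

theorem comul_dblSnd_K (i : Fin D.t) : comul (R := k) (D.dblSnd (D.minusRep.K i)) =
    D.dblSnd (D.minusRep.K i) ⊗ₜ[k] D.dblSnd (D.minusRep.K i) := by
  simpa using DrinfeldDouble.comul_snd D.pairing (D.isComatrix_minusK i) 0 0

theorem comul_dblSnd_F (i : Fin D.t) : comul (R := k) (D.dblSnd (D.minusRep.X i)) =
    1 ⊗ₜ[k] D.dblSnd (D.minusRep.X i) +
      D.dblSnd (D.minusRep.X i) ⊗ₜ[k] D.dblSnd (D.minusRep.Kinv i) := by
  simpa [Fin.sum_univ_two] using DrinfeldDouble.comul_snd D.pairing (D.isComatrix_minusF i) 0 1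

theorem counit_dblFst (a : D.UPlus) : counit (R := k) (D.dblFst a) = D.plusCounit a := by
  refine (DrinfeldDouble.counit_tmul D.pairing a 1).trans ?_
  rw [Bialgebra.counit_one, mul_one]
  rfl

theorem counit_dblSnd (b : D.UMinus) : counit (R := k) (D.dblSnd b) = D.minusCounit b := by
  refine (DrinfeldDouble.counit_tmul D.pairing 1 b).trans ?_
  rw [Bialgebra.counit_one, one_mul]
  rfl

/-- The ideal `I` is a Hopf ideal. -/
instance isHopfIdeal_doubleIdeal : D.doubleIdeal.IsHopfIdeal k where
  counit_eq_zero x hx := D.doubleIdeal_le (Bialgebra.counitAlgHom k D.Double) (fun i => by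
    rw [Bialgebra.counitAlgHom_apply, Bialgebra.counitAlgHom_apply, counit_dblFst, counit_dblSnd,
      plusCounit_K, minusCounit_K]) hx
  -- The coideal condition is stated as the vanishing on $I$ of the comultiplication followed by the
  -- quotient map in both tensor factors. This composite is an algebra map, and both copies of $K_i$
  -- are group-like, so it agrees on them.
  map_mkQ_comul_eq_zero x hx := D.doubleIdeal_le
    ((Algebra.TensorProduct.map D.dblMk D.dblMk).comp (Bialgebra.comulAlgHom k D.Double))
    (fun i => by
      simp only [AlgHom.comp_apply, Bialgebra.comulAlgHom_apply, comul_dblFst_K, comul_dblSnd_K,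
        Algebra.TensorProduct.map_tmul, dblMk_K]) hx
  antipode_mem x hx := by
    -- The antipode reverses products, so the target is the opposite algebra of the quotient. It
    -- sends each copy of $K_i$ to its $(n-1)$-st power, and these have the same class.
    have h := D.doubleIdeal_le (D.dblMk.op.comp (HopfAlgebra.antipodeAlgHomOp k D.Double))
      (fun i => by
        refine congrArg MulOpposite.op ?_
        change D.dblMk (HopfAlgebra.antipode k _) = D.dblMk (HopfAlgebra.antipode k _)
        rw [DrinfeldDouble.antipode_fst, DrinfeldDouble.antipode_snd, antipode_plusK,
          antipode_minusK, BorelRep.Kinv, BorelRep.Kinv]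
        simp only [map_pow, dblMk_K]) hx
    exact Ideal.Quotient.eq_zero_iff_mem.1 (MulOpposite.op_injective h)

/-! ### The map from the double to $\Pi^{\mathcal C}$. -/

theorem PiRep.K_pow {D : QuantumDatum k} {R : Type*} [Ring R] [Algebra k R] (ρ : D.PiRep R)
    (i : Fin D.t) : ρ.K i ^ D.n = 1 := by
  refine ρ.ext_left fun x => ?_
  have h : ∀ m : ℕ, ρ.e x * ρ.K i ^ m = D.qpow (x i) ^ m • ρ.e x := by
    intro m
    induction m with
    | zero => simp
    | succ m ih => rw [pow_succ, ← mul_assoc, ih, smul_mul_assoc, e_mul_K, smul_smul, pow_succ]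
  rw [h, ← AddChar.map_nsmul_eq_pow]
  simp

theorem PiRep.K_comm {D : QuantumDatum k} {R : Type*} [Ring R] [Algebra k R] (ρ : D.PiRep R)
    (i j : Fin D.t) : ρ.K i * ρ.K j = ρ.K j * ρ.K i := by
  refine ρ.ext_left fun x => ?_
  rw [← mul_assoc, ← mul_assoc, e_mul_K, e_mul_K, smul_mul_assoc, smul_mul_assoc, e_mul_K,
    e_mul_K, smul_comm]

/-- `K_i` and `∑ a(x, i)` satisfy the relations of `𝔲_q^+`. -/
def piPlusRep : D.BorelRep 1 D.PiAlgebra where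
  K := D.piRep.K
  X := D.piRep.E
  K_pow := D.piRep.K_pow
  K_comm := D.piRep.K_comm
  K_mul_X i j := by rw [PiRep.K_mul_E, one_mul, ← qpow_intCast]

/-- `K_i` and `∑ a(x, i)^*` satisfy the relations of `𝔲_q^-`. -/
def piMinusRep : D.BorelRep (-1) D.PiAlgebra where
  K := D.piRep.K
  X := D.piRep.F
  K_pow := D.piRep.K_pow
  K_comm := D.piRep.K_comm
  K_mul_X i j := by rw [PiRep.K_mul_F, neg_one_mul, ← qpow_intCast, Int.cast_neg]

/-- The map `𝔲_q^+ → Π`. -/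
def plusToPi : D.UPlus →ₐ[k] D.PiAlgebra := D.plusLift D.piPlusRep

/-- The map `𝔲_q^- → Π`. -/
def minusToPi : D.UMinus →ₐ[k] D.PiAlgebra := D.minusLift D.piMinusRep

theorem plusToPi_K (i : Fin D.t) : D.plusToPi (D.plusRep.K i) = D.piRep.K i := D.plusLift_K _ i

theorem plusToPi_E (i : Fin D.t) : D.plusToPi (D.plusRep.X i) = D.piRep.E i := D.plusLift_X _ i

theorem minusToPi_K (i : Fin D.t) : D.minusToPi (D.minusRep.K i) = D.piRep.K i :=
  D.minusLift_K _ i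

theorem minusToPi_F (i : Fin D.t) : D.minusToPi (D.minusRep.X i) = D.piRep.F i :=
  D.minusLift_X _ i

/-- In $\mathfrak u_q^-$ the inverse is the power $K_i^{n-1}$, in $\Pi^{\mathcal C}$ the sum $\sum_x
q^{-x_i}e_x$. They correspond because both are inverses of $K_i$. -/
theorem minusToPi_Kinv (i : Fin D.t) : D.minusToPi (D.minusRep.Kinv i) = D.piRep.Kinv i := by
  refine left_inv_eq_right_inv (a := D.piRep.K i) ?_ (D.piRep.K_mul_Kinv i)
  rw [← minusToPi_K, ← map_mul, BorelRep.Kinv_mul_K, map_one]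

/-- The map `𝒟(𝔲_q) → Π`. -/
def doubleToPi : D.Double →ₐ[k] D.PiAlgebra :=
  DrinfeldDouble.lift D.plusToPi D.minusToPi <| D.commSubalgebra_eq_top
    (fun i j => by rw [minusToPi_K, plusToPi_K, PiRep.K_comm])
    (fun i j => by rw [minusToPi_K, plusToPi_E, PiRep.K_mul_E])
    (fun i j => by
      rw [minusToPi_F, plusToPi_K, PiRep.K_mul_F, smul_smul, D.qpow_mul_neg, one_smul])
    (fun i j => by
      rw [minusToPi_F, plusToPi_E, plusToPi_K, minusToPi_Kinv, eq_sub_iff_add_eq, add_comm,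
        ← eq_sub_iff_add_eq]
      split_ifs with h
      · subst h
        rw [PiRep.comm_eq]
      · rw [D.piRep.comm_ne i j h, sub_self])

theorem doubleToPi_fst (a : D.UPlus) : D.doubleToPi (D.dblFst a) = D.plusToPi a :=
  DrinfeldDouble.lift_fst _ _ _ a

theorem doubleToPi_snd (b : D.UMinus) : D.doubleToPi (D.dblSnd b) = D.minusToPi b :=
  DrinfeldDouble.lift_snd _ _ _ b

/-- The map `𝒟(𝔲_q) / I → Π`. -/
def quotToPi : D.Double ⧸ D.doubleIdeal →ₐ[k] D.PiAlgebra :=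
  Ideal.Quotient.liftₐ D.doubleIdeal D.doubleToPi fun _ hx => D.doubleIdeal_le D.doubleToPi
    (fun i => by rw [doubleToPi_fst, doubleToPi_snd, plusToPi_K, minusToPi_K]) hx

theorem quotToPi_mk (x : D.Double) : D.quotToPi (D.dblMk x) = D.doubleToPi x := rfl

/-- Algebra maps out of `𝒟(𝔲_q) / I` agree if they agree on `K_i`, `E_i`, `F_i`. -/
theorem quot_algHom_ext {R : Type*} [Ring R] [Algebra k R]
    {f g : D.Double ⧸ D.doubleIdeal →ₐ[k] R}
    (hK : ∀ i, f (D.dblMk (D.dblFst (D.plusRep.K i))) = g (D.dblMk (D.dblFst (D.plusRep.K i))))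
    (hE : ∀ i, f (D.dblMk (D.dblFst (D.plusRep.X i))) = g (D.dblMk (D.dblFst (D.plusRep.X i))))
    (hF : ∀ i, f (D.dblMk (D.dblSnd (D.minusRep.X i))) =
      g (D.dblMk (D.dblSnd (D.minusRep.X i)))) : f = g := by
  refine Ideal.Quotient.algHom_ext k (DrinfeldDouble.algHom_ext
    (D.plus_algHom_ext hK hE) (D.minus_algHom_ext (fun i => ?_) hF))
  -- The second copy of $K_i$ needs no separate hypothesis, since it equals the first modulo $I$.
  change f (D.dblMk (D.dblSnd _)) = g (D.dblMk (D.dblSnd _))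
  rw [← dblMk_K, hK]

/-! ### The relations of $\Pi^{\mathcal C}$ in the quotient of the double. -/

theorem exists_quot_isWeightSystem : ∃ e, D.IsWeightSystem
    (fun i => D.dblMk (D.dblFst (D.plusRep.K i))) e :=
  D.exists_isWeightSystem
    (fun i => by rw [← map_pow, ← map_pow, BorelRep.K_pow, map_one, map_one])
    (fun i j => by simp only [← map_mul, BorelRep.K_comm])

/-- The weight idempotents of `𝒟(𝔲_q) / I`. -/
def quotE : D.Vertex → D.Double ⧸ D.doubleIdeal := D.exists_quot_isWeightSystem.choose

theorem quotE_spec : D.IsWeightSystem (fun i => D.dblMk (D.dblFst (D.plusRep.K i))) D.quotE :=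
  D.exists_quot_isWeightSystem.choose_spec

theorem quotE_shift_E (x : D.Vertex) (i : Fin D.t) :
    D.quotE x * D.dblMk (D.dblFst (D.plusRep.X i)) =
      D.dblMk (D.dblFst (D.plusRep.X i)) * D.quotE (x - D.col i) := by
  refine D.quotE_spec.mul_shift (fun j => ?_) x
  rw [← map_mul, ← map_mul, BorelRep.K_mul_X, one_mul, ← qpow_intCast]
  simp only [map_smul, map_mul]
  rfl

theorem quotE_shift_F (x : D.Vertex) (i : Fin D.t) :
    D.quotE x * D.dblMk (D.dblSnd (D.minusRep.X i)) =
      D.dblMk (D.dblSnd (D.minusRep.X i)) * D.quotE (x + D.col i) := by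
  -- $F_i$ lowers weights by $c^i$. Its known commutation is with the $K_j$ of the second factor,
  -- while the weights are defined by the first; `dblMk_K` connects the two.
  rw [D.quotE_spec.mul_shift (c := -D.col i) (fun j => ?_) x, sub_neg_eq_add]
  rw [dblMk_K, ← map_mul, ← map_mul, BorelRep.K_mul_X, neg_one_mul, ← qpow_intCast,
    Int.cast_neg]
  simp only [map_smul, map_mul]
  rfl

/-- Modulo $I$ the group-likes $K_i\otimes1$ and $1\otimes K_i^{-1}$ become inverse to each other,
so they are diagonal with eigenvalues $q^{x_i}$ and $q^{-x_i}$. Their difference divided by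
$q-q^{-1}$ has the eigenvalues of the preprojective relation. -/
theorem quot_commutator (i j : Fin D.t) :
    D.dblMk (D.dblFst (D.plusRep.X i)) * D.dblMk (D.dblSnd (D.minusRep.X j)) -
      D.dblMk (D.dblSnd (D.minusRep.X j)) * D.dblMk (D.dblFst (D.plusRep.X i)) =
    if i = j then ∑ x, D.qnum (x i) • D.quotE x else 0 := by
  rw [← map_mul, ← map_mul, dblSnd_F_mul_E, ← map_sub, sub_sub_cancel]
  split_ifs with h
  · subst h
    have hL : D.dblMk (D.dblSnd (D.minusRep.Kinv i)) * D.dblMk (D.dblFst (D.plusRep.K i)) = 1 := by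
      rw [dblMk_K, ← map_mul, ← map_mul, BorelRep.Kinv_mul_K, map_one, map_one]
    rw [map_smul, map_sub, D.quotE_spec.inv_eq (i := i) hL, D.quotE_spec.K_eq i,
      ← Finset.sum_sub_distrib, Finset.smul_sum]
    refine Finset.sum_congr rfl fun x _ => ?_
    rw [← sub_smul, smul_smul, qnum, div_eq_inv_mul]
  · rw [map_zero]

/-- The relations of `Π` in `𝒟(𝔲_q) / I`. -/
def quotRep : D.PiRep (D.Double ⧸ D.doubleIdeal) where
  e := D.quotE
  E i := D.dblMk (D.dblFst (D.plusRep.X i))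
  F i := D.dblMk (D.dblSnd (D.minusRep.X i))
  e_mul_e := D.quotE_spec.mul_self
  sum_e := D.quotE_spec.sum_eq
  e_mul_E := D.quotE_shift_E
  F_mul_e x i := by rw [quotE_shift_F, sub_add_cancel]
  comm i := by rw [quot_commutator, if_pos rfl]
  comm_ne i j h := by rw [← sub_eq_zero, quot_commutator, if_neg h]

/-- The idempotents of the quotient were chosen without a formula. Their images diagonalize the
$K_i$ of $\Pi^{\mathcal C}$ with the same eigenvalues as the $e_x$, and a weight system is unique.
-/
theorem quotToPi_quotE (x : D.Vertex) : D.quotToPi (D.quotE x) = D.e x := by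
  have h := D.quotE_spec.map D.quotToPi
  simp only [quotToPi_mk, doubleToPi_fst, plusToPi_K] at h
  exact congrFun (h.unique D.piRep.isWeightSystem) x

theorem quotToPi_K (i : Fin D.t) :
    D.quotToPi (D.dblMk (D.dblFst (D.plusRep.K i))) = D.piRep.K i :=
  (D.doubleToPi_fst _).trans (D.plusToPi_K i)

theorem quotToPi_E (i : Fin D.t) :
    D.quotToPi (D.dblMk (D.dblFst (D.plusRep.X i))) = D.piRep.E i :=
  (D.doubleToPi_fst _).trans (D.plusToPi_E i)

theorem quotToPi_F (i : Fin D.t) :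
    D.quotToPi (D.dblMk (D.dblSnd (D.minusRep.X i))) = D.piRep.F i :=
  (D.doubleToPi_snd _).trans (D.minusToPi_F i)

/-! ### The isomorphism and its compatibility with the coalgebra structures. -/

/-- The algebra isomorphism `𝒟(𝔲_q) / I ≃ Π`. -/
def quotEquiv : (D.Double ⧸ D.doubleIdeal) ≃ₐ[k] D.PiAlgebra :=
  AlgEquiv.ofAlgHom D.quotToPi D.quotRep.lift
    (D.pi_algHom_ext
      (fun x => (congrArg D.quotToPi (D.quotRep.lift_e x)).trans (D.quotToPi_quotE x))
      (fun i => (congrArg D.quotToPi (D.quotRep.lift_E i)).trans (D.quotToPi_E i))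
      (fun i => (congrArg D.quotToPi (D.quotRep.lift_F i)).trans (D.quotToPi_F i)))
    (D.quot_algHom_ext
      -- $K_i$ is not among the elements that define a `PiRep`, so it is first expanded as $\sum_x
      -- q^{x_i}e_x$; the image is the spectral decomposition of $K_i$ in the quotient.
      (fun i => by
        refine (congrArg D.quotRep.lift (D.quotToPi_K i)).trans ?_
        change D.quotRep.lift (∑ x, D.qpow (x i) • D.e x) = _
        simp only [map_sum, map_smul, PiRep.lift_e]
        exact (D.quotE_spec.K_eq i).symm)
      (fun i => (congrArg D.quotRep.lift (D.quotToPi_E i)).trans (D.quotRep.lift_E i))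
      (fun i => (congrArg D.quotRep.lift (D.quotToPi_F i)).trans (D.quotRep.lift_F i)))

theorem quotToPi_counit :
    (Bialgebra.counitAlgHom k D.PiAlgebra).comp D.quotToPi =
      Bialgebra.counitAlgHom k (D.Double ⧸ D.doubleIdeal) := by
  refine D.quot_algHom_ext (fun i => ?_) (fun i => ?_) (fun i => ?_)
  · refine (congrArg D.piCounit (D.quotToPi_K i)).trans ((D.piCounit_K i).trans ?_)
    exact ((D.counit_dblFst _).trans (D.plusCounit_K i)).symm
  · refine (congrArg D.piCounit (D.quotToPi_E i)).trans ((D.piCounit_E i).trans ?_)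
    exact ((D.counit_dblFst _).trans (D.plusCounit_X i)).symm
  · refine (congrArg D.piCounit (D.quotToPi_F i)).trans ((D.piCounit_F i).trans ?_)
    exact ((D.counit_dblSnd _).trans (D.minusCounit_X i)).symm

theorem comul_dblMk (x : D.Double) : comul (R := k) (D.dblMk x) =
    Algebra.TensorProduct.map D.dblMk D.dblMk (comul (R := k) x) := rfl

/-- Both sides are algebra maps, so only $K_i$, $E_i$, $F_i$ matter, where the coproducts have the
same form on both sides. For $F_i$ the factor $K_i^{-1}$ must be matched as well, by
`minusToPi_Kinv`. -/
theorem quotToPi_comul :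
    (Algebra.TensorProduct.map D.quotToPi D.quotToPi).comp
      (Bialgebra.comulAlgHom k (D.Double ⧸ D.doubleIdeal)) =
      (Bialgebra.comulAlgHom k D.PiAlgebra).comp D.quotToPi := by
  refine D.quot_algHom_ext (fun i => ?_) (fun i => ?_) (fun i => ?_) <;>
    simp only [AlgHom.comp_apply, Bialgebra.comulAlgHom_apply, comul_dblMk, comul_eq_piComul]
  · rw [quotToPi_K, piComul_K, comul_dblFst_K]
    simp only [Algebra.TensorProduct.map_tmul, quotToPi_K]
  · rw [quotToPi_E, piComul_E, comul_dblFst_E, add_comm]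
    simp only [map_add, Algebra.TensorProduct.map_tmul, quotToPi_K, quotToPi_E, map_one]
  · rw [quotToPi_F, piComul_F, comul_dblSnd_F]
    simp only [map_add, Algebra.TensorProduct.map_tmul, quotToPi_mk, doubleToPi_snd, map_one,
      minusToPi_F, minusToPi_Kinv]

/-- The bialgebra isomorphism `Π ≃ 𝒟(𝔲_q) / I`. -/
def piEquiv : D.PiAlgebra ≃ₐc[k] (D.Double ⧸ D.doubleIdeal) :=
  (BialgEquiv.ofAlgEquiv D.quotEquiv D.quotToPi_counit D.quotToPi_comul).symm

end QuantumDatum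

end QuiverDouble

end

/-- The Hopf ideal property comes first because it supplies the Hopf structure on the quotient.
Compatibility with antipodes then costs nothing beyond the bialgebra isomorphism. -/
theorem mainTheorem4 {k : Type*} [Field k] (D : QuiverDouble.QuantumDatum k) :
    ∃ _ : D.doubleIdeal.IsHopfIdeal k,
      ∃ e : D.PiAlgebra ≃ₐc[k] (D.Double ⧸ D.doubleIdeal),
        ∀ x, e (HopfAlgebra.antipode k x) = HopfAlgebra.antipode k (e x) :=
  ⟨D.isHopfIdeal_doubleIdeal, D.piEquiv,
    QuiverDouble.bialgHom_antipode (D.piEquiv : D.PiAlgebra →ₐc[k] D.Double ⧸ D.doubleIdeal)⟩
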